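/- For each sample size $n$, let $W$ be a random $n\times p$ matrix of controls with rows $W_i'$ (the number $p=p_n$ of controls, the parameters and the joint distribution may change with $n$), and let $$Y_i=D_i\beta+W_i'\gamma+U_i,\quad E[U_i\mid D,W]=0,\qquad D_i=W_i'\delta+\tilde D_i,\quad E[\tilde D_i\mid W]=0,\qquad i=1,\dots,n,$$ with $D=(D_1,\dots,D_n)'$, $U=(U_1,\dots,U_n)'$, $\tilde D=(\tilde D_1,\dots,\tilde D_n)'$. Let $\ddot D=(I-P)D$, where $P=WW^{+}$ is the orthogonal projection onto the column space of $W$, and let $\hat\beta_{OLS}=\sum_i\ddot D_iY_i/\sum_i\ddot D_i^2$. Suppose that for some constants $K,\eta>0$ (not depending on $i$ or $n$), almost surely, (a) the pairs $(U_i,\tilde D_i)$, $i=1,\dots,n$, are independent conditionally on $W$; (b) $E[|U_i|^{2+\eta}\mid D,W]+E[|\tilde D_i|^4\mid W]\le K$; (c) $1/E[\tilde D_i^2\mid W]+1/E[U_i^2\mid D,W]\le K$; (d) $\limsup_{n\to\infty}p/n<1$. Suppose also that $\liminf_{n\to\infty}p/n>0$, and that the controls are not asymptotically collinear: for some constant $c>0$,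 $P(\operatorname{rank}(W)\ge c\,p)\to1$ (which holds if $W$ has full column rank). All $o_p$ statements are as $n\to\infty$. Then, for any estimator $\hat\beta_*$ with $\hat\beta_*-\beta=(\tilde D'\tilde D)^{-1}\tilde D'U+o_p(n^{-1/2})$, $$\frac{\hat\beta_{OLS}-\hat\beta_*}{s_H}\xrightarrow{d}\mathcal N(0,1),\qquad s_H^2=\sum_{i=1}^nZ_i^2U_i^2,\qquad Z_i=\frac{\ddot D_i}{\ddot D'\ddot D}-\frac{\tilde D_i}{\tilde D'\tilde D}.$$ Additionally, suppose that $W_i'\gamma=f(W_i)+r_\gamma(W_i)$ and $W_i'\delta=g(W_i)+r_\delta(W_i)$ for functions $f,g,r_\gamma,r_\delta$ (which may change with $n$) such that (i) $\frac1n\sum_iE[r_\delta(W_i)^2+r_\gamma(W_i)^2]\to0$; (ii) $\frac1n\sum_iE[r_\gamma(W_i)^2r_\delta(W_i)^2]$ is bounded; and (iii) $n\sum_i\bigl(Z_i^2U_i^2-\tilde z_i^2(U_i+r_\gamma(W_i))^2\bigr)=o_p(1)$, with $\tilde z_i=\frac{\ddot D_i}{\ddot D'\ddot D}-\frac{\tilde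 D_i+r_\delta(W_i)}{\sum_k(\tilde D_k+r_\delta(W_k))^2}$. Suppose also that random vectors $\hat U$ and $\hat D$ (for example, estimates computed from the data) satisfy (iv) $\max_i|\hat U_i-U_i-r_\gamma(W_i)|+\max_i|\hat D_i-\tilde D_i-r_\delta(W_i)|=o_p(1)$. Then $$\frac{\hat\beta_{OLS}-\hat\beta_*}{\hat s_H}\xrightarrow{d}\mathcal N(0,1),\qquad \hat s_H^2=\sum_{i=1}^n\hat Z_i^2\hat U_i^2,\qquad \hat Z_i=\frac{\ddot D_i}{\ddot D'\ddot D}-\frac{\hat D_i}{\hat D'\hat D}.$$ -/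

import Mathlib

open MeasureTheory ProbabilityTheory Filter Topology
open scoped ENNReal

/-- `X n = o_p(1)`: convergence to zero in probability of an array of real random variables, the
`n`-th of which lives on its own probability space. -/
def IsLittleOpOne {Ω : ℕ → Type*} [∀ n, MeasurableSpace (Ω n)] (P : ∀ n, Measure (Ω n))
    (X : ∀ n, Ω n → ℝ) : Prop :=
  ∀ ε : ℝ, 0 < ε → Tendsto (fun n => P n {ω | ε ≤ |X n ω|}) atTop (𝓝 0)

/-- The random elements `X i` are mutually independent conditionally on the σ-algebra `m`.
(No assumption on the underlying measurable space is needed for this definition.) -/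
def CondIndepFamily {Ω E ι : Type*} [MeasurableSpace Ω] [MeasurableSpace E]
    (μ : Measure Ω) (m : MeasurableSpace Ω) (X : ι → Ω → E) : Prop :=
  ∀ (S : Finset ι) (B : ι → Set E), (∀ i, MeasurableSet (B i)) →
    μ[(⋂ i ∈ S, X i ⁻¹' B i).indicator (fun _ => (1 : ℝ)) | m] =ᵐ[μ]
      fun ω => ∏ i ∈ S, (μ[(X i ⁻¹' B i).indicator (fun _ => (1 : ℝ)) | m]) ω

/-- The σ-algebra generated by the random matrix `W`. -/
@[reducible] def sigmaW {Ω : Type*} {n p : ℕ} (W : Ω → Matrix (Fin n) (Fin p) ℝ) :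
    MeasurableSpace Ω :=
  MeasurableSpace.comap (fun ω (i : Fin n) (j : Fin p) => W ω i j) inferInstance

/-- The σ-algebra generated by the random vector `D` and the random matrix `W`. -/
@[reducible] def sigmaDW {Ω : Type*} {n p : ℕ} (D : Ω → Fin n → ℝ)
    (W : Ω → Matrix (Fin n) (Fin p) ℝ) : MeasurableSpace Ω :=
  MeasurableSpace.comap D inferInstance ⊔ sigmaW W

/-- The space spanned by the columns of the control matrix. -/
noncomputable def controlSpace {n p : ℕ} (W : Matrix (Fin n) (Fin p) ℝ) :
    Submodule ℝ (EuclideanSpace ℝ (Fin n)) :=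
  Submodule.span ℝ (Set.range fun j : Fin p => WithLp.toLp 2 fun i => W i j)

/-- The vector of residuals `(I - P) D` from the least-squares regression of `D` on the controls,
where `P = W W⁺` is the orthogonal projection onto the space spanned by the controls. -/
noncomputable def olsResidual {n p : ℕ} (W : Matrix (Fin n) (Fin p) ℝ) (D : Fin n → ℝ) :
    Fin n → ℝ :=
  fun i => D i - (controlSpace W).starProjection (WithLp.toLp 2 D) i

/-- The OLS estimator of the coefficient on `D` in the regression of `Y` on `D` and the controls,
written in partialled-out (Frisch-Waugh-Lovell) form. -/
noncomputable def betaOLS {n p : ℕ} (W : Matrix (Fin n) (Fin p) ℝ) (D Y : Fin n → ℝ) : ℝ :=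
  (∑ i, olsResidual W D i * Y i) / ∑ i, olsResidual W D i ^ 2

/-- The weights `D̈ᵢ / D̈'D̈ - Tᵢ / T'T`, where `D̈` are the OLS residuals of `D`, and `T` is a
vector of propensity score residuals. -/
noncomputable def hausmanWeight {n p : ℕ} (W : Matrix (Fin n) (Fin p) ℝ) (D T : Fin n → ℝ) :
    Fin n → ℝ :=
  fun i => olsResidual W D i / (∑ k, olsResidual W D k ^ 2) - T i / ∑ k, T k ^ 2

/-- The standard error `(∑ zᵢ² uᵢ²)^{1/2}` of the Hausman contrast, with `z` the weights built from
the propensity score residuals `T`, and `u` a vector of outcome residuals. -/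
noncomputable def hausmanSE {n p : ℕ} (W : Matrix (Fin n) (Fin p) ℝ) (D T u : Fin n → ℝ) : ℝ :=
  Real.sqrt (∑ i, hausmanWeight W D T i ^ 2 * u i ^ 2)

/-- The array of linear models
`Yᵢ = Dᵢ β + Wᵢ'γ + Uᵢ`, `E[Uᵢ | D, W] = 0`, and `Dᵢ = Wᵢ'δ + D̃ᵢ`, `E[D̃ᵢ | W] = 0`,
for `i = 1, …, n`, with the probability space, the dimension `p` of `Wᵢ` and the parameters allowed
to change with the sample size `n`. The variable `Dt` stands for `D̃`. -/
structure IsLinearModel {Ω : ℕ → Type*} [∀ n, MeasurableSpace (Ω n)] (P : ∀ n, Measure (Ω n))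
    (p : ℕ → ℕ) (W : ∀ n, Ω n → Matrix (Fin n) (Fin (p n)) ℝ)
    (Y D U Dt : ∀ n, Ω n → Fin n → ℝ)
    (β : ℕ → ℝ) (γ δ : ∀ n, Fin (p n) → ℝ) : Prop where
  measurable_W : ∀ n i j, Measurable fun ω => W n ω i j
  measurable_U : ∀ n i, Measurable fun ω => U n ω i
  measurable_Dt : ∀ n i, Measurable fun ω => Dt n ω i
  outcome : ∀ n ω i, Y n ω i = D n ω i * β n + (W n ω i ⬝ᵥ γ n) + U n ω i
  propensity : ∀ n ω i, D n ω i = (W n ω i ⬝ᵥ δ n) + Dt n ω i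
  integrable_U : ∀ n i, Integrable (fun ω => U n ω i) (P n)
  integrable_Dt : ∀ n i, Integrable (fun ω => Dt n ω i) (P n)
  condExp_U : ∀ n i, (P n)[fun ω => U n ω i | sigmaDW (D n) (W n)] =ᵐ[P n] 0
  condExp_Dt : ∀ n i, (P n)[fun ω => Dt n ω i | sigmaW (W n)] =ᵐ[P n] 0

/-- Sampling and moment conditions on the regression errors, with constants `K, η > 0` that do not
depend on `i` or `n`. The integrability and positivity fields make sure that the conditional
expectations, and their reciprocals, are genuine ones. -/
structure ErrorConditions {Ω : ℕ → Type*} [∀ n, MeasurableSpace (Ω n)] (P : ∀ n, Measure (Ω n))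
    (p : ℕ → ℕ) (W : ∀ n, Ω n → Matrix (Fin n) (Fin (p n)) ℝ)
    (D U Dt : ∀ n, Ω n → Fin n → ℝ) (K η : ℝ) : Prop where
  K_pos : 0 < K
  eta_pos : 0 < η
  condIndep : ∀ n, CondIndepFamily (P n) (sigmaW (W n)) fun i ω => (U n ω i, Dt n ω i)
  integrable_U_rpow : ∀ n i, Integrable (fun ω => |U n ω i| ^ (2 + η)) (P n)
  integrable_Dt_pow : ∀ n i, Integrable (fun ω => |Dt n ω i| ^ 4) (P n)
  moment_upper : ∀ n i, ∀ᵐ ω ∂(P n),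
    ((P n)[fun ω' => |U n ω' i| ^ (2 + η) | sigmaDW (D n) (W n)]) ω
      + ((P n)[fun ω' => |Dt n ω' i| ^ 4 | sigmaW (W n)]) ω ≤ K
  var_Dt_pos : ∀ n i, ∀ᵐ ω ∂(P n), 0 < ((P n)[fun ω' => Dt n ω' i ^ 2 | sigmaW (W n)]) ω
  var_U_pos : ∀ n i, ∀ᵐ ω ∂(P n), 0 < ((P n)[fun ω' => U n ω' i ^ 2 | sigmaDW (D n) (W n)]) ω
  moment_lower : ∀ n i, ∀ᵐ ω ∂(P n),
    1 / ((P n)[fun ω' => Dt n ω' i ^ 2 | sigmaW (W n)]) ω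
      + 1 / ((P n)[fun ω' => U n ω' i ^ 2 | sigmaDW (D n) (W n)]) ω ≤ K
  limsup_lt : limsup (fun n => (p n : ℝ≥0∞) / (n : ℝ≥0∞)) atTop < 1

/-- The estimators `b n` of `β n` are semiparametrically efficient:
`b - β = (D̃'D̃)⁻¹ D̃'U + o_p(n^{-1/2})`. -/
def IsEfficientEstimator {Ω : ℕ → Type*} [∀ n, MeasurableSpace (Ω n)] (P : ∀ n, Measure (Ω n))
    (U Dt : ∀ n, Ω n → Fin n → ℝ) (β : ℕ → ℝ) (b : ∀ n, Ω n → ℝ) : Prop :=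
  (∀ n, Measurable (b n)) ∧
    IsLittleOpOne P fun n ω =>
      Real.sqrt n * (b n ω - β n - (∑ i, Dt n ω i * U n ω i) / ∑ i, Dt n ω i ^ 2)

/-- Conditions on the remainders `rγ(Wᵢ)`, `rδ(Wᵢ)` of approximations `f(Wᵢ)`, `g(Wᵢ)` to the
regression functions `Wᵢ'γ`, `Wᵢ'δ`. -/
structure RemainderConditions {Ω : ℕ → Type*} [∀ n, MeasurableSpace (Ω n)]
    (P : ∀ n, Measure (Ω n)) (p : ℕ → ℕ) (W : ∀ n, Ω n → Matrix (Fin n) (Fin (p n)) ℝ)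
    (D U Dt : ∀ n, Ω n → Fin n → ℝ) (γ δ : ∀ n, Fin (p n) → ℝ)
    (f g rγ rδ : ∀ n, (Fin (p n) → ℝ) → ℝ) : Prop where
  measurable_rγ : ∀ n, Measurable (rγ n)
  measurable_rδ : ∀ n, Measurable (rδ n)
  decomp_γ : ∀ n ω i, W n ω i ⬝ᵥ γ n = f n (W n ω i) + rγ n (W n ω i)
  decomp_δ : ∀ n ω i, W n ω i ⬝ᵥ δ n = g n (W n ω i) + rδ n (W n ω i)
  mean_square : Tendsto (fun n => (∑ i : Fin n, ∫⁻ ω, ENNReal.ofReal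
      (rδ n (W n ω i) ^ 2 + rγ n (W n ω i) ^ 2) ∂(P n)) / (n : ℝ≥0∞)) atTop (𝓝 0)
  mean_product : ∃ C : ℝ, ∀ᶠ n : ℕ in atTop, (∑ i : Fin n, ∫⁻ ω, ENNReal.ofReal
      (rγ n (W n ω i) ^ 2 * rδ n (W n ω i) ^ 2) ∂(P n)) / (n : ℝ≥0∞) ≤ ENNReal.ofReal C
  negligible : IsLittleOpOne P fun n ω => n * ∑ i,
    (hausmanWeight (W n ω) (D n ω) (Dt n ω) i ^ 2 * U n ω i ^ 2
      - hausmanWeight (W n ω) (D n ω) (fun k => Dt n ω k + rδ n (W n ω k)) i ^ 2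
        * (U n ω i + rγ n (W n ω i)) ^ 2)

/-- The estimated residuals `Uhat` and `Dhat` are uniformly accurate for the residuals
`Uᵢ + rγ(Wᵢ)` and `D̃ᵢ + rδ(Wᵢ)`. -/
structure ResidualAccuracy {Ω : ℕ → Type*} [∀ n, MeasurableSpace (Ω n)]
    (P : ∀ n, Measure (Ω n)) (p : ℕ → ℕ) (W : ∀ n, Ω n → Matrix (Fin n) (Fin (p n)) ℝ)
    (U Dt : ∀ n, Ω n → Fin n → ℝ) (rγ rδ : ∀ n, (Fin (p n) → ℝ) → ℝ)
    (Uhat Dhat : ∀ n, Ω n → Fin n → ℝ) : Prop where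
  measurable_Uhat : ∀ n i, Measurable fun ω => Uhat n ω i
  measurable_Dhat : ∀ n i, Measurable fun ω => Dhat n ω i
  accurate : IsLittleOpOne P fun n ω =>
    (⨆ i : Fin n, |Uhat n ω i - U n ω i - rγ n (W n ω i)|)
      + ⨆ i : Fin n, |Dhat n ω i - Dt n ω i - rδ n (W n ω i)|

section QuadraticForm

variable {Ω ι : Type*} [MeasurableSpace Ω] {μ : Measure Ω}

lemma MeasureTheory.MemLp.mul_four {X Y : Ω → ℝ} (hX : MemLp X 4 μ) (hY : MemLp Y 4 μ) :
    MemLp (fun ω => X ω * Y ω) 2 μ := by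
  have : ENNReal.HolderTriple 4 4 2 := ⟨by
    rw [← ENNReal.toReal_eq_toReal_iff' (by simp) (by simp), ENNReal.toReal_add (by simp) (by simp)]
    norm_num⟩
  exact hY.mul hX

variable {X : ι → Ω → ℝ}

lemma indepFun_of_notMem (hX : iIndepFun X μ) (hmeas : ∀ i, Measurable (X i)) {a : ι}
    {s : Finset ι} (ha : a ∉ s) {f : ℝ → ℝ} (hf : Measurable f) {g : (s → ℝ) → ℝ}
    (hg : Measurable g) :
    IndepFun (fun ω => f (X a ω)) (fun ω => g fun i : s => X i ω) μ := by
  classical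
  have := hX.indepFun_finset {a} s (by simpa using ha) hmeas
  exact this.comp (φ := fun x : (({a} : Finset ι) → ℝ) => f (x ⟨a, by simp⟩)) (ψ := g)
    (hf.comp (measurable_pi_apply _)) hg

variable [IsProbabilityMeasure μ]

lemma sq_integral_sq_le {X : Ω → ℝ} (hX : MemLp X 4 μ) :
    (∫ ω, X ω ^ 2 ∂μ) ^ 2 ≤ ∫ ω, X ω ^ 4 ∂μ := by
  have h2 : MemLp (fun ω => X ω ^ 2) 2 μ := by simpa [sq] using hX.mul_four hX
  have := variance_nonneg (fun ω => X ω ^ 2) μ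
  rw [variance_eq_sub h2] at this
  simp only [Pi.pow_apply, ← pow_mul] at this
  norm_num at this
  exact this

lemma integral_sq_sum_mul (hX : iIndepFun X μ)
    (h2 : ∀ i, MemLp (X i) 2 μ) (h0 : ∀ i, ∫ ω, X i ω ∂μ = 0) (c : ι → ℝ) (s : Finset ι) :
    ∫ ω, (∑ i ∈ s, c i * X i ω) ^ 2 ∂μ = ∑ i ∈ s, c i ^ 2 * ∫ ω, X i ω ^ 2 ∂μ := by
  have hm : ∀ i, MemLp (fun ω => c i * X i ω) 2 μ := fun i => (h2 i).const_mul _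
  have hi : ∀ i, ∫ ω, c i * X i ω ∂μ = 0 := fun i => by rw [integral_const_mul, h0, mul_zero]
  have hv : ∀ i, variance (fun ω => c i * X i ω) μ = c i ^ 2 * ∫ ω, X i ω ^ 2 ∂μ := fun i => by
    rw [variance_of_integral_eq_zero (hm i).aemeasurable (hi i), ← integral_const_mul]
    simp_rw [mul_pow]
  have hs := IndepFun.variance_sum (s := s) (X := fun i ω => c i * X i ω) (μ := μ)
    (fun i _ => hm i) (fun i _ j _ hij => (hX.indepFun hij).comp
      (φ := fun x => c i * x) (ψ := fun x => c j * x) (by fun_prop) (by fun_prop))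
  rw [← Finset.sum_congr rfl fun i _ => hv i, ← hs,
    variance_of_integral_eq_zero
      (Finset.aemeasurable_sum _ fun i _ => (hm i).aemeasurable)]
  · simp
  · simp only [Finset.sum_apply]
    rw [integral_finsetSum _ fun i _ => (hm i).integrable one_le_two]
    simp [hi]

lemma integral_sq_quadForm_sub_le {K : ℝ} (hX : iIndepFun X μ) (hmeas : ∀ i, Measurable (X i))
    (h4 : ∀ i, MemLp (X i) 4 μ) (h0 : ∀ i, ∫ ω, X i ω ∂μ = 0)
    (hK : ∀ i, ∫ ω, X i ω ^ 4 ∂μ ≤ K) {A : ι → ι → ℝ} (hA : ∀ i j, A i j = A j i)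
    (s : Finset ι) :
    MemLp (fun ω => (∑ i ∈ s, ∑ j ∈ s, A i j * (X i ω * X j ω))
      - ∑ i ∈ s, A i i * ∫ ω, X i ω ^ 2 ∂μ) 2 μ ∧
    ∫ ω, ((∑ i ∈ s, ∑ j ∈ s, A i j * (X i ω * X j ω))
      - ∑ i ∈ s, A i i * ∫ ω, X i ω ^ 2 ∂μ) ^ 2 ∂μ ≤ 8 * K * ∑ i ∈ s, ∑ j ∈ s, A i j ^ 2 := by
  classical
  have h2 : ∀ i, MemLp (X i) 2 μ := fun i => (h4 i).mono_exponent (by norm_num)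
  set v : ι → ℝ := fun i => ∫ ω, X i ω ^ 2 ∂μ with hv
  have hv0 : ∀ i, 0 ≤ v i := fun i => integral_nonneg fun ω => sq_nonneg _
  have hvK : ∀ i, v i ^ 2 ≤ K := fun i => (sq_integral_sq_le (h4 i)).trans (hK i)
  have hvv : ∀ i j, v i * v j ≤ K := fun i j => by nlinarith [sq_nonneg (v i - v j), hvK i, hvK j]
  refine ⟨(memLp_finsetSum _ fun i _ => memLp_finsetSum _ fun j _ =>
    ((h4 i).mul_four (h4 j)).const_mul _).sub (memLp_const _), ?_⟩
  induction s using Finset.induction_on with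
  | empty => simp
  | insert a s ha ih =>
    set R : Ω → ℝ := fun ω => (∑ i ∈ s, ∑ j ∈ s, A i j * (X i ω * X j ω))
      - ∑ i ∈ s, A i i * v i with hR
    set Y : Ω → ℝ := fun ω => ∑ j ∈ s, A a j * X j ω with hY
    have hRL : MemLp R 2 μ := (memLp_finsetSum _ fun i _ => memLp_finsetSum _ fun j _ =>
      ((h4 i).mul_four (h4 j)).const_mul _).sub (memLp_const _)
    have hYL : MemLp Y 4 μ := memLp_finsetSum _ fun j _ => (h4 j).const_mul _
    have hYL2 : MemLp Y 2 μ := hYL.mono_exponent (by norm_num)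
    have hXY : MemLp (fun ω => X a ω * Y ω) 2 μ := (h4 a).mul_four hYL
    have hX2 : MemLp (fun ω => X a ω ^ 2 - v a) 2 μ := by
      simp only [sq]
      exact ((h4 a).mul_four (h4 a)).sub (memLp_const (v a))
    have hsplit : ∀ ω, (∑ i ∈ insert a s, ∑ j ∈ insert a s, A i j * (X i ω * X j ω))
        - ∑ i ∈ insert a s, A i i * ∫ ω', X i ω' ^ 2 ∂μ
        = R ω + (2 * (X a ω * Y ω) + A a a * (X a ω ^ 2 - v a)) := by
      intro ω
      change _ - ∑ i ∈ insert a s, A i i * v i = _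
      simp only [Finset.sum_insert ha, Finset.sum_add_distrib, hR, hY]
      have : ∑ i ∈ s, A i a * (X i ω * X a ω) = X a ω * ∑ i ∈ s, A a i * X i ω := by
        rw [Finset.mul_sum]
        exact Finset.sum_congr rfl fun i _ => by rw [hA i a]; ring
      have h' : ∑ i ∈ s, A a i * (X a ω * X i ω) = X a ω * ∑ i ∈ s, A a i * X i ω := by
        rw [Finset.mul_sum]
        exact Finset.sum_congr rfl fun i _ => by ring
      rw [this, h']
      ring
    have gR : R = fun ω => (fun x : s → ℝ => (∑ i : s, ∑ j : s, A i j * (x i * x j))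
        - ∑ i ∈ s, A i i * v i) fun i : s => X i ω := by
      funext ω
      simp only [hR]
      rw [← Finset.sum_coe_sort s fun i => ∑ j ∈ s, A i j * (X i ω * X j ω)]
      congr 1
      exact Finset.sum_congr rfl fun i _ =>
        (Finset.sum_coe_sort s fun j => A i j * (X i ω * X j ω)).symm
    have gY : Y = fun ω => (fun x : s → ℝ => ∑ j : s, A a j * x j) fun i : s => X i ω := by
      funext ω
      exact (Finset.sum_coe_sort s fun j => A a j * X j ω).symm
    have c1 : ∫ ω, X a ω * (Y ω * R ω) ∂μ = 0 := by
      have hind : IndepFun (X a) (fun ω => Y ω * R ω) μ := by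
        rw [gY, gR]
        exact indepFun_of_notMem hX hmeas ha (f := fun x => x) measurable_id
          (g := fun x : s → ℝ => (∑ j : s, A a j * x j) * ((∑ i : s, ∑ j : s, A i j * (x i * x j))
            - ∑ i ∈ s, A i i * v i)) (by fun_prop)
      have := hind.integral_mul_eq_mul_integral (h2 a).aestronglyMeasurable
        (hYL2.aestronglyMeasurable.mul hRL.aestronglyMeasurable)
      simp only [Pi.mul_apply] at this
      rw [this, h0, zero_mul]
    have c2 : ∫ ω, (X a ω ^ 2 - v a) * R ω ∂μ = 0 := by
      have hind : IndepFun (fun ω => X a ω ^ 2 - v a) R μ := by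
        rw [gR]
        exact indepFun_of_notMem hX hmeas ha (f := fun x => x ^ 2 - v a) (by fun_prop)
          (g := fun x : s → ℝ => ((∑ i : s, ∑ j : s, A i j * (x i * x j))
            - ∑ i ∈ s, A i i * v i)) (by fun_prop)
      have := hind.integral_mul_eq_mul_integral hX2.aestronglyMeasurable
        hRL.aestronglyMeasurable
      simp only [Pi.mul_apply] at this
      rw [this, integral_sub ((h2 a).integrable_sq) (integrable_const _)]
      simp [hv]
    have c3 : ∫ ω, (X a ω * Y ω) ^ 2 ∂μ = v a * ∑ j ∈ s, A a j ^ 2 * v j := by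
      have hind : IndepFun (fun ω => X a ω ^ 2) (fun ω => Y ω ^ 2) μ := by
        rw [gY]
        exact indepFun_of_notMem hX hmeas ha (f := fun x => x ^ 2) (by fun_prop)
          (g := fun x : s → ℝ => (∑ j : s, A a j * x j) ^ 2) (by fun_prop)
      have := hind.integral_mul_eq_mul_integral (h2 a).integrable_sq.aestronglyMeasurable
        hYL2.integrable_sq.aestronglyMeasurable
      simp only [Pi.mul_apply] at this
      simp_rw [mul_pow]
      rw [this]
      congr 1
      exact integral_sq_sum_mul hX h2 h0 (fun j => A a j) s
    have c4 : ∫ ω, (X a ω ^ 2 - v a) ^ 2 ∂μ ≤ K := by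
      have hm : MemLp (fun ω => X a ω ^ 2) 2 μ := by simpa [sq] using (h4 a).mul_four (h4 a)
      have := variance_eq_integral hm.aemeasurable
      rw [← this]
      refine (variance_le_expectation_sq hm.aestronglyMeasurable).trans ?_
      simpa [← pow_mul] using hK a
    have hTL : MemLp (fun ω => 2 * (X a ω * Y ω) + A a a * (X a ω ^ 2 - v a)) 2 μ :=
      (hXY.const_mul 2).add (hX2.const_mul (A a a))
    have e1 : ∫ ω, (R ω + (2 * (X a ω * Y ω) + A a a * (X a ω ^ 2 - v a))) ^ 2 ∂μ
        ≤ ∫ ω, (R ω ^ 2 + (4 * (X a ω * (Y ω * R ω)) + 2 * A a a * ((X a ω ^ 2 - v a) * R ω))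
          + (8 * (X a ω * Y ω) ^ 2 + 2 * A a a ^ 2 * (X a ω ^ 2 - v a) ^ 2)) ∂μ := by
      have i1 : Integrable (fun ω => X a ω * (Y ω * R ω)) μ :=
        (hXY.integrable_mul hRL).congr (ae_of_all _ fun ω => by simp [mul_assoc])
      have i2 : Integrable (fun ω => (X a ω ^ 2 - v a) * R ω) μ := hX2.integrable_mul hRL
      refine integral_mono (hRL.add hTL).integrable_sq
        ((hRL.integrable_sq.add ((i1.const_mul 4).add (i2.const_mul _))).add
        ((hXY.integrable_sq.const_mul 8).add (hX2.integrable_sq.const_mul _))) fun ω => ?_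
      nlinarith [sq_nonneg (2 * (X a ω * Y ω) - A a a * (X a ω ^ 2 - v a))]
    have e2 : ∫ ω, (R ω ^ 2 + (4 * (X a ω * (Y ω * R ω)) + 2 * A a a * ((X a ω ^ 2 - v a) * R ω))
          + (8 * (X a ω * Y ω) ^ 2 + 2 * A a a ^ 2 * (X a ω ^ 2 - v a) ^ 2)) ∂μ
        = ∫ ω, R ω ^ 2 ∂μ + (8 * (v a * ∑ j ∈ s, A a j ^ 2 * v j)
          + 2 * A a a ^ 2 * ∫ ω, (X a ω ^ 2 - v a) ^ 2 ∂μ) := by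
      have i1 : Integrable (fun ω => X a ω * (Y ω * R ω)) μ :=
        (hXY.integrable_mul hRL).congr (ae_of_all _ fun ω => by simp [mul_assoc])
      have i2 : Integrable (fun ω => (X a ω ^ 2 - v a) * R ω) μ := hX2.integrable_mul hRL
      have j1 : Integrable (fun ω => 4 * (X a ω * (Y ω * R ω))
          + 2 * A a a * ((X a ω ^ 2 - v a) * R ω)) μ := (i1.const_mul 4).add (i2.const_mul _)
      have j2 : Integrable (fun ω => 8 * (X a ω * Y ω) ^ 2
          + 2 * A a a ^ 2 * (X a ω ^ 2 - v a) ^ 2) μ :=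
        (hXY.integrable_sq.const_mul 8).add (hX2.integrable_sq.const_mul _)
      have j3 : Integrable (fun ω => R ω ^ 2 + (4 * (X a ω * (Y ω * R ω))
          + 2 * A a a * ((X a ω ^ 2 - v a) * R ω))) μ := hRL.integrable_sq.add j1
      rw [integral_add j3 j2, integral_add hRL.integrable_sq j1,
        integral_add (i1.const_mul 4) (i2.const_mul _),
        integral_add (hXY.integrable_sq.const_mul 8) (hX2.integrable_sq.const_mul _)]
      simp only [integral_const_mul, c1, c2, c3]
      ring
    simp_rw [hsplit]
    refine e1.trans ?_
    rw [e2]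
    have f1 : v a * ∑ j ∈ s, A a j ^ 2 * v j ≤ K * ∑ j ∈ s, A a j ^ 2 := by
      rw [Finset.mul_sum, Finset.mul_sum]
      exact Finset.sum_le_sum fun j _ => by nlinarith [sq_nonneg (A a j), hvv a j]
    have f2 : A a a ^ 2 * ∫ ω, (X a ω ^ 2 - v a) ^ 2 ∂μ ≤ A a a ^ 2 * K :=
      mul_le_mul_of_nonneg_left c4 (sq_nonneg _)
    have hK0 : 0 ≤ K := (sq_nonneg _).trans (hvK a)
    simp only [Finset.sum_insert ha, Finset.sum_add_distrib]
    have f3 : 0 ≤ K * ∑ i ∈ s, A i a ^ 2 :=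
      mul_nonneg hK0 (Finset.sum_nonneg fun _ _ => sq_nonneg _)
    have f4 : 0 ≤ K * A a a ^ 2 := mul_nonneg hK0 (sq_nonneg _)
    have ih' : ∫ ω, R ω ^ 2 ∂μ ≤ 8 * K * ∑ i ∈ s, ∑ j ∈ s, A i j ^ 2 := ih
    linarith

/-- A concentration inequality for quadratic forms of independent variables. -/
lemma measure_quadForm_le [Fintype ι] {K : ℝ} (hX : iIndepFun X μ)
    (hmeas : ∀ i, Measurable (X i))
    (h4 : ∀ i, MemLp (X i) 4 μ) (h0 : ∀ i, ∫ ω, X i ω ∂μ = 0)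
    (hK : ∀ i, ∫ ω, X i ω ^ 4 ∂μ ≤ K) {A : ι → ι → ℝ} (hA : ∀ i j, A i j = A j i)
    {t : ℝ} (ht : 0 < t) :
    μ {ω | t ≤ |(∑ i, ∑ j, A i j * (X i ω * X j ω)) - ∑ i, A i i * ∫ ω, X i ω ^ 2 ∂μ|}
      ≤ ENNReal.ofReal (8 * K * (∑ i, ∑ j, A i j ^ 2) / t ^ 2) := by
  obtain ⟨hL, hle⟩ := integral_sq_quadForm_sub_le hX hmeas h4 h0 hK hA Finset.univ
  have hM := mul_meas_ge_le_integral_of_nonneg (ae_of_all μ fun ω => sq_nonneg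
    ((∑ i, ∑ j, A i j * (X i ω * X j ω)) - ∑ i, A i i * ∫ ω, X i ω ^ 2 ∂μ)) hL.integrable_sq (t ^ 2)
  have hset : {ω | t ≤ |(∑ i, ∑ j, A i j * (X i ω * X j ω)) - ∑ i, A i i * ∫ ω, X i ω ^ 2 ∂μ|}
      = {ω | t ^ 2 ≤ ((∑ i, ∑ j, A i j * (X i ω * X j ω))
        - ∑ i, A i i * ∫ ω, X i ω ^ 2 ∂μ) ^ 2} := by
    ext ω
    simp only [Set.mem_ofPred_eq]
    rw [← abs_of_pos ht, sq_le_sq, abs_abs]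
  rw [hset, ← ofReal_measureReal]
  refine ENNReal.ofReal_le_ofReal ?_
  rw [le_div_iff₀ (by positivity), mul_comm]
  exact hM.trans hle

lemma integral_pow_four_sum_mul_le [Fintype ι] {K : ℝ} (hX : iIndepFun X μ)
    (hmeas : ∀ i, Measurable (X i))
    (h4 : ∀ i, MemLp (X i) 4 μ) (h0 : ∀ i, ∫ ω, X i ω ∂μ = 0)
    (hK : ∀ i, ∫ ω, X i ω ^ 4 ∂μ ≤ K) (a : ι → ℝ) :
    Integrable (fun ω => (∑ i, a i * X i ω) ^ 4) μ ∧
    ∫ ω, (∑ i, a i * X i ω) ^ 4 ∂μ ≤ (16 * K + 2 * (1 + K) ^ 2) * (∑ i, a i ^ 2) ^ 2 := by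
  obtain ⟨hL, hle⟩ := integral_sq_quadForm_sub_le hX hmeas h4 h0 hK (A := fun i j => a i * a j)
    (fun i j => mul_comm _ _) Finset.univ
  set m : ℝ := ∑ i, a i * a i * ∫ ω, X i ω ^ 2 ∂μ with hm
  have hv0 : ∀ i, 0 ≤ ∫ ω, X i ω ^ 2 ∂μ := fun i => integral_nonneg fun ω => sq_nonneg _
  have hv : ∀ i, ∫ ω, X i ω ^ 2 ∂μ ≤ 1 + K := fun i => by
    nlinarith [(sq_integral_sq_le (h4 i)).trans (hK i), hv0 i,
      sq_nonneg ((∫ ω, X i ω ^ 2 ∂μ) - 1)]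
  have hm0 : 0 ≤ m := Finset.sum_nonneg fun i _ => mul_nonneg (mul_self_nonneg _) (hv0 i)
  have hm1 : m ≤ (1 + K) * ∑ i, a i ^ 2 := by
    rw [hm, Finset.mul_sum]
    exact Finset.sum_le_sum fun i _ => by nlinarith [hv i, sq_nonneg (a i)]
  have hq : ∀ ω, ∑ i, ∑ j, a i * a j * (X i ω * X j ω) = (∑ i, a i * X i ω) ^ 2 := fun ω => by
    rw [sq, Finset.sum_mul_sum]
    exact Finset.sum_congr rfl fun i _ => Finset.sum_congr rfl fun j _ => by ring
  have hs : ∑ i, ∑ j, (a i * a j) ^ 2 = (∑ i, a i ^ 2) ^ 2 := by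
    rw [sq (∑ i, a i ^ 2), Finset.sum_mul_sum]
    exact Finset.sum_congr rfl fun i _ => Finset.sum_congr rfl fun j _ => by ring
  simp_rw [hq] at hL hle
  have hI : MemLp (fun ω => (∑ i, a i * X i ω) ^ 2) 2 μ := by
    convert hL.add (memLp_const m) using 1
    funext ω; simp
  refine ⟨by simpa [← pow_mul] using hI.integrable_sq, ?_⟩
  calc ∫ ω, (∑ i, a i * X i ω) ^ 4 ∂μ
      ≤ ∫ ω, (2 * ((∑ i, a i * X i ω) ^ 2 - m) ^ 2 + 2 * m ^ 2) ∂μ := by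
        refine integral_mono (by simpa [← pow_mul] using hI.integrable_sq)
          ((hL.integrable_sq.const_mul 2).add (integrable_const _)) fun ω => ?_
        simp only
        nlinarith [sq_nonneg ((∑ i, a i * X i ω) ^ 2 - 2 * m)]
    _ = 2 * ∫ ω, ((∑ i, a i * X i ω) ^ 2 - m) ^ 2 ∂μ + 2 * m ^ 2 := by
        rw [integral_add (hL.integrable_sq.const_mul 2) (integrable_const _), integral_const_mul]
        simp
    _ ≤ 2 * (8 * K * (∑ i, a i ^ 2) ^ 2) + 2 * ((1 + K) * ∑ i, a i ^ 2) ^ 2 := by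
        rw [hs] at hle
        gcongr
    _ = _ := by ring

end QuadraticForm

section TriangularArray

lemma norm_exp_mul_I_sub_taylor_le {κ : ℝ} (hκ0 : 0 < κ) (hκ1 : κ ≤ 1) (x : ℝ) :
    ‖Complex.exp (x * Complex.I) - (1 + x * Complex.I - (x ^ 2 / 2 : ℝ))‖
      ≤ 4 * |x| ^ (2 + κ) := by
  have hz : ‖(x : ℂ) * Complex.I‖ = |x| := by simp
  by_cases hx : |x| ≤ 1
  · have h := Complex.exp_bound (x := x * Complex.I) (by rwa [hz]) (n := 3) (by norm_num)
    rw [hz] at h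
    have hs : ∑ m ∈ Finset.range 3, ((x : ℂ) * Complex.I) ^ m / (m.factorial : ℂ)
        = 1 + x * Complex.I - (x ^ 2 / 2 : ℝ) := by
      simp only [Finset.sum_range_succ, Finset.sum_range_zero, mul_pow, Complex.I_sq]
      push_cast [Nat.factorial]
      ring
    rw [hs] at h
    refine h.trans ?_
    have h3 : |x| ^ 3 ≤ |x| ^ (2 + κ) := by
      rcases (abs_nonneg x).eq_or_lt with h0 | h0
      · rw [← h0, Real.zero_rpow (by linarith)]
        norm_num
      · rw [← Real.rpow_natCast]
        exact Real.rpow_le_rpow_of_exponent_ge h0 hx (by push_cast; linarith)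
    have : (0 : ℝ) ≤ |x| ^ 3 := by positivity
    norm_num [Nat.factorial]
    linarith
  · push Not at hx
    have h2 : |x| ^ 2 ≤ |x| ^ (2 + κ) := by
      rw [← Real.rpow_natCast]
      exact Real.rpow_le_rpow_of_exponent_le hx.le (by push_cast; linarith)
    have hn : ‖(1 : ℂ) + x * Complex.I - (x ^ 2 / 2 : ℝ)‖ ≤ 1 + |x| + |x| ^ 2 / 2 := by
      refine (norm_sub_le _ _).trans (add_le_add ((norm_add_le _ _).trans ?_) ?_)
      · simp
      · rw [Complex.norm_real, Real.norm_eq_abs, abs_of_nonneg (by positivity), sq_abs]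
    calc _ ≤ 1 + (1 + |x| + |x| ^ 2 / 2) := by
          refine (norm_sub_le _ _).trans (add_le_add ?_ hn)
          rw [Complex.norm_exp_ofReal_mul_I]
      _ ≤ 4 * |x| ^ 2 := by nlinarith
      _ ≤ _ := by linarith

lemma Real.abs_exp_neg_sub_one_sub_le {x : ℝ} (hx : 0 ≤ x) :
    |Real.exp (-x) - (1 - x)| ≤ x ^ 2 := by
  have h1 := Real.add_one_le_exp (-x)
  rw [abs_of_nonneg (by linarith)]
  by_cases h : x ≤ 1
  · have := Real.abs_exp_sub_one_sub_id_le (x := -x) (by rwa [abs_neg, abs_of_nonneg hx])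
    rw [neg_sq] at this
    linarith [le_abs_self (Real.exp (-x) - 1 - -x)]
  · have : Real.exp (-x) ≤ 1 := Real.exp_le_one_iff.2 (by linarith)
    nlinarith

lemma norm_prod_sub_prod_le {ι : Type*} (s : Finset ι) (a b : ι → ℂ) (ha : ∀ i, ‖a i‖ ≤ 1)
    (hb : ∀ i, ‖b i‖ ≤ 1) : ‖∏ i ∈ s, a i - ∏ i ∈ s, b i‖ ≤ ∑ i ∈ s, ‖a i - b i‖ := by
  classical
  induction s using Finset.induction_on with
  | empty => simp
  | insert i s hi ih =>
    rw [Finset.prod_insert hi, Finset.prod_insert hi, Finset.sum_insert hi]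
    have hbs : ‖∏ i ∈ s, b i‖ ≤ 1 := by
      rw [norm_prod]
      exact Finset.prod_le_one (fun _ _ => norm_nonneg _) fun i _ => hb i
    calc ‖a i * ∏ i ∈ s, a i - b i * ∏ i ∈ s, b i‖
        = ‖a i * (∏ i ∈ s, a i - ∏ i ∈ s, b i) + (a i - b i) * ∏ i ∈ s, b i‖ := by ring_nf
      _ ≤ ‖a i‖ * ‖∏ i ∈ s, a i - ∏ i ∈ s, b i‖ + ‖a i - b i‖ * ‖∏ i ∈ s, b i‖ := by
          refine (norm_add_le _ _).trans ?_
          rw [norm_mul, norm_mul]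
      _ ≤ 1 * ‖∏ i ∈ s, a i - ∏ i ∈ s, b i‖ + ‖a i - b i‖ * 1 := by
          gcongr
          exact ha i
      _ ≤ _ := by linarith

/-- A centred law on the line, with variance at least `1 / K`, and absolute moment of order `2 + κ`
at most `K`. -/
structure MomentBounds (κ K : ℝ) (ν : Measure ℝ) : Prop where
  integrable : Integrable (fun x => |x| ^ (2 + κ)) ν
  mean : ∫ x, x ∂ν = 0
  upper : ∫ x, |x| ^ (2 + κ) ∂ν ≤ K
  lower : 1 / K ≤ ∫ x, x ^ 2 ∂ν

lemma sq_le_one_add_rpow {κ : ℝ} (hκ : 0 < κ) (x : ℝ) : x ^ 2 ≤ 1 + |x| ^ (2 + κ) := by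
  have h0 : 0 ≤ |x| ^ (2 + κ) := by positivity
  by_cases hx : |x| ≤ 1
  · rw [← sq_abs]
    nlinarith [abs_nonneg x]
  · push Not at hx
    have : |x| ^ 2 ≤ |x| ^ (2 + κ) := by
      rw [← Real.rpow_natCast]
      exact Real.rpow_le_rpow_of_exponent_le hx.le (by push_cast; linarith)
    rw [sq_abs] at this
    linarith

namespace MomentBounds

variable {κ K : ℝ} {ν : Measure ℝ} [IsProbabilityMeasure ν]

lemma memLp (h : MomentBounds κ K ν) (hκ : 0 < κ) : MemLp (fun x => x) 2 ν := by
  rw [memLp_two_iff_integrable_sq (by fun_prop)]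
  refine ((integrable_const 1).add h.integrable).mono' (by fun_prop) (ae_of_all _ fun x => ?_)
  rw [Real.norm_eq_abs, abs_of_nonneg (sq_nonneg x)]
  exact sq_le_one_add_rpow hκ x

lemma integral_sq_le (h : MomentBounds κ K ν) (hκ : 0 < κ) : ∫ x, x ^ 2 ∂ν ≤ 1 + K := by
  calc ∫ x, x ^ 2 ∂ν ≤ ∫ x, (1 + |x| ^ (2 + κ)) ∂ν :=
        integral_mono (h.memLp hκ).integrable_sq ((integrable_const 1).add h.integrable)
          fun x => sq_le_one_add_rpow hκ x
    _ = 1 + ∫ x, |x| ^ (2 + κ) ∂ν := by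
        rw [integral_add (integrable_const 1) h.integrable]
        simp
    _ ≤ _ := by linarith [h.upper]

lemma min_one (h : MomentBounds κ K ν) (hκ : 0 < κ) (hK : 0 < K) :
    MomentBounds (min κ 1) (1 + K) ν := by
  have hle : ∀ x : ℝ, |x| ^ (2 + min κ 1) ≤ 1 + |x| ^ (2 + κ) := fun x => by
    have hm : 0 < min κ 1 := lt_min hκ one_pos
    have h0 : 0 ≤ |x| ^ (2 + κ) := by positivity
    by_cases hx : |x| ≤ 1
    · have := Real.rpow_le_one (abs_nonneg x) hx (z := 2 + min κ 1) (by linarith)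
      linarith
    · push Not at hx
      have := Real.rpow_le_rpow_of_exponent_le hx.le
        (show 2 + min κ 1 ≤ 2 + κ by linarith [min_le_left κ 1])
      linarith
  have hi : Integrable (fun x => |x| ^ (2 + min κ 1)) ν :=
    ((integrable_const 1).add h.integrable).mono'
      (measurable_id.abs.pow_const _).aestronglyMeasurable (ae_of_all _ fun x => by
        rw [Real.norm_eq_abs, abs_of_nonneg (by positivity)]
        exact hle x)
  refine ⟨hi, h.mean, ?_, le_trans ?_ h.lower⟩
  · calc ∫ x, |x| ^ (2 + min κ 1) ∂ν ≤ ∫ x, (1 + |x| ^ (2 + κ)) ∂ν :=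
          integral_mono hi ((integrable_const 1).add h.integrable) hle
      _ = 1 + ∫ x, |x| ^ (2 + κ) ∂ν := by
          rw [integral_add (integrable_const 1) h.integrable]
          simp
      _ ≤ _ := by linarith [h.upper]
  · exact one_div_le_one_div_of_le hK (by linarith)

lemma norm_integral_exp_sub_le (h : MomentBounds κ K ν) (hκ0 : 0 < κ) (hκ1 : κ ≤ 1) (s : ℝ) :
    ‖∫ x, Complex.exp ((s * x : ℝ) * Complex.I) ∂ν
      - (Real.exp (-(s ^ 2 * (∫ x, x ^ 2 ∂ν) / 2)) : ℝ)‖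
      ≤ 4 * K * |s| ^ (2 + κ) + (s ^ 2 * (∫ x, x ^ 2 ∂ν) / 2) ^ 2 := by
  set v := ∫ x, x ^ 2 ∂ν with hv
  have hv0 : 0 ≤ v := integral_nonneg fun x => sq_nonneg x
  have hm := h.memLp hκ0
  have hi1 : Integrable (fun x : ℝ => Complex.exp ((s * x : ℝ) * Complex.I)) ν :=
    (integrable_const (1 : ℝ)).mono' (by fun_prop) (ae_of_all _ fun x => by
      rw [Complex.norm_exp_ofReal_mul_I])
  have hix : Integrable (fun x : ℝ => ((s * x : ℝ) : ℂ) * Complex.I) ν :=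
    (((hm.integrable one_le_two).const_mul s).ofReal).mul_const _
  have hi2 : Integrable (fun x : ℝ => ((((s * x) ^ 2 / 2 : ℝ)) : ℂ)) ν := by
    have : Integrable (fun x : ℝ => (s * x) ^ 2 / 2) ν := by
      simp only [mul_pow]
      exact (hm.integrable_sq.const_mul _).div_const _
    exact this.ofReal
  have hT : ∫ x : ℝ, ((1 : ℂ) + (s * x : ℝ) * Complex.I - ((s * x) ^ 2 / 2 : ℝ)) ∂ν
      = ((1 - s ^ 2 * v / 2 : ℝ) : ℂ) := by
    have e1 : ∫ x : ℝ, ((s * x : ℝ) : ℂ) * Complex.I ∂ν = 0 := by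
      rw [integral_mul_const, integral_complex_ofReal, integral_const_mul, h.mean]
      simp
    have e2 : ∫ x : ℝ, ((((s * x) ^ 2 / 2 : ℝ)) : ℂ) ∂ν = ((s ^ 2 * v / 2 : ℝ) : ℂ) := by
      rw [integral_complex_ofReal]
      simp only [mul_pow, integral_div, integral_const_mul]
      rw [← hv]
    have hi0 : Integrable (fun x : ℝ => (1 : ℂ) + (s * x : ℝ) * Complex.I) ν :=
      (integrable_const 1).add hix
    rw [integral_sub hi0 hi2, integral_add (integrable_const 1) hix, e1, e2]
    simp
  have h1 : ‖∫ x, Complex.exp ((s * x : ℝ) * Complex.I) ∂ν - ((1 - s ^ 2 * v / 2 : ℝ) : ℂ)‖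
      ≤ 4 * K * |s| ^ (2 + κ) := by
    have hi3 : Integrable (fun x : ℝ => (1 : ℂ) + (s * x : ℝ) * Complex.I
        - ((s * x) ^ 2 / 2 : ℝ)) ν := ((integrable_const 1).add hix).sub hi2
    rw [← hT, ← integral_sub hi1 hi3]
    calc _ ≤ ∫ x, 4 * |s| ^ (2 + κ) * |x| ^ (2 + κ) ∂ν := by
          refine norm_integral_le_of_norm_le (h.integrable.const_mul _) (ae_of_all _ fun x => ?_)
          refine (norm_exp_mul_I_sub_taylor_le hκ0 hκ1 (s * x)).trans_eq ?_
          rw [abs_mul, Real.mul_rpow (abs_nonneg _) (abs_nonneg _), mul_assoc]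
      _ = 4 * |s| ^ (2 + κ) * ∫ x, |x| ^ (2 + κ) ∂ν := integral_const_mul _ _
      _ ≤ 4 * |s| ^ (2 + κ) * K := by gcongr; exact h.upper
      _ = _ := by ring
  have h2 : ‖((1 - s ^ 2 * v / 2 : ℝ) : ℂ) - (Real.exp (-(s ^ 2 * v / 2)) : ℝ)‖
      ≤ (s ^ 2 * v / 2) ^ 2 := by
    rw [← Complex.ofReal_sub, Complex.norm_real, Real.norm_eq_abs, abs_sub_comm]
    exact Real.abs_exp_neg_sub_one_sub_le (by positivity)
  calc _ = ‖(∫ x, Complex.exp ((s * x : ℝ) * Complex.I) ∂ν - ((1 - s ^ 2 * v / 2 : ℝ) : ℂ))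
        + (((1 - s ^ 2 * v / 2 : ℝ) : ℂ) - (Real.exp (-(s ^ 2 * v / 2)) : ℝ))‖ := by
        rw [sub_add_sub_cancel]
    _ ≤ _ := (norm_add_le _ _).trans (add_le_add h1 h2)

end MomentBounds

variable {κ K : ℝ}

lemma sum_sq_le_of_momentBounds {n : ℕ} {ν : Fin n → Measure ℝ}
    (h : ∀ i, MomentBounds κ K (ν i)) (hK : 0 < K) {c : Fin n → ℝ}
    (hc : ∑ i, c i ^ 2 * ∫ x, x ^ 2 ∂(ν i) = 1) : ∑ i, c i ^ 2 ≤ K := by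
  have : ∑ i, c i ^ 2 * (1 / K) ≤ 1 := by
    refine le_trans ?_ hc.le
    exact Finset.sum_le_sum fun i _ => mul_le_mul_of_nonneg_left (h i).lower (sq_nonneg _)
  rw [← Finset.sum_mul, mul_one_div, div_le_one hK] at this
  exact this

/-- Lyapunov's central limit theorem, in terms of characteristic functions: the error is small,
uniformly over all weights that are small. -/
lemma exists_charFun_pi_sub_le (hκ0 : 0 < κ) (hκ1 : κ ≤ 1) (hK : 0 < K) (t : ℝ) {δ : ℝ}
    (hδ : 0 < δ) : ∃ ε : ℝ, 0 < ε ∧ ∀ (n : ℕ) (ν : Fin n → Measure ℝ)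
      [∀ i, IsProbabilityMeasure (ν i)], (∀ i, MomentBounds κ K (ν i)) → ∀ c : Fin n → ℝ,
      (∀ i, |c i| ≤ ε) → ∑ i, c i ^ 2 * ∫ x, x ^ 2 ∂(ν i) = 1 →
      ‖∫ u, Complex.exp ((t * ∑ i, c i * u i : ℝ) * Complex.I) ∂(Measure.pi ν)
        - (Real.exp (-(t ^ 2 / 2)) : ℝ)‖ ≤ δ := by
  have hlim : Tendsto (fun ε : ℝ => 4 * K * |t| ^ (2 + κ) * K * ε ^ κ
      + t ^ 4 / 4 * (1 + K) * ε ^ 2) (𝓝[>] 0) (𝓝 0) := by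
    have h1 : Tendsto (fun ε : ℝ => ε ^ κ) (𝓝[>] 0) (𝓝 0) := by
      have := (Real.continuousAt_rpow_const 0 κ (Or.inr hκ0.le)).tendsto
      rw [Real.zero_rpow hκ0.ne'] at this
      exact this.mono_left nhdsWithin_le_nhds
    have h2 : Tendsto (fun ε : ℝ => ε ^ 2) (𝓝[>] 0) (𝓝 0) := by
      have : Tendsto (fun ε : ℝ => ε ^ 2) (𝓝 0) (𝓝 (0 ^ 2)) := (continuous_pow 2).tendsto 0
      rw [zero_pow two_ne_zero] at this
      exact this.mono_left nhdsWithin_le_nhds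
    simpa using (h1.const_mul (4 * K * |t| ^ (2 + κ) * K)).add
      (h2.const_mul (t ^ 4 / 4 * (1 + K)))
  obtain ⟨ε, hε, hε0⟩ := ((hlim.eventually (gt_mem_nhds hδ)).and
    (eventually_mem_nhdsWithin (a := (0 : ℝ)) (s := Set.Ioi 0))).exists
  have hε0 : 0 < ε := hε0
  refine ⟨ε, hε0, fun n ν _ h c hcε hc => ?_⟩
  have hcK := sum_sq_le_of_momentBounds h hK hc
  set v : Fin n → ℝ := fun i => ∫ x, x ^ 2 ∂(ν i) with hv
  have hv0 : ∀ i, 0 ≤ v i := fun i => integral_nonneg fun x => sq_nonneg x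
  have hvK : ∀ i, v i ≤ 1 + K := fun i => (h i).integral_sq_le hκ0
  have hprod : ∫ u, Complex.exp ((t * ∑ i, c i * u i : ℝ) * Complex.I) ∂(Measure.pi ν)
      = ∏ i, ∫ x, Complex.exp ((t * c i * x : ℝ) * Complex.I) ∂(ν i) := by
    rw [← integral_fintype_prod_eq_prod (μ := ν)
      (fun i (x : ℝ) => Complex.exp ((t * c i * x : ℝ) * Complex.I))]
    congr 1
    funext u
    rw [← Complex.exp_sum]
    congr 1
    rw [← Finset.sum_mul, ← Complex.ofReal_sum, Finset.mul_sum]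
    simp_rw [mul_assoc]
  have hexp : ((Real.exp (-(t ^ 2 / 2)) : ℝ) : ℂ)
      = ∏ i, ((Real.exp (-((t * c i) ^ 2 * v i / 2)) : ℝ) : ℂ) := by
    rw [← Complex.ofReal_prod, ← Real.exp_sum]
    congr 2
    have : ∑ i, c i ^ 2 * v i = 1 := hc
    calc -(t ^ 2 / 2) = -(t ^ 2 / 2) * ∑ i, c i ^ 2 * v i := by rw [this, mul_one]
      _ = _ := by
        rw [Finset.mul_sum]
        exact Finset.sum_congr rfl fun i _ => by ring
  rw [hprod, hexp]
  refine (norm_prod_sub_prod_le _ _ _ (fun i => ?_) fun i => ?_).trans ?_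
  · refine (norm_integral_le_integral_norm _).trans ?_
    simp_rw [Complex.norm_exp_ofReal_mul_I]
    simp
  · rw [Complex.norm_real, Real.norm_eq_abs, abs_of_pos (Real.exp_pos _), Real.exp_le_one_iff]
    have := hv0 i
    have : 0 ≤ (t * c i) ^ 2 * v i / 2 := by positivity
    linarith
  · have hterm : ∀ i, ‖∫ x, Complex.exp ((t * c i * x : ℝ) * Complex.I) ∂(ν i)
        - ((Real.exp (-((t * c i) ^ 2 * v i / 2)) : ℝ) : ℂ)‖
        ≤ 4 * K * |t| ^ (2 + κ) * ε ^ κ * c i ^ 2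
          + t ^ 4 / 4 * (1 + K) * ε ^ 2 * (c i ^ 2 * v i) := fun i => by
      refine ((h i).norm_integral_exp_sub_le hκ0 hκ1 (t * c i)).trans (add_le_add ?_ ?_)
      · have h1 : |c i| ^ (2 + κ) ≤ ε ^ κ * c i ^ 2 := by
          have : |c i| ^ (2 + κ) = |c i| ^ 2 * |c i| ^ κ := by
            rcases (abs_nonneg (c i)).eq_or_lt with h0 | h0
            · rw [← h0, Real.zero_rpow (by linarith)]
              simp
            · rw [Real.rpow_add h0]
              simp
          rw [this, sq_abs, mul_comm]
          exact mul_le_mul_of_nonneg_right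
            (Real.rpow_le_rpow (abs_nonneg _) (hcε i) hκ0.le) (sq_nonneg _)
        rw [abs_mul, Real.mul_rpow (abs_nonneg _) (abs_nonneg _)]
        calc 4 * K * (|t| ^ (2 + κ) * |c i| ^ (2 + κ))
            ≤ 4 * K * (|t| ^ (2 + κ) * (ε ^ κ * c i ^ 2)) := by gcongr
          _ = _ := by ring
      · have h2 : c i ^ 2 ≤ ε ^ 2 := by
          rw [← sq_abs]
          exact pow_le_pow_left₀ (abs_nonneg _) (hcε i) 2
        have h3 : c i ^ 2 * v i ≤ ε ^ 2 * (1 + K) :=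
          mul_le_mul h2 (hvK i) (hv0 i) (sq_nonneg _)
        have h4 : 0 ≤ c i ^ 2 * v i := mul_nonneg (sq_nonneg _) (hv0 i)
        calc ((t * c i) ^ 2 * v i / 2) ^ 2
            = t ^ 4 / 4 * (c i ^ 2 * v i * (c i ^ 2 * v i)) := by ring
          _ ≤ t ^ 4 / 4 * (ε ^ 2 * (1 + K) * (c i ^ 2 * v i)) := by gcongr
          _ = _ := by ring
    calc _ ≤ ∑ i, (4 * K * |t| ^ (2 + κ) * ε ^ κ * c i ^ 2
          + t ^ 4 / 4 * (1 + K) * ε ^ 2 * (c i ^ 2 * v i)) :=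
          Finset.sum_le_sum fun i _ => hterm i
      _ = 4 * K * |t| ^ (2 + κ) * ε ^ κ * ∑ i, c i ^ 2 + t ^ 4 / 4 * (1 + K) * ε ^ 2 * 1 := by
          rw [Finset.sum_add_distrib, ← Finset.mul_sum, ← Finset.mul_sum, ← hc]
      _ ≤ 4 * K * |t| ^ (2 + κ) * ε ^ κ * K + t ^ 4 / 4 * (1 + K) * ε ^ 2 * 1 := by gcongr
      _ = 4 * K * |t| ^ (2 + κ) * K * ε ^ κ + t ^ 4 / 4 * (1 + K) * ε ^ 2 := by ring
      _ ≤ δ := hε.le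

lemma measure_pi_abs_sum_ge_le {n : ℕ} {ν : Fin n → Measure ℝ} [∀ i, IsProbabilityMeasure (ν i)]
    (hκ0 : 0 < κ) (h : ∀ i, MomentBounds κ K (ν i)) {c : Fin n → ℝ}
    (hc : ∑ i, c i ^ 2 * ∫ x, x ^ 2 ∂(ν i) = 1) {M : ℝ} (hM : 0 < M) :
    Measure.pi ν {u | M ≤ |∑ i, c i * u i|} ≤ ENNReal.ofReal (1 / M ^ 2) := by
  have hind : iIndepFun (fun (i : Fin n) (u : Fin n → ℝ) => u i) (Measure.pi ν) :=
    iIndepFun_pi (X := fun _ x => x) fun i => by fun_prop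
  have hL : ∀ i, MemLp (fun u : Fin n → ℝ => u i) 2 (Measure.pi ν) := fun i =>
    ((h i).memLp hκ0).comp_measurePreserving (measurePreserving_eval ν i)
  have e1 : ∀ i, ∫ u : Fin n → ℝ, u i ∂(Measure.pi ν) = 0 := fun i => by
    rw [integral_comp_eval (μ := ν) (i := i) (f := fun x : ℝ => x) (by fun_prop), (h i).mean]
  have e2 : ∀ i, ∫ u : Fin n → ℝ, u i ^ 2 ∂(Measure.pi ν) = ∫ x, x ^ 2 ∂(ν i) := fun i =>
    integral_comp_eval (μ := ν) (i := i) (f := fun x : ℝ => x ^ 2) (by fun_prop)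
  have hint := integral_sq_sum_mul hind hL e1 c Finset.univ
  simp_rw [e2, hc] at hint
  have hi : Integrable (fun u : Fin n → ℝ => (∑ i, c i * u i) ^ 2) (Measure.pi ν) :=
    (memLp_finsetSum _ fun i _ => (hL i).const_mul (c i)).integrable_sq
  have hMk := mul_meas_ge_le_integral_of_nonneg (ae_of_all (Measure.pi ν) fun u : Fin n → ℝ =>
    sq_nonneg (∑ i, c i * u i)) hi (M ^ 2)
  have hset : {u : Fin n → ℝ | M ≤ |∑ i, c i * u i|} = {u | M ^ 2 ≤ (∑ i, c i * u i) ^ 2} := by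
    ext u
    simp only [Set.mem_ofPred_eq]
    rw [← abs_of_pos hM, sq_le_sq, abs_abs]
  rw [hset, ← ofReal_measureReal]
  refine ENNReal.ofReal_le_ofReal ?_
  rw [le_div_iff₀ (by positivity), mul_comm]
  exact hMk.trans hint.le

end TriangularArray

section WeakLaw

variable {κ K : ℝ}

lemma measure_pi_abs_sum_sub_ge_le {n : ℕ} {ν : Fin n → Measure ℝ}
    [∀ i, IsProbabilityMeasure (ν i)] {g : ℝ → ℝ} (hg : Measurable g) {B : ℝ}
    (hB : ∀ x, |g x| ≤ B) (w : Fin n → ℝ) {t : ℝ} (ht : 0 < t) :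
    Measure.pi ν {u | t ≤ |∑ i, w i * (g (u i) - ∫ x, g x ∂(ν i))|}
      ≤ ENNReal.ofReal (B ^ 2 * (∑ i, w i ^ 2) / t ^ 2) := by
  have hind : iIndepFun (fun (i : Fin n) (u : Fin n → ℝ) => g (u i) - ∫ x, g x ∂(ν i))
      (Measure.pi ν) :=
    iIndepFun_pi (X := fun i x => g x - ∫ x, g x ∂(ν i)) fun i => by fun_prop
  have hg2 : ∀ i, MemLp g 2 (ν i) := fun i =>
    MemLp.of_bound hg.aestronglyMeasurable B (ae_of_all _ hB)
  have hL0 : ∀ i, MemLp (fun x => g x - ∫ x, g x ∂(ν i)) 2 (ν i) := fun i =>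
    (hg2 i).sub (memLp_const _)
  have hL : ∀ i, MemLp (fun u : Fin n → ℝ => g (u i) - ∫ x, g x ∂(ν i)) 2 (Measure.pi ν) :=
    fun i => (hL0 i).comp_measurePreserving (measurePreserving_eval ν i)
  have e1 : ∀ i, ∫ u : Fin n → ℝ, (g (u i) - ∫ x, g x ∂(ν i)) ∂(Measure.pi ν) = 0 := fun i => by
    rw [integral_comp_eval (μ := ν) (i := i) (f := fun x : ℝ => g x - ∫ x, g x ∂(ν i))
      (hL0 i).aestronglyMeasurable, integral_sub ((hg2 i).integrable one_le_two)
      (integrable_const _)]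
    simp
  have e2 : ∀ i, ∫ u : Fin n → ℝ, (g (u i) - ∫ x, g x ∂(ν i)) ^ 2 ∂(Measure.pi ν) ≤ B ^ 2 :=
    fun i => by
      rw [integral_comp_eval (μ := ν) (i := i) (f := fun x : ℝ => (g x - ∫ x, g x ∂(ν i)) ^ 2)
        (hL0 i).integrable_sq.aestronglyMeasurable, ← variance_eq_integral hg.aemeasurable]
      refine (variance_le_expectation_sq hg.aestronglyMeasurable).trans ?_
      calc ∫ x, (g ^ 2) x ∂(ν i) ≤ ∫ _, B ^ 2 ∂(ν i) :=
            integral_mono (hg2 i).integrable_sq (integrable_const _) fun x => by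
              simp only [Pi.pow_apply]
              rw [← sq_abs]
              exact pow_le_pow_left₀ (abs_nonneg _) (hB x) 2
        _ = B ^ 2 := by simp
  have hint := integral_sq_sum_mul hind hL e1 w Finset.univ
  have hi : Integrable (fun u : Fin n → ℝ => (∑ i, w i * (g (u i) - ∫ x, g x ∂(ν i))) ^ 2)
      (Measure.pi ν) := (memLp_finsetSum _ fun i _ => (hL i).const_mul (w i)).integrable_sq
  have hMk := mul_meas_ge_le_integral_of_nonneg (ae_of_all (Measure.pi ν) fun u : Fin n → ℝ =>
    sq_nonneg (∑ i, w i * (g (u i) - ∫ x, g x ∂(ν i)))) hi (t ^ 2)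
  have hset : {u : Fin n → ℝ | t ≤ |∑ i, w i * (g (u i) - ∫ x, g x ∂(ν i))|}
      = {u | t ^ 2 ≤ (∑ i, w i * (g (u i) - ∫ x, g x ∂(ν i))) ^ 2} := by
    ext u
    simp only [Set.mem_ofPred_eq]
    rw [← abs_of_pos ht, sq_le_sq, abs_abs]
  rw [hset, ← ofReal_measureReal]
  refine ENNReal.ofReal_le_ofReal ?_
  rw [le_div_iff₀ (by positivity), mul_comm]
  refine hMk.trans (hint.le.trans ?_)
  rw [Finset.mul_sum]
  exact Finset.sum_le_sum fun i _ => by nlinarith [e2 i, sq_nonneg (w i)]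

lemma measure_pi_sum_ge_le {n : ℕ} {ν : Fin n → Measure ℝ}
    [∀ i, IsProbabilityMeasure (ν i)] {h : ℝ → ℝ} (hi : ∀ i, Integrable h (ν i))
    (h0 : ∀ x, 0 ≤ h x) {B : ℝ} (hB : ∀ i, ∫ x, h x ∂(ν i) ≤ B) {w : Fin n → ℝ}
    (hw : ∀ i, 0 ≤ w i) {t : ℝ} (ht : 0 < t) :
    Measure.pi ν {u | t ≤ ∑ i, w i * h (u i)} ≤ ENNReal.ofReal (B * (∑ i, w i) / t) := by
  have hi' : ∀ i, Integrable (fun u : Fin n → ℝ => h (u i)) (Measure.pi ν) := fun i =>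
    integrable_comp_eval (μ := ν) (i := i) (hi i)
  have hs : Integrable (fun u : Fin n → ℝ => ∑ i, w i * h (u i)) (Measure.pi ν) :=
    integrable_finsetSum _ fun i _ => (hi' i).const_mul _
  have hMk := mul_meas_ge_le_integral_of_nonneg (ae_of_all (Measure.pi ν) fun u : Fin n → ℝ =>
    Finset.sum_nonneg fun i _ => mul_nonneg (hw i) (h0 (u i))) hs t
  rw [← ofReal_measureReal]
  refine ENNReal.ofReal_le_ofReal ?_
  rw [le_div_iff₀ ht, mul_comm]
  refine hMk.trans ?_
  rw [integral_finsetSum _ fun i _ => (hi' i).const_mul _, Finset.mul_sum]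
  refine Finset.sum_le_sum fun i _ => ?_
  rw [integral_const_mul, integral_comp_eval (μ := ν) (i := i) (hi i).aestronglyMeasurable,
    mul_comm]
  exact mul_le_mul_of_nonneg_right (hB i) (hw i)

lemma sq_sub_min_le {κ T : ℝ} (hκ : 0 < κ) (hT : 0 < T) (x : ℝ) :
    x ^ 2 - min (x ^ 2) (T ^ 2) ≤ |x| ^ (2 + κ) * T ^ (-κ) := by
  by_cases hx : |x| ≤ T
  · have : x ^ 2 ≤ T ^ 2 := by
      rw [← sq_abs]
      exact pow_le_pow_left₀ (abs_nonneg _) hx 2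
    rw [min_eq_left this, sub_self]
    positivity
  · push Not at hx
    have hx0 : 0 < |x| := hT.trans hx
    have h1 : 0 ≤ min (x ^ 2) (T ^ 2) := le_min (sq_nonneg _) (sq_nonneg _)
    have h2 : |x| ^ (2 + κ) * T ^ (-κ) = x ^ 2 * (|x| / T) ^ κ := by
      rw [Real.rpow_add hx0, Real.div_rpow hx0.le hT.le, Real.rpow_neg hT.le]
      simp only [Real.rpow_ofNat, sq_abs]
      ring
    have h3 : 1 ≤ (|x| / T) ^ κ := Real.one_le_rpow ((one_le_div hT).2 hx.le) hκ.le
    rw [h2]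
    nlinarith [sq_nonneg x]

/-- A weak law of large numbers for weighted squares, uniform over small weights. -/
lemma exists_measure_pi_sum_sq_sub_one_le (hκ : 0 < κ) (hK : 0 < K) {δ : ℝ} (hδ : 0 < δ) :
    ∃ ε : ℝ, 0 < ε ∧ ∀ (n : ℕ) (ν : Fin n → Measure ℝ)
      [∀ i, IsProbabilityMeasure (ν i)], (∀ i, MomentBounds κ K (ν i)) → ∀ c : Fin n → ℝ,
      (∀ i, |c i| ≤ ε) → ∑ i, c i ^ 2 * ∫ x, x ^ 2 ∂(ν i) = 1 →
      Measure.pi ν {u | δ ≤ |∑ i, c i ^ 2 * u i ^ 2 - 1|} ≤ ENNReal.ofReal δ := by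
  obtain ⟨T, hT, hT0⟩ : ∃ T : ℝ, K * T ^ (-κ) * K ≤ δ * δ / 8 ∧ 0 < T := by
    have h1 : Tendsto (fun T : ℝ => K * T ^ (-κ) * K) atTop (𝓝 0) := by
      simpa using ((tendsto_rpow_neg_atTop hκ).const_mul K).mul_const K
    obtain ⟨T, hT⟩ := ((h1.eventually (gt_mem_nhds (show 0 < δ * δ / 8 by positivity))).and
      (eventually_gt_atTop 0)).exists
    exact ⟨T, hT.1.le, hT.2⟩
  have hbd : 0 ≤ K * T ^ (-κ) := by positivity
  obtain ⟨ε, hε0, hε⟩ : ∃ ε : ℝ, 0 < ε ∧ (T ^ 2) ^ 2 * (ε ^ 2 * K) / (δ / 2) ^ 2 ≤ δ / 2 := by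
    have h2 : Tendsto (fun ε : ℝ => (T ^ 2) ^ 2 * (ε ^ 2 * K) / (δ / 2) ^ 2) (𝓝[>] 0) (𝓝 0) := by
      have : Continuous (fun ε : ℝ => (T ^ 2) ^ 2 * (ε ^ 2 * K) / (δ / 2) ^ 2) := by fun_prop
      have := this.tendsto 0
      simp only [ne_eq, OfNat.ofNat_ne_zero, not_false_eq_true, zero_pow, zero_mul, mul_zero,
        zero_div] at this
      exact this.mono_left nhdsWithin_le_nhds
    obtain ⟨ε, hε, hε0⟩ := ((h2.eventually (gt_mem_nhds (show 0 < δ / 2 by positivity))).and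
      (eventually_mem_nhdsWithin (a := (0 : ℝ)) (s := Set.Ioi 0))).exists
    exact ⟨ε, hε0, hε.le⟩
  refine ⟨ε, hε0, fun n ν _ h c hcε hc => ?_⟩
  have hcK := sum_sq_le_of_momentBounds h hK hc
  set g : ℝ → ℝ := fun x => min (x ^ 2) (T ^ 2) with hg
  set r : ℝ → ℝ := fun x => x ^ 2 - g x with hr
  have hgm : Measurable g := by fun_prop
  have hg0 : ∀ x, 0 ≤ g x := fun x => le_min (sq_nonneg _) (sq_nonneg _)
  have hgB : ∀ x, |g x| ≤ T ^ 2 := fun x => by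
    rw [abs_of_nonneg (hg0 x)]
    exact min_le_right _ _
  have hgi : ∀ i, Integrable g (ν i) := fun i =>
    (MemLp.of_bound (p := 1) hgm.aestronglyMeasurable _ (ae_of_all _ hgB)).integrable le_rfl
  have hi2 : ∀ i, Integrable (fun x : ℝ => x ^ 2) (ν i) := fun i => ((h i).memLp hκ).integrable_sq
  have hri : ∀ i, Integrable r (ν i) := fun i => (hi2 i).sub (hgi i)
  have hr0 : ∀ x, 0 ≤ r x := fun x => sub_nonneg.2 (min_le_left _ _)
  have hrB : ∀ i, ∫ x, r x ∂(ν i) ≤ K * T ^ (-κ) := fun i => by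
    calc ∫ x, r x ∂(ν i) ≤ ∫ x, |x| ^ (2 + κ) * T ^ (-κ) ∂(ν i) :=
          integral_mono (hri i) ((h i).integrable.mul_const _) fun x => sq_sub_min_le hκ hT0 x
      _ = (∫ x, |x| ^ (2 + κ) ∂(ν i)) * T ^ (-κ) := integral_mul_const _ _
      _ ≤ _ := mul_le_mul_of_nonneg_right (h i).upper (by positivity)
  have hrB0 : ∀ i, 0 ≤ ∫ x, r x ∂(ν i) := fun i => integral_nonneg hr0
  -- the centred sum splits into a bounded part and a remainder
  have hsplit : ∀ u : Fin n → ℝ, ∑ i, c i ^ 2 * u i ^ 2 - 1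
      = ∑ i, c i ^ 2 * (g (u i) - ∫ x, g x ∂(ν i))
        + (∑ i, c i ^ 2 * r (u i) - ∑ i, c i ^ 2 * ∫ x, r x ∂(ν i)) := fun u => by
    rw [← hc, ← Finset.sum_sub_distrib, ← Finset.sum_sub_distrib, ← Finset.sum_add_distrib]
    refine Finset.sum_congr rfl fun i _ => ?_
    have : ∫ x, r x ∂(ν i) = ∫ x, x ^ 2 ∂(ν i) - ∫ x, g x ∂(ν i) := integral_sub (hi2 i) (hgi i)
    rw [this]
    simp only [hr]
    ring
  have hmean : ∑ i, c i ^ 2 * ∫ x, r x ∂(ν i) ≤ K * T ^ (-κ) * K := by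
    calc _ ≤ ∑ i, c i ^ 2 * (K * T ^ (-κ)) :=
          Finset.sum_le_sum fun i _ => mul_le_mul_of_nonneg_left (hrB i) (sq_nonneg _)
      _ = (∑ i, c i ^ 2) * (K * T ^ (-κ)) := by rw [Finset.sum_mul]
      _ ≤ K * (K * T ^ (-κ)) := mul_le_mul_of_nonneg_right hcK hbd
      _ = _ := by ring
  have hmean0 : 0 ≤ ∑ i, c i ^ 2 * ∫ x, r x ∂(ν i) :=
    Finset.sum_nonneg fun i _ => mul_nonneg (sq_nonneg _) (hrB0 i)
  by_cases hδ1 : 1 ≤ δ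
  · refine prob_le_one.trans ?_
    rw [← ENNReal.ofReal_one]
    exact ENNReal.ofReal_le_ofReal hδ1
  push Not at hδ1
  have hmean' : ∑ i, c i ^ 2 * ∫ x, r x ∂(ν i) ≤ δ / 4 := by nlinarith
  have hsub : {u : Fin n → ℝ | δ ≤ |∑ i, c i ^ 2 * u i ^ 2 - 1|}
      ⊆ {u | δ / 2 ≤ |∑ i, c i ^ 2 * (g (u i) - ∫ x, g x ∂(ν i))|}
        ∪ {u | δ / 4 ≤ ∑ i, c i ^ 2 * r (u i)} := fun u hu => by
    by_contra hcon
    simp only [Set.mem_union, Set.mem_ofPred_eq, not_or, not_le] at hcon hu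
    rw [hsplit] at hu
    have hr' : 0 ≤ ∑ i, c i ^ 2 * r (u i) :=
      Finset.sum_nonneg fun i _ => mul_nonneg (sq_nonneg _) (hr0 _)
    have h1 := abs_add_le (∑ i, c i ^ 2 * (g (u i) - ∫ x, g x ∂(ν i)))
      (∑ i, c i ^ 2 * r (u i) - ∑ i, c i ^ 2 * ∫ x, r x ∂(ν i))
    have h2 : |∑ i, c i ^ 2 * r (u i) - ∑ i, c i ^ 2 * ∫ x, r x ∂(ν i)| ≤ δ / 4 := by
      rw [abs_le]
      constructor <;> linarith [hcon.2]
    linarith [hcon.1]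
  refine (measure_mono hsub).trans ((measure_union_le _ _).trans ?_)
  have b1 := measure_pi_abs_sum_sub_ge_le (ν := ν) hgm hgB (fun i => c i ^ 2)
    (show 0 < δ / 2 by positivity)
  have b2 := measure_pi_sum_ge_le (ν := ν) hri hr0 hrB (fun i => sq_nonneg (c i))
    (show 0 < δ / 4 by positivity)
  have hc4 : ∑ i, (c i ^ 2) ^ 2 ≤ ε ^ 2 * K := by
    calc ∑ i, (c i ^ 2) ^ 2 ≤ ∑ i, ε ^ 2 * c i ^ 2 := Finset.sum_le_sum fun i _ => by
          have : c i ^ 2 ≤ ε ^ 2 := by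
            rw [← sq_abs]
            exact pow_le_pow_left₀ (abs_nonneg _) (hcε i) 2
          nlinarith [sq_nonneg (c i)]
      _ ≤ _ := by
        rw [← Finset.mul_sum]
        gcongr
  refine (add_le_add b1 b2).trans ?_
  rw [← ENNReal.ofReal_add (by positivity) (div_nonneg (mul_nonneg hbd
    (Finset.sum_nonneg fun i _ => sq_nonneg _)) (by positivity))]
  refine ENNReal.ofReal_le_ofReal ?_
  have c1 : (T ^ 2) ^ 2 * (∑ i, (c i ^ 2) ^ 2) / (δ / 2) ^ 2 ≤ δ / 2 :=
    le_trans (by gcongr) hε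
  have c2 : K * T ^ (-κ) * (∑ i, c i ^ 2) / (δ / 4) ≤ δ / 2 := by
    rw [div_le_iff₀ (by positivity)]
    have := mul_le_mul_of_nonneg_left hcK hbd
    linarith
  linarith

end WeakLaw

section ConditionalLaw

variable {Ω S : Type*} [MeasurableSpace Ω] [mS : MeasurableSpace S] {P : Measure Ω}
  [IsProbabilityMeasure P] {n : ℕ}

/-- Under conditional independence, the conditional law of a random vector is a product law. -/
lemma condDistrib_ae_eq_pi {V : Ω → S} (hV : Measurable V) {X : Ω → Fin n → ℝ}
    (hX : ∀ i, Measurable fun ω => X ω i)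
    (hind : CondIndepFamily P (mS.comap V) fun i ω => X ω i) :
    ∀ᵐ ω ∂P, condDistrib X V P (V ω)
      = Measure.pi fun i => condDistrib (fun ω => X ω i) V P (V ω) := by
  have hXm : Measurable X := measurable_pi_lambda _ hX
  have key : ∀ q : Fin n → ℚ, ∀ᵐ ω ∂P,
      (condDistrib X V P (V ω)).real (Set.univ.pi fun i => Set.Iic (q i : ℝ))
        = ∏ i, (condDistrib (fun ω => X ω i) V P (V ω)).real (Set.Iic (q i : ℝ)) := fun q => by
    have h1 := condDistrib_ae_eq_condExp (μ := P) hV hXm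
      (MeasurableSet.univ_pi fun i => measurableSet_Iic (a := (q i : ℝ)))
    have h2 := fun i => condDistrib_ae_eq_condExp (μ := P) hV (hX i)
      (measurableSet_Iic (a := (q i : ℝ)))
    have h3 := hind Finset.univ (fun i => Set.Iic (q i : ℝ)) fun i => measurableSet_Iic
    have hset : X ⁻¹' (Set.univ.pi fun i => Set.Iic (q i : ℝ))
        = ⋂ i ∈ Finset.univ, (fun ω => X ω i) ⁻¹' Set.Iic (q i : ℝ) := by
      ext ω
      simp [Pi.le_def]
    rw [← hset] at h3
    filter_upwards [h1, ae_all_iff.2 h2, h3] with ω h1 h2 h3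
    rw [h1, h3]
    exact Finset.prod_congr rfl fun i _ => (h2 i).symm
  filter_upwards [ae_all_iff.2 key] with ω hω
  have hspan : ∀ μ : Measure ℝ, IsProbabilityMeasure μ →
      Nonempty (μ.FiniteSpanningSetsIn (⋃ a : ℚ, {Set.Iic (a : ℝ)})) := fun μ _ =>
    ⟨{ set := fun k => Set.Iic (((k : ℚ) : ℝ))
       set_mem := fun k => by simp only [Set.mem_iUnion, Set.mem_singleton_iff]; exact ⟨k, rfl⟩
       finite := fun k => measure_lt_top _ _
       spanning := Set.eq_univ_of_forall fun x => by
        obtain ⟨k, hk⟩ := exists_nat_ge x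
        exact Set.mem_iUnion.2 ⟨k, by simpa using hk⟩ }⟩
  symm
  refine Measure.pi_eq_generateFrom (C := fun _ => ⋃ a : ℚ, {Set.Iic (a : ℝ)})
    (fun _ => by rw [← Real.borel_eq_generateFrom_Iic_rat]; exact (BorelSpace.measurable_eq).symm)
    (fun _ => Real.isPiSystem_Iic_rat) (fun i => (hspan _ inferInstance).some) fun s hs => ?_
  simp only [Set.mem_iUnion, Set.mem_singleton_iff] at hs
  choose q hq using hs
  obtain rfl : s = fun i => Set.Iic (q i : ℝ) := funext hq
  have := hω q
  rw [← ENNReal.toReal_eq_toReal_iff' (measure_ne_top _ _)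
    (ENNReal.prod_ne_top fun i _ => measure_ne_top _ _), ENNReal.toReal_prod]
  exact this

lemma ae_integral_condDistrib_eq {V : Ω → S} (hV : Measurable V) {X : Ω → ℝ} (hX : Measurable X)
    {f : ℝ → ℝ} (hf : Measurable f) (hi : Integrable (fun ω => f (X ω)) P) :
    ∀ᵐ ω ∂P, ∫ x, f x ∂(condDistrib X V P (V ω)) = P[fun ω => f (X ω) | mS.comap V] ω := by
  filter_upwards [condExp_ae_eq_integral_condDistrib (μ := P) hV hX.aemeasurable
    hf.stronglyMeasurable hi] with ω h
  exact h.symm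

lemma ae_integrable_condDistrib {V : Ω → S} (hV : Measurable V) {X : Ω → ℝ} (hX : Measurable X)
    {f : ℝ → ℝ} (hf : Measurable f) (hi : Integrable (fun ω => f (X ω)) P) :
    ∀ᵐ ω ∂P, Integrable f (condDistrib X V P (V ω)) := by
  refine Integrable.condDistrib_ae (f := fun z : S × ℝ => f z.2) hV.aemeasurable hX.aemeasurable ?_
  exact (integrable_map_measure (f := fun ω => (V ω, X ω)) (g := fun z : S × ℝ => f z.2)
    (hf.comp measurable_snd).aestronglyMeasurable (hV.prodMk hX).aemeasurable).2 hi

/-- A uniform bound on conditional probabilities bounds the probability. -/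
lemma measure_le_of_condDistrib_le {T : Type*} [MeasurableSpace T] [StandardBorelSpace T]
    [Nonempty T] {V : Ω → S} (hV : Measurable V) {X : Ω → T}
    (hX : Measurable X) {B : Set (S × T)} (hB : MeasurableSet B) {A : Set S}
    (hA : MeasurableSet A) {b : ℝ≥0∞}
    (h : ∀ᵐ ω ∂P, V ω ∈ A → condDistrib X V P (V ω) {x | (V ω, x) ∈ B} ≤ b) :
    P {ω | (V ω, X ω) ∈ B} ≤ P {ω | V ω ∉ A} + b := by
  have h1 : P {ω | V ω ∈ A ∧ (V ω, X ω) ∈ B} ≤ b := by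
    have hB' : MeasurableSet (B ∩ (Prod.fst ⁻¹' A)) := hB.inter (measurable_fst hA)
    have e : P {ω | V ω ∈ A ∧ (V ω, X ω) ∈ B}
        = (P.map fun ω => (V ω, X ω)) (B ∩ (Prod.fst ⁻¹' A)) := by
      rw [Measure.map_apply (hV.prodMk hX) hB']
      congr 1
      ext ω
      simp [and_comm]
    rw [e, ← compProd_map_condDistrib hX.aemeasurable, Measure.compProd_apply hB',
      lintegral_map (Kernel.measurable_kernel_prodMk_left hB') hV]
    calc _ ≤ ∫⁻ _, b ∂P := lintegral_mono_ae <| by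
          filter_upwards [h] with ω hω
          by_cases hA : V ω ∈ A
          · exact (measure_mono fun x hx => hx.1).trans (hω hA)
          · refine le_of_eq_of_le ?_ zero_le
            convert measure_empty (μ := condDistrib X V P (V ω))
            ext x
            simp [hA]
      _ = b := by simp
  calc _ ≤ P ({ω | V ω ∉ A} ∪ {ω | V ω ∈ A ∧ (V ω, X ω) ∈ B}) :=
        measure_mono fun ω hω => (em (V ω ∈ A)).symm.imp id fun hA => ⟨hA, hω⟩
    _ ≤ _ := (measure_union_le _ _).trans (add_le_add le_rfl h1)

lemma CondIndepFamily.comp {Ω : Type*} {m : MeasurableSpace Ω} [MeasurableSpace Ω]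
    {P : Measure Ω} {E F ι : Type*} [MeasurableSpace E] [MeasurableSpace F]
    {X : ι → Ω → E} (h : CondIndepFamily P m X) {f : E → F}
    (hf : Measurable f) : CondIndepFamily P m fun i ω => f (X i ω) :=
  fun s B hB => h s (fun i => f ⁻¹' B i) fun i => hf (hB i)

lemma ae_condExp_indicator_pair {V : Ω → S} (hV : Measurable V) {U D : Ω → ℝ}
    (hU : Measurable U) (hD : Measurable D) {B C : Set ℝ} (hB : MeasurableSet B)
    (hC : MeasurableSet C) :
    P[((fun ω => (U ω, D ω)) ⁻¹' (B ×ˢ C)).indicator (fun _ => (1 : ℝ)) | mS.comap V] =ᵐ[P]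
      P[fun ω => C.indicator (fun _ => (1 : ℝ)) (D ω)
        * (condDistrib U (fun ω => (V ω, D ω)) P (V ω, D ω)).real B | mS.comap V] := by
  have hVD : Measurable fun ω => (V ω, D ω) := hV.prodMk hD
  have hle : mS.comap V ≤ (inferInstance : MeasurableSpace (S × ℝ)).comap fun ω => (V ω, D ω) :=
    (measurable_fst.comp (comap_measurable fun ω => (V ω, D ω))).comap_le
  have hprod : ((fun ω => (U ω, D ω)) ⁻¹' (B ×ˢ C)).indicator (fun _ => (1 : ℝ))
      = (fun ω => C.indicator (fun _ => (1 : ℝ)) (D ω))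
        * (U ⁻¹' B).indicator (fun _ => (1 : ℝ)) := by
    ext ω
    by_cases h1 : U ω ∈ B <;> by_cases h2 : D ω ∈ C <;> simp [Set.indicator, h1, h2]
  have hiB : Integrable ((U ⁻¹' B).indicator (fun _ => (1 : ℝ))) P :=
    (integrable_const _).indicator (hU hB)
  have hiBC : Integrable ((fun ω => C.indicator (fun _ => (1 : ℝ)) (D ω))
        * (U ⁻¹' B).indicator (fun _ => (1 : ℝ))) P := by
    rw [← hprod]
    exact (integrable_const _).indicator ((hU.prodMk hD) (hB.prod hC))
  have hCm : StronglyMeasurable[(inferInstance : MeasurableSpace (S × ℝ)).comap fun ω => (V ω, D ω)]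
      (fun ω => C.indicator (fun _ => (1 : ℝ)) (D ω)) := by
    have : Measurable fun z : S × ℝ => C.indicator (fun _ => (1 : ℝ)) z.2 :=
      (measurable_const.indicator hC).comp measurable_snd
    exact (this.comp (comap_measurable fun ω => (V ω, D ω))).stronglyMeasurable
  rw [hprod]
  have h1 := condExp_mul_of_stronglyMeasurable_left hCm hiBC hiB
  have h2 := condDistrib_ae_eq_condExp (μ := P) hVD hU hB
  refine (condExp_condExp_of_le hle hVD.comap_le).symm.trans (condExp_congr_ae ?_)
  filter_upwards [h1, h2] with ω h1 h2
  rw [h1, Pi.mul_apply, h2]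

lemma ae_condExp_prod_condDistrib {V : Ω → S} (hV : Measurable V) {U D : Ω → Fin n → ℝ}
    (hU : ∀ i, Measurable fun ω => U ω i) (hD : ∀ i, Measurable fun ω => D ω i)
    (hind : CondIndepFamily P (mS.comap V) fun i ω => (U ω i, D ω i))
    {B C : Fin n → Set ℝ} (hB : ∀ i, MeasurableSet (B i)) (hC : ∀ i, MeasurableSet (C i)) :
    P[(⋂ i ∈ Finset.univ, (fun ω => (U ω i, D ω i)) ⁻¹' (B i ×ˢ C i)).indicator
        (fun _ => (1 : ℝ)) | mS.comap V] =ᵐ[P]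
      P[fun ω => ∏ i, (C i).indicator (fun _ => (1 : ℝ)) (D ω i)
        * (condDistrib (fun ω => U ω i) (fun ω => (V ω, D ω i)) P (V ω, D ω i)).real (B i)
        | mS.comap V] := by
  have hDm : Measurable D := measurable_pi_lambda _ hD
  obtain ⟨G, hG⟩ : ∃ G : Fin n → S × ℝ → ℝ, ∀ i z, (C i).indicator (fun _ => (1 : ℝ)) z.2
    * (condDistrib (fun ω => U ω i) (fun ω => (V ω, D ω i)) P z).real (B i) = G i z :=
    ⟨_, fun _ _ => rfl⟩
  have hGm : ∀ i, Measurable (G i) := fun i => by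
    rw [← funext (hG i)]
    exact ((measurable_const.indicator (hC i)).comp measurable_snd).mul
      (Kernel.measurable_coe _ (hB i)).ennreal_toReal
  have hG0 : ∀ i z, 0 ≤ G i z := fun i z => by
    rw [← hG]
    exact mul_nonneg (Set.indicator_nonneg (fun _ _ => zero_le_one) _) measureReal_nonneg
  have hG1 : ∀ i z, G i z ≤ 1 := fun i z => by
    rw [← hG]
    exact mul_le_one₀ (Set.indicator_le_self' (fun _ _ => zero_le_one) _) measureReal_nonneg
      measureReal_le_one
  have hGi : ∀ i, Integrable (fun ω => G i (V ω, D ω i)) P := fun i =>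
    (integrable_const (1 : ℝ)).mono'
      ((hGm i).comp (hV.prodMk (hD i))).aestronglyMeasurable (ae_of_all _ fun ω => by
        rw [Real.norm_eq_abs, abs_of_nonneg (hG0 _ _)]
        exact hG1 _ _)
  have hPm : Measurable fun z : S × (Fin n → ℝ) => ∏ i, G i (z.1, z.2 i) :=
    Finset.measurable_prod _ fun i _ => (hGm i).comp
      (measurable_fst.prodMk ((measurable_pi_apply i).comp measurable_snd))
  have hPi : Integrable (fun ω => ∏ i, G i (V ω, D ω i)) P :=
    (integrable_const (1 : ℝ)).mono' (hPm.comp (hV.prodMk hDm)).aestronglyMeasurable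
      (ae_of_all _ fun ω => by
        rw [Real.norm_eq_abs, abs_of_nonneg (Finset.prod_nonneg fun i _ => hG0 _ _)]
        exact Finset.prod_le_one (fun i _ => hG0 _ _) fun i _ => hG1 _ _)
  have h1 := hind Finset.univ (fun i => B i ×ˢ C i) fun i => (hB i).prod (hC i)
  have h2 := fun i => ae_condExp_indicator_pair (P := P) hV (hU i) (hD i) (hB i) (hC i)
  simp only [fun i ω => hG i (V ω, D ω i)] at h2 ⊢
  have h3 := condExp_prod_ae_eq_integral_condDistrib (μ := P) hV hDm.aemeasurable
    (f := fun z : S × (Fin n → ℝ) => ∏ i, G i (z.1, z.2 i)) hPm.stronglyMeasurable hPi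
  have h4 := fun i => condExp_prod_ae_eq_integral_condDistrib (μ := P) hV (hD i).aemeasurable
    (f := G i) (hGm i).stronglyMeasurable (hGi i)
  have h5 := condDistrib_ae_eq_pi hV hD (hind.comp (f := Prod.snd) measurable_snd)
  filter_upwards [h1, ae_all_iff.2 h2, h3, ae_all_iff.2 h4, h5] with ω h1 h2 h3 h4 h5
  rw [h1]
  refine Eq.trans ?_ h3.symm
  rw [h5, integral_fintype_prod_eq_prod (f := fun i x => G i (V ω, x))]
  exact Finset.prod_congr rfl fun i _ => (h2 i).trans (h4 i)

lemma condExp_indicator_iInter_ae_eq {V : Ω → S} (hV : Measurable V) {U D : Ω → Fin n → ℝ}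
    (hU : ∀ i, Measurable fun ω => U ω i) (hD : ∀ i, Measurable fun ω => D ω i)
    (hind : CondIndepFamily P (mS.comap V) fun i ω => (U ω i, D ω i))
    {B : Fin n → Set ℝ} (hB : ∀ i, MeasurableSet (B i)) :
    P[(⋂ i, (fun ω => U ω i) ⁻¹' B i).indicator (fun _ => (1 : ℝ)) |
        (inferInstance : MeasurableSpace (S × (Fin n → ℝ))).comap fun ω => (V ω, D ω)] =ᵐ[P]
      fun ω => ∏ i, (condDistrib (fun ω => U ω i) (fun ω => (V ω, D ω i)) P (V ω, D ω i)).real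
        (B i) := by
  have hDm : Measurable D := measurable_pi_lambda _ hD
  have hVD : Measurable fun ω => (V ω, D ω) := hV.prodMk hDm
  set G : Fin n → S × ℝ → ℝ := fun i z =>
    (condDistrib (fun ω => U ω i) (fun ω => (V ω, D ω i)) P z).real (B i) with hG
  have hGm : ∀ i, Measurable (G i) := fun i => (Kernel.measurable_coe _ (hB i)).ennreal_toReal
  have hPm : Measurable fun z : S × (Fin n → ℝ) => ∏ i, G i (z.1, z.2 i) :=
    Finset.measurable_prod _ fun i _ => (hGm i).comp
      (measurable_fst.prodMk ((measurable_pi_apply i).comp measurable_snd))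
  have hP0 : ∀ z : S × (Fin n → ℝ), 0 ≤ ∏ i, G i (z.1, z.2 i) := fun z =>
    Finset.prod_nonneg fun i _ => measureReal_nonneg
  have hPi : Integrable (fun ω => ∏ i, G i (V ω, D ω i)) P :=
    (integrable_const (1 : ℝ)).mono' (hPm.comp hVD).aestronglyMeasurable
      (ae_of_all _ fun ω => by
        rw [Real.norm_eq_abs, abs_of_nonneg (hP0 (V ω, D ω))]
        exact Finset.prod_le_one (fun i _ => measureReal_nonneg) fun i _ => measureReal_le_one)
  have hE : MeasurableSet (⋂ i, (fun ω => U ω i) ⁻¹' B i) :=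
    MeasurableSet.iInter fun i => hU i (hB i)
  set E := ⋂ i, (fun ω => U ω i) ⁻¹' B i with hEdef
  set μ₁ : Measure (S × (Fin n → ℝ)) := (P.restrict E).map fun ω => (V ω, D ω) with hμ₁
  set μ₂ : Measure (S × (Fin n → ℝ)) :=
    (P.withDensity fun ω => ENNReal.ofReal (∏ i, G i (V ω, D ω i))).map fun ω => (V ω, D ω)
    with hμ₂
  have hfin : IsFiniteMeasure (P.withDensity fun ω => ENNReal.ofReal (∏ i, G i (V ω, D ω i))) :=
    isFiniteMeasure_withDensity_ofReal hPi.2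
  have e₁ : ∀ A, MeasurableSet A → μ₁ A = ENNReal.ofReal
      (∫ ω in (fun ω => (V ω, D ω)) ⁻¹' A, E.indicator (fun _ => (1 : ℝ)) ω ∂P) := fun A hA => by
    rw [hμ₁, Measure.map_apply hVD hA, Measure.restrict_apply (hVD hA), integral_indicator hE,
      Measure.restrict_restrict hE]
    simp [Set.inter_comm]
  have e₂ : ∀ A, MeasurableSet A → μ₂ A = ENNReal.ofReal
      (∫ ω in (fun ω => (V ω, D ω)) ⁻¹' A, ∏ i, G i (V ω, D ω i) ∂P) := fun A hA => by
    rw [hμ₂, Measure.map_apply hVD hA, withDensity_apply _ (hVD hA),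
      ofReal_integral_eq_lintegral_ofReal hPi.restrict (ae_of_all _ fun ω => hP0 (V ω, D ω))]
  have hbox : ∀ (H : Set S) (C : Fin n → Set ℝ), MeasurableSet H → (∀ i, MeasurableSet (C i)) →
      ∫ ω in (fun ω => (V ω, D ω)) ⁻¹' (H ×ˢ Set.univ.pi C), E.indicator (fun _ => (1 : ℝ)) ω ∂P
      = ∫ ω in (fun ω => (V ω, D ω)) ⁻¹' (H ×ˢ Set.univ.pi C), ∏ i, G i (V ω, D ω i) ∂P := by
    intro H C hH hC
    have hCm : MeasurableSet (D ⁻¹' Set.univ.pi C) := hDm (MeasurableSet.univ_pi hC)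
    have hpre : (fun ω => (V ω, D ω)) ⁻¹' (H ×ˢ Set.univ.pi C)
        = V ⁻¹' H ∩ D ⁻¹' Set.univ.pi C := rfl
    have i1 : ∀ ω, (D ⁻¹' Set.univ.pi C).indicator (E.indicator (fun _ => (1 : ℝ))) ω
        = (⋂ i ∈ Finset.univ, (fun ω => (U ω i, D ω i)) ⁻¹' (B i ×ˢ C i)).indicator
          (fun _ => (1 : ℝ)) ω := fun ω => by
      rw [Set.indicator_indicator]
      congr 1
      ext ω
      simp only [Set.mem_inter_iff, Set.mem_preimage, Set.mem_pi, Set.mem_univ, true_implies,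
        hEdef, Set.mem_iInter, Finset.mem_univ, Set.mem_prod]
      exact ⟨fun h i => ⟨h.2 i, h.1 i⟩, fun h => ⟨fun i => (h i).2, fun i => (h i).1⟩⟩
    have i2 : ∀ ω, (D ⁻¹' Set.univ.pi C).indicator (fun ω => ∏ i, G i (V ω, D ω i)) ω
        = ∏ i, (C i).indicator (fun _ => (1 : ℝ)) (D ω i) * G i (V ω, D ω i) := fun ω => by
      by_cases h : ∀ i, D ω i ∈ C i
      · rw [Set.indicator_of_mem (by simpa using h)]
        exact Finset.prod_congr rfl fun i _ => by rw [Set.indicator_of_mem (h i), one_mul]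
      · rw [Set.indicator_of_notMem (by simpa using h)]
        push Not at h
        obtain ⟨i, hi⟩ := h
        refine (Finset.prod_eq_zero (Finset.mem_univ i) ?_).symm
        rw [Set.indicator_of_notMem hi, zero_mul]
    rw [hpre, ← setIntegral_indicator hCm, ← setIntegral_indicator hCm]
    simp_rw [i1, i2]
    have hm1 : Integrable ((⋂ i ∈ Finset.univ, (fun ω => (U ω i, D ω i)) ⁻¹'
        (B i ×ˢ C i)).indicator (fun _ => (1 : ℝ))) P :=
      (integrable_const _).indicator (Finset.measurableSet_biInter _ fun i _ =>
        ((hU i).prodMk (hD i)) ((hB i).prod (hC i)))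
    have hm2 : Integrable (fun ω => ∏ i, (C i).indicator (fun _ => (1 : ℝ)) (D ω i)
        * G i (V ω, D ω i)) P := by
      simp_rw [← i2]
      exact hPi.indicator hCm
    rw [← setIntegral_condExp hV.comap_le hm1 ⟨H, hH, rfl⟩,
      ← setIntegral_condExp hV.comap_le hm2 ⟨H, hH, rfl⟩]
    exact setIntegral_congr_ae (hV hH)
      ((ae_condExp_prod_condDistrib hV hU hD hind hB hC).mono fun ω h _ => h)
  have hμ : μ₁ = μ₂ := by
    have hspan1 : IsCountablySpanning {s : Set S | MeasurableSet s} :=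
      isCountablySpanning_measurableSet
    have hspan2 : IsCountablySpanning (Set.univ.pi '' Set.univ.pi
        fun _ : Fin n => {s : Set ℝ | MeasurableSet s}) :=
      IsCountablySpanning.pi fun _ => isCountablySpanning_measurableSet
    refine ext_of_generate_finite (Set.image2 (· ×ˢ ·) {s : Set S | MeasurableSet s}
      (Set.univ.pi '' Set.univ.pi fun _ : Fin n => {s : Set ℝ | MeasurableSet s}))
      (generateFrom_eq_prod MeasurableSpace.generateFrom_measurableSet generateFrom_pi hspan1 hspan2).symm
      (MeasurableSpace.isPiSystem_measurableSet.prod isPiSystem_pi) ?_ ?_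
    · rintro _ ⟨H, hH, _, ⟨C, hC, rfl⟩, rfl⟩
      have hC : ∀ i, MeasurableSet (C i) := fun i => hC i (Set.mem_univ i)
      rw [e₁ _ (hH.prod (MeasurableSet.univ_pi hC)), e₂ _ (hH.prod (MeasurableSet.univ_pi hC)),
        hbox H C hH hC]
    · have := hbox Set.univ (fun _ => Set.univ) MeasurableSet.univ fun _ => MeasurableSet.univ
      rw [Set.pi_univ, Set.univ_prod_univ] at this
      rw [e₁ _ MeasurableSet.univ, e₂ _ MeasurableSet.univ, this]
  symm
  refine ae_eq_condExp_of_forall_setIntegral_eq hVD.comap_le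
    ((integrable_const _).indicator hE) (fun _ _ _ => hPi.integrableOn) ?_ ?_
  · rintro _ ⟨A, hA, rfl⟩ _
    have h1 := e₁ A hA
    rw [hμ, e₂ A hA, ENNReal.ofReal_eq_ofReal_iff] at h1
    · exact h1
    · exact integral_nonneg fun ω => hP0 (V ω, D ω)
    · exact integral_nonneg fun ω => Set.indicator_nonneg (fun _ _ => zero_le_one) _
  · exact (hPm.comp (comap_measurable fun ω => (V ω, D ω))).aestronglyMeasurable

/-- Weak union: pairs that are conditionally independent given `V` have first coordinates that are
conditionally independent given `V` and all the second coordinates. -/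
lemma CondIndepFamily.fst_of_pair {V : Ω → S} (hV : Measurable V) {U D : Ω → Fin n → ℝ}
    (hU : ∀ i, Measurable fun ω => U ω i) (hD : ∀ i, Measurable fun ω => D ω i)
    (hind : CondIndepFamily P (mS.comap V) fun i ω => (U ω i, D ω i)) :
    CondIndepFamily P
      ((inferInstance : MeasurableSpace (S × (Fin n → ℝ))).comap fun ω => (V ω, D ω))
      fun i ω => U ω i := by
  classical
  intro s B hB
  have h1 := condExp_indicator_iInter_ae_eq hV hU hD hind
    (B := fun i => if i ∈ s then B i else Set.univ)
    fun i => by split_ifs; exacts [hB i, MeasurableSet.univ]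
  have h2 := fun j => condExp_indicator_iInter_ae_eq hV hU hD hind
    (B := fun i => if i = j then B j else Set.univ)
    fun i => by split_ifs; exacts [hB j, MeasurableSet.univ]
  have s1 : (⋂ i, (fun ω => U ω i) ⁻¹' (if i ∈ s then B i else Set.univ))
      = ⋂ i ∈ s, (fun ω => U ω i) ⁻¹' B i := by
    ext ω
    simp only [Set.mem_iInter, Set.mem_preimage]
    refine forall_congr' fun i => ?_
    by_cases hi : i ∈ s <;> simp [hi]
  have s2 : ∀ j, (⋂ i, (fun ω => U ω i) ⁻¹' (if i = j then B j else Set.univ))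
      = (fun ω => U ω j) ⁻¹' B j := fun j => by
    ext ω
    simp only [Set.mem_iInter, Set.mem_preimage]
    refine ⟨fun h => by simpa using h j, fun h i => ?_⟩
    by_cases hi : i = j
    · subst hi; simpa using h
    · simp [hi]
  rw [s1] at h1
  simp_rw [s2] at h2
  filter_upwards [h1, ae_all_iff.2 h2] with ω h1 h2
  rw [h1, Finset.prod_congr rfl fun j _ => h2 j]
  have e : ∀ j, ∏ i, (condDistrib (fun ω => U ω i) (fun ω => (V ω, D ω i)) P (V ω, D ω i)).real
      (if i = j then B j else Set.univ)
      = (condDistrib (fun ω => U ω j) (fun ω => (V ω, D ω j)) P (V ω, D ω j)).real (B j) :=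
    fun j => by
      rw [Finset.prod_eq_single j]
      · simp
      · intro i _ hi
        simp [hi]
      · simp
  simp_rw [e]
  rw [← Finset.prod_subset (Finset.subset_univ s)]
  · exact Finset.prod_congr rfl fun i hi => by simp [hi]
  · intro i _ hi
    simp [hi]

end ConditionalLaw

section Projection

variable {n p : ℕ}

/-- The matrix of the orthogonal projection onto the space spanned by the controls. -/
noncomputable def projMatrix (W : Matrix (Fin n) (Fin p) ℝ) : Matrix (Fin n) (Fin n) ℝ :=
  Matrix.of fun i j => (controlSpace W).starProjection (EuclideanSpace.single j 1) i

lemma starProjection_controlSpace_apply (W : Matrix (Fin n) (Fin p) ℝ)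
    (x : EuclideanSpace ℝ (Fin n)) (i : Fin n) :
    (controlSpace W).starProjection x i = ∑ j, projMatrix W i j * x j := by
  have hx : x = ∑ j, x j • EuclideanSpace.single j (1 : ℝ) := by
    ext k
    simp [Finset.sum_apply, Pi.single_apply]
  conv_lhs => rw [hx]
  rw [map_sum]
  simp [projMatrix, mul_comm]

lemma projMatrix_eq_inner (W : Matrix (Fin n) (Fin p) ℝ) (i j : Fin n) :
    projMatrix W i j = inner ℝ (EuclideanSpace.single i (1 : ℝ))
      ((controlSpace W).starProjection (EuclideanSpace.single j (1 : ℝ))) := by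
  simp [projMatrix, EuclideanSpace.inner_single_left]

lemma projMatrix_symm (W : Matrix (Fin n) (Fin p) ℝ) (i j : Fin n) :
    projMatrix W i j = projMatrix W j i := by
  rw [projMatrix_eq_inner, projMatrix_eq_inner, real_inner_comm]
  exact (controlSpace W).starProjection_isSymmetric _ _

lemma projMatrix_mul_self (W : Matrix (Fin n) (Fin p) ℝ) :
    projMatrix W * projMatrix W = projMatrix W := by
  ext i k
  rw [Matrix.mul_apply]
  have h := starProjection_controlSpace_apply W
    ((controlSpace W).starProjection (EuclideanSpace.single k (1 : ℝ))) i
  rw [Submodule.starProjection_eq_self_iff.2 (Submodule.starProjection_apply_mem _ _)] at h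
  exact h.symm

lemma finrank_controlSpace (W : Matrix (Fin n) (Fin p) ℝ) :
    Module.finrank ℝ (controlSpace W) = W.rank := by
  rw [Matrix.rank_eq_finrank_span_cols, controlSpace]
  have h : Submodule.span ℝ (Set.range fun j : Fin p => WithLp.toLp 2 fun i => W i j)
      = (Submodule.span ℝ (Set.range W.col)).map
        ((WithLp.linearEquiv 2 ℝ (Fin n → ℝ)).symm : (Fin n → ℝ) →ₗ[ℝ] EuclideanSpace ℝ (Fin n)) := by
    rw [Submodule.map_span, ← Set.range_comp]
    rfl
  rw [h]
  exact LinearEquiv.finrank_map_eq _ _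

lemma trace_projMatrix (W : Matrix (Fin n) (Fin p) ℝ) :
    (projMatrix W).trace = W.rank := by
  have hp : LinearMap.IsProj (controlSpace W)
      ((controlSpace W).starProjection : EuclideanSpace ℝ (Fin n) →ₗ[ℝ] EuclideanSpace ℝ (Fin n)) :=
    ⟨fun x => Submodule.starProjection_apply_mem _ _,
      fun x hx => Submodule.starProjection_eq_self_iff.2 hx⟩
  rw [← finrank_controlSpace, ← hp.trace,
    LinearMap.trace_eq_sum_inner _ (EuclideanSpace.basisFun (Fin n) ℝ), Matrix.trace]
  refine Finset.sum_congr rfl fun i _ => ?_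
  rw [Matrix.diag_apply, projMatrix_eq_inner]
  simp

lemma starProjection_span_range_eq_sum {E : Type*} [NormedAddCommGroup E] [InnerProductSpace ℝ E]
    {ι : Type*} [Fintype ι] {g : ι → E} (hg : Pairwise fun i j => inner ℝ (g i) (g j) = 0)
    [(Submodule.span ℝ (Set.range g)).HasOrthogonalProjection] (x : E) :
    (Submodule.span ℝ (Set.range g)).starProjection x
      = ∑ i, (inner ℝ (g i) x / ‖g i‖ ^ 2) • g i := by
  have hmem : ∑ i, (inner ℝ (g i) x / ‖g i‖ ^ 2) • g i ∈ Submodule.span ℝ (Set.range g) :=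
    Submodule.sum_mem _ fun i _ => Submodule.smul_mem _ _
      (Submodule.subset_span (Set.mem_range_self i))
  refine Submodule.eq_starProjection_of_mem_orthogonal hmem ?_
  rw [Submodule.mem_orthogonal]
  intro u hu
  induction hu using Submodule.span_induction with
  | mem y hy =>
    obtain ⟨k, rfl⟩ := hy
    rw [inner_sub_right, inner_sum, Finset.sum_eq_single k]
    · rw [inner_smul_right, real_inner_self_eq_norm_sq]
      by_cases h : g k = 0
      · simp [h]
      · rw [div_mul_cancel₀ _ (by simpa using h), sub_self]
    · intro j _ hj
      rw [inner_smul_right, hg hj.symm, mul_zero]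
    · simp
  | zero => simp
  | add y z _ _ hy hz => rw [inner_add_left, hy, hz, add_zero]
  | smul a y _ hy => rw [inner_smul_left, hy, mul_zero]

lemma starProjection_congr {E : Type*} [NormedAddCommGroup E] [InnerProductSpace ℝ E]
    {S T : Submodule ℝ E} [S.HasOrthogonalProjection] [T.HasOrthogonalProjection] (h : S = T)
    (x : E) : S.starProjection x = T.starProjection x := by
  subst h
  rfl

lemma measurable_gramSchmidt {α : Type*} [MeasurableSpace α] {f : Fin p → α → EuclideanSpace ℝ (Fin n)}
    (hf : ∀ j, Measurable (f j)) (j : Fin p) :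
    Measurable fun a => InnerProductSpace.gramSchmidt ℝ (fun k => f k a) j := by
  induction j using WellFoundedLT.induction with
  | ind j ih =>
    have h : ∀ a, InnerProductSpace.gramSchmidt ℝ (fun k => f k a) j = f j a
        - ∑ i ∈ Finset.Iio j, (inner ℝ (InnerProductSpace.gramSchmidt ℝ (fun k => f k a) i) (f j a)
          / ‖InnerProductSpace.gramSchmidt ℝ (fun k => f k a) i‖ ^ 2)
          • InnerProductSpace.gramSchmidt ℝ (fun k => f k a) i := fun a => by
      have := InnerProductSpace.gramSchmidt_def'' ℝ (fun k => f k a) j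
      exact eq_sub_of_add_eq this.symm
    simp_rw [h]
    refine (hf j).sub (Finset.measurable_sum _ fun i hi => ?_)
    have hi := ih i (Finset.mem_Iio.1 hi)
    exact ((hi.inner (hf j)).div (hi.norm.pow_const 2)).smul hi

lemma measurable_projMatrix {α : Type*} [MeasurableSpace α] {W : α → Matrix (Fin n) (Fin p) ℝ}
    (hW : ∀ i j, Measurable fun a => W a i j) (i j : Fin n) :
    Measurable fun a => projMatrix (W a) i j := by
  set f : Fin p → α → EuclideanSpace ℝ (Fin n) := fun k a => WithLp.toLp 2 fun i => W a i k with hf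
  have hfm : ∀ k, Measurable (f k) := fun k =>
    (WithLp.measurable_toLp 2 (Fin n → ℝ)).comp (measurable_pi_lambda _ fun i => hW i k)
  have hg := measurable_gramSchmidt hfm
  have hspan : ∀ a, controlSpace (W a)
      = Submodule.span ℝ (Set.range (InnerProductSpace.gramSchmidt ℝ fun k => f k a)) := fun a => by
    rw [InnerProductSpace.span_gramSchmidt]
    rfl
  have h : ∀ a, projMatrix (W a) i j = (∑ k, (inner ℝ
      (InnerProductSpace.gramSchmidt ℝ (fun k => f k a) k) (EuclideanSpace.single j (1 : ℝ))
        / ‖InnerProductSpace.gramSchmidt ℝ (fun k => f k a) k‖ ^ 2)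
      • InnerProductSpace.gramSchmidt ℝ (fun k => f k a) k : EuclideanSpace ℝ (Fin n)) i := fun a => by
    rw [← starProjection_span_range_eq_sum
      (InnerProductSpace.gramSchmidt_pairwise_orthogonal ℝ fun k => f k a)]
    simp only [projMatrix, Matrix.of_apply]
    rw [starProjection_congr (hspan a)]
  simp_rw [h]
  have hs : Measurable fun a => (∑ k, (inner ℝ
      (InnerProductSpace.gramSchmidt ℝ (fun k => f k a) k) (EuclideanSpace.single j (1 : ℝ))
        / ‖InnerProductSpace.gramSchmidt ℝ (fun k => f k a) k‖ ^ 2)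
      • InnerProductSpace.gramSchmidt ℝ (fun k => f k a) k : EuclideanSpace ℝ (Fin n)) :=
    Finset.measurable_sum _ fun k _ =>
      (((hg k).inner measurable_const).div ((hg k).norm.pow_const 2)).smul (hg k)
  exact (measurable_pi_apply i).comp ((WithLp.measurable_ofLp 2 (Fin n → ℝ)).comp hs)

/-- The matrix of the orthogonal projection onto the orthogonal complement of the controls. -/
noncomputable def annihilator (W : Matrix (Fin n) (Fin p) ℝ) : Matrix (Fin n) (Fin n) ℝ :=
  1 - projMatrix W

lemma annihilator_symm (W : Matrix (Fin n) (Fin p) ℝ) (i j : Fin n) :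
    annihilator W i j = annihilator W j i := by
  simp only [annihilator, Matrix.sub_apply, projMatrix_symm W i j, Matrix.one_apply, eq_comm]

lemma annihilator_mul_self (W : Matrix (Fin n) (Fin p) ℝ) :
    annihilator W * annihilator W = annihilator W := by
  simp [annihilator, mul_sub, sub_mul, projMatrix_mul_self]

lemma trace_annihilator (W : Matrix (Fin n) (Fin p) ℝ) :
    (annihilator W).trace = n - W.rank := by
  simp [annihilator, Matrix.trace_sub, trace_projMatrix]

lemma measurable_annihilator {α : Type*} [MeasurableSpace α] {W : α → Matrix (Fin n) (Fin p) ℝ}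
    (hW : ∀ i j, Measurable fun a => W a i j) (i j : Fin n) :
    Measurable fun a => annihilator (W a) i j := by
  simp only [annihilator, Matrix.sub_apply]
  exact measurable_const.sub (measurable_projMatrix hW i j)

lemma sum_sq_row_eq_diag {A : Matrix (Fin n) (Fin n) ℝ} (hA : ∀ i j, A i j = A j i)
    (hAA : A * A = A) (i : Fin n) : ∑ j, A i j ^ 2 = A i i := by
  conv_rhs => rw [← hAA, Matrix.mul_apply]
  exact Finset.sum_congr rfl fun j _ => by rw [hA j i, sq]

lemma diag_nonneg_of_idempotent {A : Matrix (Fin n) (Fin n) ℝ} (hA : ∀ i j, A i j = A j i)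
    (hAA : A * A = A) (i : Fin n) : 0 ≤ A i i := by
  rw [← sum_sq_row_eq_diag hA hAA]
  exact Finset.sum_nonneg fun j _ => sq_nonneg _

lemma diag_le_one_of_idempotent {A : Matrix (Fin n) (Fin n) ℝ} (hA : ∀ i j, A i j = A j i)
    (hAA : A * A = A) (i : Fin n) : A i i ≤ 1 := by
  have h1 : A i i ^ 2 ≤ ∑ j, A i j ^ 2 :=
    Finset.single_le_sum (f := fun j => A i j ^ 2) (fun j _ => sq_nonneg _) (Finset.mem_univ i)
  rw [sum_sq_row_eq_diag hA hAA] at h1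
  nlinarith

/-- The squared length of the projection of `x` is the quadratic form of `x`. -/
lemma sum_sq_mulVec_of_idempotent {A : Matrix (Fin n) (Fin n) ℝ} (hA : ∀ i j, A i j = A j i)
    (hAA : A * A = A) (x : Fin n → ℝ) :
    ∑ i, (∑ j, A i j * x j) ^ 2 = ∑ i, ∑ j, A i j * (x i * x j) := by
  have h : ∀ j k, ∑ i, A i j * A i k = A j k := fun j k => by
    conv_rhs => rw [← hAA, Matrix.mul_apply]
    exact Finset.sum_congr rfl fun i _ => by rw [hA i j]
  calc ∑ i, (∑ j, A i j * x j) ^ 2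
      = ∑ i, ∑ j, ∑ k, A i j * A i k * (x j * x k) := by
        refine Finset.sum_congr rfl fun i _ => ?_
        rw [sq, Finset.sum_mul_sum]
        exact Finset.sum_congr rfl fun j _ => Finset.sum_congr rfl fun k _ => by ring
    _ = ∑ j, ∑ k, ∑ i, A i j * A i k * (x j * x k) := by
        rw [Finset.sum_comm]
        exact Finset.sum_congr rfl fun j _ => Finset.sum_comm
    _ = _ := Finset.sum_congr rfl fun j _ => Finset.sum_congr rfl fun k _ => by
        rw [← Finset.sum_mul, h]

lemma olsResidual_eq_sum_annihilator (W : Matrix (Fin n) (Fin p) ℝ) (x : Fin n → ℝ) (i : Fin n) :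
    olsResidual W x i = ∑ j, annihilator W i j * x j := by
  rw [olsResidual, starProjection_controlSpace_apply]
  simp [annihilator, Matrix.sub_apply, sub_mul, Finset.sum_sub_distrib, Matrix.one_apply]

lemma mulVec_mem_controlSpace (W : Matrix (Fin n) (Fin p) ℝ) (d : Fin p → ℝ) :
    (WithLp.toLp 2 fun i => W i ⬝ᵥ d) ∈ controlSpace W := by
  have : (WithLp.toLp 2 fun i => W i ⬝ᵥ d : EuclideanSpace ℝ (Fin n))
      = ∑ j, d j • WithLp.toLp 2 fun i => W i j := by
    ext i
    simp [dotProduct, mul_comm]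
  rw [this]
  exact Submodule.sum_mem _ fun j _ => Submodule.smul_mem _ _ (Submodule.subset_span ⟨j, rfl⟩)

lemma sum_annihilator_mul_dotProduct (W : Matrix (Fin n) (Fin p) ℝ) (d : Fin p → ℝ) (i : Fin n) :
    ∑ j, annihilator W i j * (W j ⬝ᵥ d) = 0 := by
  rw [← olsResidual_eq_sum_annihilator, olsResidual,
    Submodule.starProjection_eq_self_iff.2 (mulVec_mem_controlSpace W d)]
  simp

/-- Residuals do not depend on the component in the space of the controls. -/
lemma olsResidual_eq_of_eq_add {W : Matrix (Fin n) (Fin p) ℝ} {D x : Fin n → ℝ} {d : Fin p → ℝ}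
    (h : ∀ i, D i = (W i ⬝ᵥ d) + x i) (i : Fin n) :
    olsResidual W D i = ∑ j, annihilator W i j * x j := by
  rw [olsResidual_eq_sum_annihilator]
  simp_rw [h, mul_add]
  rw [Finset.sum_add_distrib, sum_annihilator_mul_dotProduct, zero_add]

lemma sum_olsResidual_mul_dotProduct (W : Matrix (Fin n) (Fin p) ℝ) (x : Fin n → ℝ)
    (d : Fin p → ℝ) : ∑ i, olsResidual W x i * (W i ⬝ᵥ d) = 0 := by
  simp_rw [olsResidual_eq_sum_annihilator, Finset.sum_mul]
  rw [Finset.sum_comm]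
  refine Finset.sum_eq_zero fun j _ => ?_
  calc ∑ i, annihilator W i j * x j * (W i ⬝ᵥ d)
      = x j * ∑ i, annihilator W j i * (W i ⬝ᵥ d) := by
        rw [Finset.mul_sum]
        exact Finset.sum_congr rfl fun i _ => by rw [annihilator_symm W i j]; ring
    _ = 0 := by rw [sum_annihilator_mul_dotProduct, mul_zero]

lemma measurable_olsResidual {α : Type*} [MeasurableSpace α] {W : α → Matrix (Fin n) (Fin p) ℝ}
    (hW : ∀ i j, Measurable fun a => W a i j) {D : α → Fin n → ℝ}
    (hD : ∀ i, Measurable fun a => D a i) (i : Fin n) :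
    Measurable fun a => olsResidual (W a) (D a) i := by
  simp_rw [olsResidual_eq_sum_annihilator]
  exact Finset.measurable_sum _ fun j _ => (measurable_annihilator hW i j).mul (hD j)

end Projection

section WithProbabilityTendingToOne

variable {Ω : ℕ → Type*} [∀ n, MeasurableSpace (Ω n)] {P : ∀ n, Measure (Ω n)}

/-- The filter of events that hold with probability tending to one. -/
def wpFilter (P : ∀ n, Measure (Ω n)) : Filter (Σ n, Ω n) where
  sets := {s | Tendsto (fun n => P n {ω | (⟨n, ω⟩ : Σ n, Ω n) ∉ s}) atTop (𝓝 0)}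
  univ_sets := by simp
  sets_of_superset := fun {s t} hs hst => by
    refine tendsto_of_tendsto_of_tendsto_of_le_of_le tendsto_const_nhds hs (fun _ => zero_le)
      fun n => measure_mono fun ω hω h => hω (hst h)
  inter_sets := fun {s t} hs ht => by
    have h := Tendsto.add hs ht
    rw [add_zero] at h
    refine tendsto_of_tendsto_of_tendsto_of_le_of_le tendsto_const_nhds h (fun _ => zero_le)
      fun n => ?_
    refine (measure_mono fun ω hω => ?_).trans (measure_union_le _ _)
    by_contra hcon
    simp only [Set.mem_union, Set.mem_ofPred_eq, not_or, not_not] at hcon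
    exact hω hcon

lemma eventually_wpFilter_iff {q : ∀ n, Ω n → Prop} :
    (∀ᶠ x in wpFilter P, q x.1 x.2) ↔ Tendsto (fun n => P n {ω | ¬ q n ω}) atTop (𝓝 0) :=
  Iff.rfl

lemma eventually_wpFilter_of_le {q : ∀ n, Ω n → Prop} {b : ℕ → ℝ≥0∞}
    (hb : Tendsto b atTop (𝓝 0)) (h : ∀ᶠ n in atTop, P n {ω | ¬ q n ω} ≤ b n) :
    ∀ᶠ x in wpFilter P, q x.1 x.2 :=
  tendsto_of_tendsto_of_tendsto_of_le_of_le' tendsto_const_nhds hb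
    (Eventually.of_forall fun _ => zero_le) h

lemma tendsto_fst_wpFilter : Tendsto Sigma.fst (wpFilter P) atTop := by
  intro s hs
  refine eventually_wpFilter_of_le (q := fun n _ => n ∈ s) tendsto_const_nhds ?_
  filter_upwards [hs] with n hn
  simp [show n ∈ s from hn]

lemma isLittleOpOne_iff {X : ∀ n, Ω n → ℝ} :
    IsLittleOpOne P X ↔ Tendsto (fun x : Σ n, Ω n => X x.1 x.2) (wpFilter P) (𝓝 0) := by
  rw [Metric.tendsto_nhds]
  refine forall_congr' fun ε => forall_congr' fun _ => ?_
  simp only [Real.dist_eq, sub_zero]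
  rw [eventually_wpFilter_iff (q := fun n ω => |X n ω| < ε)]
  simp only [not_lt]

/-- Stochastic boundedness: `X n = O_p(1)`. -/
def IsBigOpOne (P : ∀ n, Measure (Ω n)) (X : ∀ n, Ω n → ℝ) : Prop :=
  ∀ δ : ℝ, 0 < δ → ∃ M : ℝ, 0 < M ∧ ∀ᶠ n in atTop, P n {ω | M ≤ |X n ω|} ≤ ENNReal.ofReal δ

lemma IsBigOpOne.tendsto_mul {X Y : ∀ n, Ω n → ℝ} (hX : IsBigOpOne P X)
    (hY : Tendsto (fun x : Σ n, Ω n => Y x.1 x.2) (wpFilter P) (𝓝 0)) :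
    Tendsto (fun x : Σ n, Ω n => X x.1 x.2 * Y x.1 x.2) (wpFilter P) (𝓝 0) := by
  rw [← isLittleOpOne_iff (X := fun n ω => X n ω * Y n ω)]
  intro ε hε
  rw [ENNReal.tendsto_nhds_zero]
  intro δ hδ
  by_cases hδt : δ = ∞
  · simp [hδt]
  have hδ' : 0 < δ.toReal := ENNReal.toReal_pos hδ.ne' hδt
  obtain ⟨M, hM, hXM⟩ := hX (δ.toReal / 2) (by positivity)
  have hYM := isLittleOpOne_iff.2 hY (ε / M) (by positivity)
  rw [ENNReal.tendsto_nhds_zero] at hYM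
  filter_upwards [hXM, hYM (ENNReal.ofReal (δ.toReal / 2)) (by simpa using hδ')] with n h1 h2
  calc P n {ω | ε ≤ |X n ω * Y n ω|}
      ≤ P n ({ω | M ≤ |X n ω|} ∪ {ω | ε / M ≤ |Y n ω|}) := measure_mono fun ω hω => by
        by_contra hcon
        simp only [Set.mem_union, Set.mem_ofPred_eq, not_or, not_le] at hcon hω
        rw [abs_mul] at hω
        have : |X n ω| * |Y n ω| < M * (ε / M) :=
          mul_lt_mul'' hcon.1 hcon.2 (abs_nonneg _) (abs_nonneg _)
        rw [mul_div_cancel₀ _ hM.ne'] at this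
        linarith
    _ ≤ ENNReal.ofReal (δ.toReal / 2) + ENNReal.ofReal (δ.toReal / 2) :=
        (measure_union_le _ _).trans (add_le_add h1 h2)
    _ = δ := by
        rw [← ENNReal.ofReal_add (by positivity) (by positivity), add_halves,
          ENNReal.ofReal_toReal hδt]

/-- Markov's inequality: a sequence that is bounded in `L¹` is stochastically bounded. -/
lemma isBigOpOne_of_lintegral_le {X : ∀ n, Ω n → ℝ} (hX : ∀ n, AEMeasurable (X n) (P n)) {C : ℝ}
    (h : ∀ᶠ n in atTop, ∫⁻ ω, ENNReal.ofReal |X n ω| ∂(P n) ≤ ENNReal.ofReal C) :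
    IsBigOpOne P X := by
  intro δ hδ
  refine ⟨(|C| + 1) / δ, by positivity, ?_⟩
  filter_upwards [h] with n hn
  have hM : 0 < (|C| + 1) / δ := by positivity
  have hset : {ω | (|C| + 1) / δ ≤ |X n ω|}
      = {ω | ENNReal.ofReal ((|C| + 1) / δ) ≤ ENNReal.ofReal |X n ω|} := by
    ext ω
    simp only [Set.mem_ofPred_eq]
    rw [ENNReal.ofReal_le_ofReal_iff (abs_nonneg _)]
  rw [hset]
  refine (meas_ge_le_lintegral_div (hX n).norm.ennreal_ofReal (by simpa using hM)
    ENNReal.ofReal_ne_top).trans ?_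
  simp only [Real.norm_eq_abs]
  refine (ENNReal.div_le_div_right hn _).trans ?_
  rw [← ENNReal.ofReal_div_of_pos hM]
  refine ENNReal.ofReal_le_ofReal ?_
  rw [div_le_iff₀ hM, mul_div_cancel₀ _ hδ.ne']
  linarith [le_abs_self C]

lemma tendsto_wpFilter_zero_of_lintegral {X : ∀ n, Ω n → ℝ} (hX : ∀ n, AEMeasurable (X n) (P n))
    (h : Tendsto (fun n => ∫⁻ ω, ENNReal.ofReal |X n ω| ∂(P n)) atTop (𝓝 0)) :
    Tendsto (fun x : Σ n, Ω n => X x.1 x.2) (wpFilter P) (𝓝 0) := by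
  rw [← isLittleOpOne_iff]
  intro ε hε
  have hε' : ENNReal.ofReal ε ≠ 0 := by simpa using hε
  have h' := ENNReal.Tendsto.div_const h (b := ENNReal.ofReal ε) (Or.inr hε')
  rw [ENNReal.zero_div] at h'
  refine tendsto_of_tendsto_of_tendsto_of_le_of_le tendsto_const_nhds h' (fun _ => zero_le)
    fun n => ?_
  have hset : {ω | ε ≤ |X n ω|} = {ω | ENNReal.ofReal ε ≤ ENNReal.ofReal |X n ω|} := by
    ext ω
    simp only [Set.mem_ofPred_eq]
    rw [ENNReal.ofReal_le_ofReal_iff (abs_nonneg _)]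
  rw [hset]
  exact meas_ge_le_lintegral_div (hX n).norm.ennreal_ofReal hε' ENNReal.ofReal_ne_top

end WithProbabilityTendingToOne

section QuadraticFormsOfProductLaws

variable {n : ℕ} {K : ℝ} {τ : Fin n → Measure ℝ} [∀ i, IsProbabilityMeasure (τ i)]

lemma abs_rpow_two_add_two (x : ℝ) : |x| ^ ((2 : ℝ) + 2) = x ^ 4 := by
  rw [show (2 : ℝ) + 2 = ((4 : ℕ) : ℝ) by norm_num, Real.rpow_natCast]
  exact Even.pow_abs (by decide) x

lemma MomentBounds.memLp_four {ν : Measure ℝ} (h : MomentBounds 2 K ν) :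
    MemLp (fun x : ℝ => x) 4 ν := by
  refine (integrable_norm_rpow_iff (f := fun x : ℝ => x) (by fun_prop) (by norm_num)
    (by norm_num)).1 ?_
  refine h.integrable.congr (ae_of_all _ fun x => ?_)
  simp only [Real.norm_eq_abs]
  norm_num

lemma memLp_four_eval (h : ∀ i, MomentBounds 2 K (τ i)) (i : Fin n) :
    MemLp (fun x : Fin n → ℝ => x i) 4 (Measure.pi τ) :=
  ((h i).memLp_four).comp_measurePreserving (measurePreserving_eval τ i)

lemma iIndepFun_eval_pi : iIndepFun (fun (i : Fin n) (x : Fin n → ℝ) => x i) (Measure.pi τ) :=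
  iIndepFun_pi (X := fun _ x => x) fun i => by fun_prop

lemma integral_eval_pi (h : ∀ i, MomentBounds 2 K (τ i)) (i : Fin n) :
    ∫ x : Fin n → ℝ, x i ∂(Measure.pi τ) = 0 := by
  rw [integral_comp_eval (μ := τ) (i := i) (f := fun x : ℝ => x) (by fun_prop), (h i).mean]

lemma integral_eval_sq_pi (i : Fin n) :
    ∫ x : Fin n → ℝ, x i ^ 2 ∂(Measure.pi τ) = ∫ y, y ^ 2 ∂(τ i) :=
  integral_comp_eval (μ := τ) (i := i) (f := fun x : ℝ => x ^ 2) (by fun_prop)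

lemma integral_eval_four_pi_le (h : ∀ i, MomentBounds 2 K (τ i)) (i : Fin n) :
    ∫ x : Fin n → ℝ, x i ^ 4 ∂(Measure.pi τ) ≤ K := by
  rw [integral_comp_eval (μ := τ) (i := i) (f := fun x : ℝ => x ^ 4) (by fun_prop)]
  refine le_trans (le_of_eq ?_) (h i).upper
  simp_rw [abs_rpow_two_add_two]

lemma measure_pi_projection_le (h : ∀ i, MomentBounds 2 K (τ i)) (hK : 0 < K)
    {A : Matrix (Fin n) (Fin n) ℝ} (hA : ∀ i j, A i j = A j i) (hAA : A * A = A) {s : ℝ}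
    (hs : 0 < s) :
    Measure.pi τ {x | ∑ i, (∑ j, A i j * x j) ^ 2 ≤ A.trace / K - s}
      ≤ ENNReal.ofReal (8 * K * n / s ^ 2) := by
  have hq := measure_quadForm_le (iIndepFun_eval_pi (τ := τ)) (fun i => by fun_prop)
    (memLp_four_eval h) (integral_eval_pi h) (integral_eval_four_pi_le h) hA hs
  simp_rw [integral_eval_sq_pi] at hq
  have hrow : ∑ i, ∑ j, A i j ^ 2 ≤ n := by
    simp_rw [sum_sq_row_eq_diag hA hAA]
    calc ∑ i, A i i ≤ ∑ _i : Fin n, (1 : ℝ) :=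
          Finset.sum_le_sum fun i _ => diag_le_one_of_idempotent hA hAA i
      _ = n := by simp
  refine (measure_mono fun x hx => ?_).trans (hq.trans (ENNReal.ofReal_le_ofReal (by gcongr)))
  have hx : ∑ i, (∑ j, A i j * x j) ^ 2 ≤ A.trace / K - s := hx
  rw [sum_sq_mulVec_of_idempotent hA hAA] at hx
  have hm : A.trace / K ≤ ∑ i, A i i * ∫ y, y ^ 2 ∂(τ i) := by
    rw [Matrix.trace, Finset.sum_div]
    refine Finset.sum_le_sum fun i _ => ?_
    rw [div_eq_mul_one_div]
    exact mul_le_mul_of_nonneg_left (h i).lower (diag_nonneg_of_idempotent hA hAA i)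
  simp only [Set.mem_ofPred_eq]
  rw [abs_sub_comm]
  exact (by linarith : s ≤ _).trans (le_abs_self _)

lemma measure_pi_sum_sq_ge_le (h : ∀ i, MomentBounds 2 K (τ i)) {s : ℝ} (hs : 0 < s) :
    Measure.pi τ {x | (1 + K) * n + s ≤ ∑ i, x i ^ 2} ≤ ENNReal.ofReal (8 * K * n / s ^ 2) := by
  have hq := measure_quadForm_le (iIndepFun_eval_pi (τ := τ)) (fun i => by fun_prop)
    (memLp_four_eval h) (integral_eval_pi h) (integral_eval_four_pi_le h)
    (A := (1 : Matrix (Fin n) (Fin n) ℝ)) (fun i j => by simp [Matrix.one_apply, eq_comm]) hs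
  simp_rw [integral_eval_sq_pi] at hq
  have hrow : ∑ i, ∑ j, (1 : Matrix (Fin n) (Fin n) ℝ) i j ^ 2 = n := by
    simp [Matrix.one_apply]
  rw [hrow] at hq
  refine (measure_mono fun x hx => ?_).trans hq
  have hx : (1 + K) * n + s ≤ ∑ i, x i ^ 2 := hx
  have hm : ∑ i, (1 : Matrix (Fin n) (Fin n) ℝ) i i * ∫ y, y ^ 2 ∂(τ i) ≤ (1 + K) * n := by
    calc _ ≤ ∑ _i : Fin n, (1 + K) := Finset.sum_le_sum fun i _ => by
          rw [Matrix.one_apply_eq, one_mul]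
          exact (h i).integral_sq_le (by norm_num)
      _ = _ := by
        rw [Finset.sum_const, Finset.card_univ, Fintype.card_fin, nsmul_eq_mul, mul_comm]
  have hx2 : ∑ i, ∑ j, (1 : Matrix (Fin n) (Fin n) ℝ) i j * (x i * x j) = ∑ i, x i ^ 2 := by
    simp [Matrix.one_apply, sq]
  simp only [Set.mem_ofPred_eq]
  rw [hx2]
  exact (by linarith : s ≤ _).trans (le_abs_self _)

lemma measure_pi_exists_ge_le (h : ∀ i, MomentBounds 2 K (τ i)) (hK : 0 < K)
    {A : Matrix (Fin n) (Fin n) ℝ} (hA : ∀ i, ∑ j, A i j ^ 2 ≤ 1) {r : ℝ} (hr : 0 < r) :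
    Measure.pi τ {x | ∃ i, r ≤ |∑ j, A i j * x j|}
      ≤ ENNReal.ofReal ((16 * K + 2 * (1 + K) ^ 2) * n / r ^ 4) := by
  have hi : ∀ i, Measure.pi τ {x | r ≤ |∑ j, A i j * x j|}
      ≤ ENNReal.ofReal ((16 * K + 2 * (1 + K) ^ 2) / r ^ 4) := fun i => by
    obtain ⟨hint, hle⟩ := integral_pow_four_sum_mul_le (iIndepFun_eval_pi (τ := τ))
      (fun i => by fun_prop) (memLp_four_eval h) (integral_eval_pi h) (integral_eval_four_pi_le h)
      (fun j => A i j)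
    have hM := mul_meas_ge_le_integral_of_nonneg (ae_of_all (Measure.pi τ) fun x : Fin n → ℝ =>
      (by positivity : 0 ≤ (∑ j, A i j * x j) ^ 4)) hint (r ^ 4)
    rw [← ofReal_measureReal]
    refine ENNReal.ofReal_le_ofReal ?_
    rw [le_div_iff₀ (by positivity), mul_comm]
    have hset : {x : Fin n → ℝ | r ≤ |∑ j, A i j * x j|}
        ⊆ {x | r ^ 4 ≤ (∑ j, A i j * x j) ^ 4} := fun x hx => by
      have h4 : |∑ j, A i j * x j| ^ 4 = (∑ j, A i j * x j) ^ 4 := Even.pow_abs (by decide) _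
      simp only [Set.mem_ofPred_eq] at hx ⊢
      rw [← h4]
      exact pow_le_pow_left₀ hr.le hx 4
    calc _ ≤ r ^ 4 * (Measure.pi τ).real {x | r ^ 4 ≤ (∑ j, A i j * x j) ^ 4} :=
          mul_le_mul_of_nonneg_left (measureReal_mono hset) (by positivity)
      _ ≤ (16 * K + 2 * (1 + K) ^ 2) * (∑ j, A i j ^ 2) ^ 2 := hM.trans hle
      _ ≤ (16 * K + 2 * (1 + K) ^ 2) * 1 ^ 2 := by
          have := hA i
          have : 0 ≤ ∑ j, A i j ^ 2 := Finset.sum_nonneg fun j _ => sq_nonneg _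
          gcongr
      _ = _ := by ring
  have hU : {x : Fin n → ℝ | ∃ i, r ≤ |∑ j, A i j * x j|}
      = ⋃ i, {x | r ≤ |∑ j, A i j * x j|} := by
    ext x
    simp
  rw [hU]
  refine (measure_iUnion_fintype_le _ _).trans ((Finset.sum_le_sum fun i _ => hi i).trans ?_)
  rw [Finset.sum_const, Finset.card_univ, Fintype.card_fin, nsmul_eq_mul,
    ← ENNReal.ofReal_natCast, ← ENNReal.ofReal_mul (by positivity)]
  exact ENNReal.ofReal_le_ofReal (le_of_eq (by ring))

end QuadraticFormsOfProductLaws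

section ConditionalProbabilityBounds

variable {Ω S : Type*} [MeasurableSpace Ω] [mS : MeasurableSpace S] {P : Measure Ω}
  [IsProbabilityMeasure P] {n : ℕ} {κ K : ℝ}

/-- The conditional laws of the coordinates of `X` given `V` satisfy the moment bounds. -/
def CondMomentBounds (P : Measure Ω) [IsProbabilityMeasure P] (V : Ω → S) (X : Ω → Fin n → ℝ)
    (κ K : ℝ) : Prop :=
  ∀ᵐ ω ∂P, ∀ i, MomentBounds κ K (condDistrib (fun ω => X ω i) V P (V ω))

lemma condMomentBounds_of_condExp {V : Ω → S} (hV : Measurable V) {X : Ω → Fin n → ℝ}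
    (hX : ∀ i, Measurable fun ω => X ω i) (hκ : 0 < κ)
    (hi1 : ∀ i, Integrable (fun ω => X ω i) P)
    (hi : ∀ i, Integrable (fun ω => |X ω i| ^ (2 + κ)) P)
    (h0 : ∀ i, P[fun ω => X ω i | mS.comap V] =ᵐ[P] 0)
    (hup : ∀ i, ∀ᵐ ω ∂P, P[fun ω => |X ω i| ^ (2 + κ) | mS.comap V] ω ≤ K)
    (hlow : ∀ i, ∀ᵐ ω ∂P, 1 / K ≤ P[fun ω => X ω i ^ 2 | mS.comap V] ω) :
    CondMomentBounds P V X κ K := by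
  refine ae_all_iff.2 fun i => ?_
  have hm : Measurable fun x : ℝ => |x| ^ (2 + κ) := measurable_id.abs.pow_const _
  have hi2 : Integrable (fun ω => X ω i ^ 2) P :=
    ((integrable_const 1).add (hi i)).mono' ((hX i).pow_const 2).aestronglyMeasurable
      (ae_of_all _ fun ω => by
        rw [Real.norm_eq_abs, abs_of_nonneg (sq_nonneg _)]
        exact sq_le_one_add_rpow hκ _)
  filter_upwards [ae_integral_condDistrib_eq hV (hX i) measurable_id (hi1 i),
    ae_integral_condDistrib_eq hV (hX i) hm (hi i),
    ae_integral_condDistrib_eq hV (hX i) (measurable_id.pow_const 2) hi2,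
    ae_integrable_condDistrib hV (hX i) hm (hi i), h0 i, hup i, hlow i]
    with ω e1 e2 e3 e4 h0 hup hlow
  exact ⟨e4, e1.trans h0, e2.trans_le hup, hlow.trans_eq e3.symm⟩

lemma measure_le_of_forall_pi_le {V : Ω → S} (hV : Measurable V) {X : Ω → Fin n → ℝ}
    (hX : ∀ i, Measurable fun ω => X ω i)
    (hind : CondIndepFamily P (mS.comap V) fun i ω => X ω i) (hmom : CondMomentBounds P V X κ K)
    {B : Set (S × (Fin n → ℝ))} (hB : MeasurableSet B) {A : Set S} (hA : MeasurableSet A)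
    {b : ℝ≥0∞}
    (h : ∀ v ∈ A, (∀ i, MomentBounds κ K (condDistrib (fun ω => X ω i) V P v)) →
      Measure.pi (fun i => condDistrib (fun ω => X ω i) V P v) {x | (v, x) ∈ B} ≤ b) :
    P {ω | (V ω, X ω) ∈ B} ≤ P {ω | V ω ∉ A} + b := by
  refine measure_le_of_condDistrib_le hV (measurable_pi_lambda _ hX) hB hA ?_
  filter_upwards [condDistrib_ae_eq_pi hV hX hind, hmom] with ω h1 h2 h3
  rw [h1]
  exact h _ h3 h2

/-- The conditional standard deviation, given `V = v`, of a sum with weights `Z v`. -/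
noncomputable def condScale (P : Measure Ω) [IsProbabilityMeasure P] (V : Ω → S)
    (X : Ω → Fin n → ℝ) (Z : S → Fin n → ℝ) (v : S) : ℝ :=
  Real.sqrt (∑ i, Z v i ^ 2 * ∫ x, x ^ 2 ∂(condDistrib (fun ω => X ω i) V P v))

lemma measurable_condScale {V : Ω → S} {X : Ω → Fin n → ℝ} {Z : S → Fin n → ℝ}
    (hZ : ∀ i, Measurable fun v => Z v i) : Measurable (condScale P V X Z) := by
  refine Measurable.sqrt (Finset.measurable_sum _ fun i _ => ((hZ i).pow_const 2).mul ?_)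
  have : StronglyMeasurable fun z : S × ℝ => z.2 ^ 2 :=
    (measurable_snd.pow_const 2).stronglyMeasurable
  exact (this.integral_kernel_prod_right' (κ := condDistrib (fun ω => X ω i) V P)).measurable

lemma condScale_sq (V : Ω → S) (X : Ω → Fin n → ℝ) (Z : S → Fin n → ℝ) (v : S) :
    condScale P V X Z v ^ 2
      = ∑ i, Z v i ^ 2 * ∫ x, x ^ 2 ∂(condDistrib (fun ω => X ω i) V P v) :=
  Real.sq_sqrt (Finset.sum_nonneg fun _ _ =>
    mul_nonneg (sq_nonneg _) (integral_nonneg fun x => sq_nonneg x))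

lemma sum_div_condScale_sq {V : Ω → S} {X : Ω → Fin n → ℝ} {Z : S → Fin n → ℝ} {v : S}
    (h : 0 < condScale P V X Z v) :
    ∑ i, (Z v i / condScale P V X Z v) ^ 2
      * ∫ x, x ^ 2 ∂(condDistrib (fun ω => X ω i) V P v) = 1 := by
  simp_rw [div_pow, div_mul_eq_mul_div]
  rw [← Finset.sum_div, ← condScale_sq, div_self (by positivity)]

/-- The event that no single weight dominates the conditional standard deviation. -/
def negligibleWeights (P : Measure Ω) [IsProbabilityMeasure P] (V : Ω → S)
    (X : Ω → Fin n → ℝ) (Z : S → Fin n → ℝ) (ε : ℝ) : Set S :=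
  {v | 0 < condScale P V X Z v ∧ ∀ i, |Z v i| ≤ ε * condScale P V X Z v}

lemma measurableSet_negligibleWeights {V : Ω → S} {X : Ω → Fin n → ℝ} {Z : S → Fin n → ℝ}
    (hZ : ∀ i, Measurable fun v => Z v i) (ε : ℝ) :
    MeasurableSet (negligibleWeights P V X Z ε) := by
  have hs := measurable_condScale (P := P) (V := V) (X := X) hZ
  refine (measurableSet_lt measurable_const hs).inter ?_
  have : {v | ∀ i, |Z v i| ≤ ε * condScale P V X Z v}
      = ⋂ i, {v | |Z v i| ≤ ε * condScale P V X Z v} := by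
    ext v
    simp
  change MeasurableSet {v | ∀ i, |Z v i| ≤ ε * condScale P V X Z v}
  rw [this]
  exact MeasurableSet.iInter fun i => measurableSet_le (hZ i).abs (hs.const_mul ε)

lemma abs_div_condScale_le {V : Ω → S} {X : Ω → Fin n → ℝ} {Z : S → Fin n → ℝ} {ε : ℝ} {v : S}
    (hv : v ∈ negligibleWeights P V X Z ε) (i : Fin n) : |Z v i / condScale P V X Z v| ≤ ε := by
  rw [abs_div, abs_of_pos hv.1, div_le_iff₀ hv.1]
  exact hv.2 i

/-- The weighted sum, standardized by its conditional standard deviation. -/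
noncomputable def standardizedSum (P : Measure Ω) [IsProbabilityMeasure P] (V : Ω → S)
    (X : Ω → Fin n → ℝ) (Z : S → Fin n → ℝ) (z : S × (Fin n → ℝ)) : ℝ :=
  ∑ i, Z z.1 i / condScale P V X Z z.1 * z.2 i

lemma measurable_standardizedSum {V : Ω → S} {X : Ω → Fin n → ℝ} {Z : S → Fin n → ℝ}
    (hZ : ∀ i, Measurable fun v => Z v i) : Measurable (standardizedSum P V X Z) :=
  Finset.measurable_sum _ fun i _ =>
    (((hZ i).comp measurable_fst).div ((measurable_condScale hZ).comp measurable_fst)).mul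
      ((measurable_pi_apply i).comp measurable_snd)

lemma norm_integral_exp_standardizedSum_sub_le {V : Ω → S} (hV : Measurable V)
    {X : Ω → Fin n → ℝ} (hX : ∀ i, Measurable fun ω => X ω i)
    (hind : CondIndepFamily P (mS.comap V) fun i ω => X ω i) (hmom : CondMomentBounds P V X κ K)
    {Z : S → Fin n → ℝ} (hZ : ∀ i, Measurable fun v => Z v i) {t δ ε : ℝ} (hδ : 0 ≤ δ)
    (h : ∀ (ν : Fin n → Measure ℝ)
      [∀ i, IsProbabilityMeasure (ν i)], (∀ i, MomentBounds κ K (ν i)) → ∀ c : Fin n → ℝ,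
      (∀ i, |c i| ≤ ε) → ∑ i, c i ^ 2 * ∫ x, x ^ 2 ∂(ν i) = 1 →
      ‖∫ u, Complex.exp ((t * ∑ i, c i * u i : ℝ) * Complex.I) ∂(Measure.pi ν)
        - (Real.exp (-(t ^ 2 / 2)) : ℝ)‖ ≤ δ) :
    ‖∫ ω, Complex.exp ((t * standardizedSum P V X Z (V ω, X ω) : ℝ) * Complex.I) ∂P
        - (Real.exp (-(t ^ 2 / 2)) : ℝ)‖
      ≤ δ + 2 * P.real {ω | V ω ∉ negligibleWeights P V X Z ε} := by
  have hXm : Measurable X := measurable_pi_lambda _ hX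
  have hT := measurable_standardizedSum (P := P) (V := V) (X := X) hZ
  set A := negligibleWeights P V X Z ε with hAdef
  have hA : MeasurableSet A := measurableSet_negligibleWeights hZ ε
  set f : S × (Fin n → ℝ) → ℂ := fun z =>
    Complex.exp ((t * standardizedSum P V X Z z : ℝ) * Complex.I) with hf
  have hfm : Measurable f := by fun_prop
  have hf1 : ∀ z, ‖f z‖ = 1 := fun z => Complex.norm_exp_ofReal_mul_I _
  have hfi : Integrable (fun ω => f (V ω, X ω)) P :=
    (integrable_const (1 : ℝ)).mono' (hfm.comp (hV.prodMk hXm)).aestronglyMeasurable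
      (ae_of_all _ fun ω => (hf1 _).le)
  have h1 := condExp_prod_ae_eq_integral_condDistrib (μ := P) hV hXm.aemeasurable
    hfm.stronglyMeasurable hfi
  set e : ℂ := ((Real.exp (-(t ^ 2 / 2)) : ℝ) : ℂ) with he
  have he1 : ‖e‖ ≤ 1 := by
    rw [he, Complex.norm_real, Real.norm_eq_abs, abs_of_pos (Real.exp_pos _), Real.exp_le_one_iff]
    have := sq_nonneg t
    linarith
  have hAm : MeasurableSet {ω | V ω ∉ A} := hV hA.compl
  calc ‖∫ ω, f (V ω, X ω) ∂P - e‖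
      = ‖∫ ω, (P[fun ω => f (V ω, X ω) | mS.comap V] ω - e) ∂P‖ := by
        rw [integral_sub integrable_condExp (integrable_const _), integral_condExp hV.comap_le]
        simp
    _ ≤ ∫ ω, (δ + {ω | V ω ∉ A}.indicator (fun _ => (2 : ℝ)) ω) ∂P := by
        refine norm_integral_le_of_norm_le
          ((integrable_const _).add ((integrable_const _).indicator hAm)) ?_
        filter_upwards [h1, condDistrib_ae_eq_pi hV hX hind, hmom] with ω h1 h2 h3
        rw [h1]
        by_cases hω : V ω ∈ A
        · rw [Set.indicator_of_notMem (by simpa using hω), add_zero, h2]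
          have hc := h (fun i => condDistrib (fun ω => X ω i) V P (V ω)) h3
            (fun i => Z (V ω) i / condScale P V X Z (V ω)) (fun i => abs_div_condScale_le hω i)
            (sum_div_condScale_sq hω.1)
          simp only [hf, standardizedSum]
          exact hc
        · rw [Set.indicator_of_mem (by simpa using hω)]
          refine (norm_sub_le _ _).trans ?_
          have : ‖∫ y, f (V ω, y) ∂(condDistrib X V P (V ω))‖ ≤ 1 := by
            refine (norm_integral_le_integral_norm _).trans ?_
            simp_rw [hf1]
            simp
          linarith
    _ = δ + 2 * P.real {ω | V ω ∉ A} := by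
        rw [integral_add (integrable_const _) ((integrable_const _).indicator hAm),
          integral_indicator_const _ hAm]
        simp [mul_comm]

lemma measure_standardizedSum_ge_le {V : Ω → S} (hV : Measurable V)
    {X : Ω → Fin n → ℝ} (hX : ∀ i, Measurable fun ω => X ω i)
    (hind : CondIndepFamily P (mS.comap V) fun i ω => X ω i) (hmom : CondMomentBounds P V X κ K)
    (hκ : 0 < κ) {Z : S → Fin n → ℝ} (hZ : ∀ i, Measurable fun v => Z v i) (ε : ℝ) {M : ℝ}
    (hM : 0 < M) :
    P {ω | M ≤ |standardizedSum P V X Z (V ω, X ω)|}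
      ≤ P {ω | V ω ∉ negligibleWeights P V X Z ε} + ENNReal.ofReal (1 / M ^ 2) := by
  refine measure_le_of_forall_pi_le hV hX hind hmom
    (B := {z | M ≤ |standardizedSum P V X Z z|})
    (measurableSet_le measurable_const (measurable_standardizedSum hZ).abs)
    (measurableSet_negligibleWeights hZ ε) fun v hv hm => ?_
  exact measure_pi_abs_sum_ge_le hκ hm (sum_div_condScale_sq hv.1) hM

lemma measure_abs_sum_sq_sub_one_le {V : Ω → S} (hV : Measurable V)
    {X : Ω → Fin n → ℝ} (hX : ∀ i, Measurable fun ω => X ω i)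
    (hind : CondIndepFamily P (mS.comap V) fun i ω => X ω i) (hmom : CondMomentBounds P V X κ K)
    {Z : S → Fin n → ℝ} (hZ : ∀ i, Measurable fun v => Z v i) {δ ε : ℝ}
    (h : ∀ (ν : Fin n → Measure ℝ)
      [∀ i, IsProbabilityMeasure (ν i)], (∀ i, MomentBounds κ K (ν i)) → ∀ c : Fin n → ℝ,
      (∀ i, |c i| ≤ ε) → ∑ i, c i ^ 2 * ∫ x, x ^ 2 ∂(ν i) = 1 →
      Measure.pi ν {u | δ ≤ |∑ i, c i ^ 2 * u i ^ 2 - 1|} ≤ ENNReal.ofReal δ) :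
    P {ω | δ ≤ |(∑ i, Z (V ω) i ^ 2 * X ω i ^ 2) / condScale P V X Z (V ω) ^ 2 - 1|}
      ≤ P {ω | V ω ∉ negligibleWeights P V X Z ε} + ENNReal.ofReal δ := by
  have hs := measurable_condScale (P := P) (V := V) (X := X) hZ
  refine measure_le_of_forall_pi_le hV hX hind hmom
    (B := {z | δ ≤ |(∑ i, Z z.1 i ^ 2 * z.2 i ^ 2) / condScale P V X Z z.1 ^ 2 - 1|}) ?_
    (measurableSet_negligibleWeights hZ ε) fun v hv hm => ?_
  · refine measurableSet_le measurable_const (Measurable.abs (Measurable.sub_const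
      ((Finset.measurable_sum _ fun i _ => ?_).div ((hs.comp measurable_fst).pow_const 2)) 1))
    exact (((hZ i).comp measurable_fst).pow_const 2).mul
      (((measurable_pi_apply i).comp measurable_snd).pow_const 2)
  · have := h _ hm _ (abs_div_condScale_le hv) (sum_div_condScale_sq hv.1)
    refine le_of_eq_of_le ?_ this
    congr 1
    ext u
    simp only [Set.mem_ofPred_eq, Finset.sum_div, div_pow, div_mul_eq_mul_div]

end ConditionalProbabilityBounds

section ArrayLimits

variable {Ω S : ℕ → Type*} [∀ n, MeasurableSpace (Ω n)] [mS : ∀ n, MeasurableSpace (S n)]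
  {P : ∀ n, Measure (Ω n)} [∀ n, IsProbabilityMeasure (P n)] {κ K : ℝ}

/-- A triangular array of weighted sums `∑ Zᵢ Xᵢ`, with `Z` a function of `V`, and variables `X`
that are conditionally independent given `V`. -/
structure WeightedArray (P : ∀ n, Measure (Ω n)) [∀ n, IsProbabilityMeasure (P n)]
    (V : ∀ n, Ω n → S n) (X : ∀ n, Ω n → Fin n → ℝ) (Z : ∀ n, S n → Fin n → ℝ) (κ K : ℝ) :
    Prop where
  measurable_V : ∀ n, Measurable (V n)
  measurable_X : ∀ n i, Measurable fun ω => X n ω i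
  measurable_Z : ∀ n i, Measurable fun v => Z n v i
  condIndep : ∀ n, CondIndepFamily (P n) ((mS n).comap (V n)) fun i ω => X n ω i
  moments : ∀ n, CondMomentBounds (P n) (V n) (X n) κ K
  kappa_pos : 0 < κ
  kappa_le : κ ≤ 1
  K_pos : 0 < K
  negligible : ∀ ε : ℝ, 0 < ε → ∀ᶠ x in wpFilter P,
    V x.1 x.2 ∈ negligibleWeights (P x.1) (V x.1) (X x.1) (Z x.1) ε

variable {V : ∀ n, Ω n → S n} {X : ∀ n, Ω n → Fin n → ℝ} {Z : ∀ n, S n → Fin n → ℝ}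

lemma WeightedArray.tendsto_measure_notMem (h : WeightedArray P V X Z κ K) {ε : ℝ} (hε : 0 < ε) :
    Tendsto (fun n => P n {ω | V n ω ∉ negligibleWeights (P n) (V n) (X n) (Z n) ε})
      atTop (𝓝 0) :=
  (eventually_wpFilter_iff
    (q := fun n ω => V n ω ∈ negligibleWeights (P n) (V n) (X n) (Z n) ε)).1 (h.negligible ε hε)

lemma WeightedArray.tendsto_integral_exp (h : WeightedArray P V X Z κ K) (t : ℝ) :
    Tendsto (fun n => ∫ ω, Complex.exp ((t * standardizedSum (P n) (V n) (X n) (Z n)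
      (V n ω, X n ω) : ℝ) * Complex.I) ∂(P n)) atTop (𝓝 (Real.exp (-(t ^ 2 / 2)) : ℝ)) := by
  rw [Metric.tendsto_nhds]
  intro δ hδ
  obtain ⟨ε, hε, hb⟩ := exists_charFun_pi_sub_le h.kappa_pos h.kappa_le h.K_pos t
    (show 0 < δ / 2 by positivity)
  have hlim := (ENNReal.tendsto_toReal (ENNReal.zero_ne_top)).comp (h.tendsto_measure_notMem hε)
  rw [ENNReal.toReal_zero] at hlim
  filter_upwards [hlim.eventually (gt_mem_nhds (show 0 < δ / 4 by positivity))] with n hn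
  rw [dist_eq_norm]
  have := norm_integral_exp_standardizedSum_sub_le (h.measurable_V n) (h.measurable_X n)
    (h.condIndep n) (h.moments n) (h.measurable_Z n) (show 0 ≤ δ / 2 by positivity)
    (t := t) (ε := ε) (fun ν _ hν c => hb n ν hν c)
  simp only [Function.comp_apply] at hn
  rw [measureReal_def] at this
  linarith

lemma WeightedArray.isBigOpOne (h : WeightedArray P V X Z κ K) :
    IsBigOpOne P fun n ω => standardizedSum (P n) (V n) (X n) (Z n) (V n ω, X n ω) := by
  intro δ hδ
  refine ⟨Real.sqrt (2 / δ), by positivity, ?_⟩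
  have hlim := h.tendsto_measure_notMem one_pos
  rw [ENNReal.tendsto_nhds_zero] at hlim
  filter_upwards [hlim (ENNReal.ofReal (δ / 2)) (by simpa using hδ)] with n hn
  refine (measure_standardizedSum_ge_le (h.measurable_V n) (h.measurable_X n)
    (h.condIndep n) (h.moments n) h.kappa_pos (h.measurable_Z n) 1 (by positivity)).trans ?_
  refine (add_le_add hn le_rfl).trans_eq ?_
  rw [Real.sq_sqrt (by positivity), ← ENNReal.ofReal_add (by positivity) (by positivity)]
  congr 1
  field_simp
  norm_num

lemma WeightedArray.tendsto_sum_sq_div (h : WeightedArray P V X Z κ K) :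
    Tendsto (fun x : Σ n, Ω n => (∑ i, Z x.1 (V x.1 x.2) i ^ 2 * X x.1 x.2 i ^ 2)
      / condScale (P x.1) (V x.1) (X x.1) (Z x.1) (V x.1 x.2) ^ 2) (wpFilter P) (𝓝 1) := by
  rw [tendsto_iff_dist_tendsto_zero]
  have key : Tendsto (fun x : Σ n, Ω n => (∑ i, Z x.1 (V x.1 x.2) i ^ 2 * X x.1 x.2 i ^ 2)
      / condScale (P x.1) (V x.1) (X x.1) (Z x.1) (V x.1 x.2) ^ 2 - 1) (wpFilter P) (𝓝 0) := by
    refine (isLittleOpOne_iff (X := fun n ω => (∑ i, Z n (V n ω) i ^ 2 * X n ω i ^ 2)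
      / condScale (P n) (V n) (X n) (Z n) (V n ω) ^ 2 - 1)).1 ?_
    intro δ' hδ'
    rw [ENNReal.tendsto_nhds_zero]
    intro b hb
    by_cases hbt : b = ∞
    · simp [hbt]
    have hb' : 0 < b.toReal := ENNReal.toReal_pos hb.ne' hbt
    set δ := min δ' (b.toReal / 2) with hδdef
    have hδ : 0 < δ := lt_min hδ' (by positivity)
    obtain ⟨ε, hε, hB⟩ := exists_measure_pi_sum_sq_sub_one_le h.kappa_pos h.K_pos hδ
    have hlim := h.tendsto_measure_notMem hε
    rw [ENNReal.tendsto_nhds_zero] at hlim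
    filter_upwards [hlim (ENNReal.ofReal (b.toReal / 2)) (by simpa using hb')] with n hn
    have h1 := measure_abs_sum_sq_sub_one_le (h.measurable_V n) (h.measurable_X n)
      (h.condIndep n) (h.moments n) (h.measurable_Z n) (δ := δ) (ε := ε)
      (fun ν _ hν c => hB n ν hν c)
    refine (measure_mono fun ω hω => ?_).trans (h1.trans ((add_le_add hn
      (ENNReal.ofReal_le_ofReal (min_le_right _ _))).trans_eq ?_))
    · exact (min_le_left _ _).trans (show δ' ≤ _ from hω)
    · rw [← ENNReal.ofReal_add (by positivity) (by positivity), add_halves,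
        ENNReal.ofReal_toReal hbt]
  simpa [Real.dist_eq] using key.abs

end ArrayLimits

section ArrayQuadraticForms

variable {Ω S : ℕ → Type*} [∀ n, MeasurableSpace (Ω n)] [mS : ∀ n, MeasurableSpace (S n)]
  {P : ∀ n, Measure (Ω n)} [∀ n, IsProbabilityMeasure (P n)] {K : ℝ}
  {V : ∀ n, Ω n → S n} {X : ∀ n, Ω n → Fin n → ℝ}

/-- An array of variables with bounded fourth moments that are conditionally independent
given `V`. -/
structure FourthMomentArray (P : ∀ n, Measure (Ω n)) [∀ n, IsProbabilityMeasure (P n)]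
    (V : ∀ n, Ω n → S n) (X : ∀ n, Ω n → Fin n → ℝ) (K : ℝ) : Prop where
  measurable_V : ∀ n, Measurable (V n)
  measurable_X : ∀ n i, Measurable fun ω => X n ω i
  condIndep : ∀ n, CondIndepFamily (P n) ((mS n).comap (V n)) fun i ω => X n ω i
  moments : ∀ n, CondMomentBounds (P n) (V n) (X n) 2 K
  K_pos : 0 < K

lemma tendsto_ofReal_const_div_natCast (C : ℝ) :
    Tendsto (fun n : ℕ => ENNReal.ofReal (C / n)) atTop (𝓝 0) := by
  have := ENNReal.tendsto_ofReal (tendsto_const_div_atTop_nhds_zero_nat C)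
  rwa [ENNReal.ofReal_zero] at this

lemma FourthMomentArray.measure_le (h : FourthMomentArray P V X K) {n : ℕ}
    {B : Set (S n × (Fin n → ℝ))} (hB : MeasurableSet B) {b : ℝ≥0∞}
    (hb : ∀ (v : S n) (τ : Fin n → Measure ℝ) [∀ i, IsProbabilityMeasure (τ i)],
      (∀ i, MomentBounds 2 K (τ i)) → Measure.pi τ {x | (v, x) ∈ B} ≤ b) :
    P n {ω | (V n ω, X n ω) ∈ B} ≤ b := by
  have := measure_le_of_forall_pi_le (h.measurable_V n) (h.measurable_X n) (h.condIndep n)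
    (h.moments n) hB MeasurableSet.univ (b := b) fun v _ hm => hb v _ hm
  simpa using this

lemma measurable_sum_matrix_mul {n : ℕ} {T : Type*} [MeasurableSpace T]
    {A : T → Matrix (Fin n) (Fin n) ℝ} (hA : ∀ i j, Measurable fun v => A v i j) (i : Fin n) :
    Measurable fun z : T × (Fin n → ℝ) => ∑ j, A z.1 i j * z.2 j :=
  Finset.measurable_sum _ fun j _ => ((hA i j).comp measurable_fst).mul
    ((measurable_pi_apply j).comp measurable_snd)

lemma FourthMomentArray.eventually_projection_gt (h : FourthMomentArray P V X K)
    {A : ∀ n, S n → Matrix (Fin n) (Fin n) ℝ} (hAm : ∀ n i j, Measurable fun v => A n v i j)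
    (hA : ∀ n v i j, A n v i j = A n v j i) (hAA : ∀ n v, A n v * A n v = A n v) {s : ℝ}
    (hs : 0 < s) :
    ∀ᶠ x in wpFilter P, (A x.1 (V x.1 x.2)).trace / K - s * x.1
      < ∑ i, (∑ j, A x.1 (V x.1 x.2) i j * X x.1 x.2 j) ^ 2 := by
  refine eventually_wpFilter_of_le (q := fun n ω => (A n (V n ω)).trace / K - s * n
      < ∑ i, (∑ j, A n (V n ω) i j * X n ω j) ^ 2)
    (tendsto_ofReal_const_div_natCast (8 * K / s ^ 2)) ?_
  filter_upwards [eventually_gt_atTop 0] with n hn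
  have hn : (0 : ℝ) < n := by exact_mod_cast hn
  simp only [not_lt]
  refine h.measure_le (B := {z | ∑ i, (∑ j, A n z.1 i j * z.2 j) ^ 2
    ≤ (A n z.1).trace / K - s * n}) (measurableSet_le (Finset.measurable_sum _ fun i _ =>
      (measurable_sum_matrix_mul (hAm n) i).pow_const 2) ?_) fun v τ _ hτ => ?_
  · exact ((Finset.measurable_sum _ fun i _ =>
      ((hAm n i i).comp measurable_fst)).div_const K).sub_const _
  · refine (measure_pi_projection_le hτ h.K_pos (hA n v) (hAA n v)
      (show 0 < s * n by positivity)).trans (ENNReal.ofReal_le_ofReal (le_of_eq ?_))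
    field_simp

lemma FourthMomentArray.eventually_sum_sq_lt (h : FourthMomentArray P V X K) :
    ∀ᶠ x in wpFilter P, ∑ i, X x.1 x.2 i ^ 2 < (2 + K) * x.1 := by
  refine eventually_wpFilter_of_le (q := fun n ω => ∑ i, X n ω i ^ 2 < (2 + K) * n)
    (tendsto_ofReal_const_div_natCast (8 * K)) ?_
  filter_upwards [eventually_gt_atTop 0] with n hn
  have hn : (0 : ℝ) < n := by exact_mod_cast hn
  simp only [not_lt]
  refine h.measure_le (B := {z | (2 + K) * n ≤ ∑ i, z.2 i ^ 2}) (measurableSet_le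
    measurable_const (by fun_prop)) fun v τ _ hτ => ?_
  have := measure_pi_sum_sq_ge_le hτ hn
  rw [show (1 + K) * (n : ℝ) + n = (2 + K) * n by ring] at this
  refine this.trans (ENNReal.ofReal_le_ofReal (le_of_eq ?_))
  field_simp

lemma FourthMomentArray.eventually_forall_abs_lt (h : FourthMomentArray P V X K)
    {A : ∀ n, S n → Matrix (Fin n) (Fin n) ℝ} (hAm : ∀ n i j, Measurable fun v => A n v i j)
    (hA : ∀ n v i, ∑ j, A n v i j ^ 2 ≤ 1) {ε : ℝ} (hε : 0 < ε) :
    ∀ᶠ x in wpFilter P, ∀ i, |∑ j, A x.1 (V x.1 x.2) i j * X x.1 x.2 j| < ε * Real.sqrt x.1 := by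
  refine eventually_wpFilter_of_le
    (q := fun n ω => ∀ i, |∑ j, A n (V n ω) i j * X n ω j| < ε * Real.sqrt n)
    (tendsto_ofReal_const_div_natCast ((16 * K + 2 * (1 + K) ^ 2) / ε ^ 4)) ?_
  filter_upwards [eventually_gt_atTop 0] with n hn
  have hn : (0 : ℝ) < n := by exact_mod_cast hn
  simp only [not_forall, not_lt]
  refine h.measure_le (B := {z | ∃ i, ε * Real.sqrt n ≤ |∑ j, A n z.1 i j * z.2 j|}) ?_
    fun v τ _ hτ => ?_
  · have : {z : S n × (Fin n → ℝ) | ∃ i, ε * Real.sqrt n ≤ |∑ j, A n z.1 i j * z.2 j|}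
        = ⋃ i, {z | ε * Real.sqrt n ≤ |∑ j, A n z.1 i j * z.2 j|} := by
      ext z
      simp
    rw [this]
    exact MeasurableSet.iUnion fun i => measurableSet_le measurable_const
      (measurable_sum_matrix_mul (hAm n) i).abs
  · refine (measure_pi_exists_ge_le hτ h.K_pos (hA n v)
      (show 0 < ε * Real.sqrt n by positivity)).trans (ENNReal.ofReal_le_ofReal (le_of_eq ?_))
    rw [mul_pow, show Real.sqrt n ^ 4 = (n : ℝ) ^ 2 by
      rw [show 4 = 2 * 2 by norm_num, pow_mul, Real.sq_sqrt hn.le]]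
    field_simp

end ArrayQuadraticForms

section Model

variable {Ω : ℕ → Type*} [∀ n, MeasurableSpace (Ω n)] {P : ∀ n, Measure (Ω n)}
  {p : ℕ → ℕ} {W : ∀ n, Ω n → Matrix (Fin n) (Fin (p n)) ℝ}
  {Y D U Dt : ∀ n, Ω n → Fin n → ℝ} {β : ℕ → ℝ} {γ δ : ∀ n, Fin (p n) → ℝ} {K η : ℝ}

/-- The controls as a random array of numbers. -/
@[reducible] def controlArray {Ω : Type*} {n p : ℕ} (W : Ω → Matrix (Fin n) (Fin p) ℝ) (ω : Ω) :
    Fin n → Fin p → ℝ :=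
  fun i j => W ω i j

lemma sigmaDW_eq_comap {Ω : Type*} {n p : ℕ} (D : Ω → Fin n → ℝ)
    (W : Ω → Matrix (Fin n) (Fin p) ℝ) :
    sigmaDW D W = (inferInstance : MeasurableSpace ((Fin n → ℝ) × (Fin n → Fin p → ℝ))).comap
      fun ω => (D ω, controlArray W ω) :=
  (MeasurableSpace.comap_prodMk D (controlArray W)).symm

namespace IsLinearModel

variable (hm : IsLinearModel P p W Y D U Dt β γ δ)

include hm

lemma measurable_dotProduct (n : ℕ) (d : Fin (p n) → ℝ) (i : Fin n) :
    Measurable fun ω => W n ω i ⬝ᵥ d :=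
  Finset.measurable_sum _ fun j _ => (hm.measurable_W n i j).mul_const _

lemma measurable_D (n : ℕ) (i : Fin n) : Measurable fun ω => D n ω i := by
  simp_rw [hm.propensity]
  exact (hm.measurable_dotProduct n (δ n) i).add (hm.measurable_Dt n i)

lemma measurable_Y (n : ℕ) (i : Fin n) : Measurable fun ω => Y n ω i := by
  simp_rw [hm.outcome]
  exact (((hm.measurable_D n i).mul_const _).add (hm.measurable_dotProduct n (γ n) i)).add
    (hm.measurable_U n i)

lemma measurable_controlArray (n : ℕ) : Measurable (controlArray (W n)) :=
  measurable_pi_lambda _ fun i => measurable_pi_lambda _ fun j => hm.measurable_W n i j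

lemma measurable_prodMk (n : ℕ) : Measurable fun ω => (D n ω, controlArray (W n) ω) :=
  (measurable_pi_lambda _ fun i => hm.measurable_D n i).prodMk (hm.measurable_controlArray n)

lemma comap_eq (n : ℕ) :
    ((inferInstance : MeasurableSpace ((Fin n → Fin (p n) → ℝ) × (Fin n → ℝ))).comap
      fun ω => (controlArray (W n) ω, Dt n ω)) = sigmaDW (D n) (W n) := by
  rw [sigmaDW_eq_comap]
  have hdot : Measurable fun w : Fin n → Fin (p n) → ℝ => fun i => w i ⬝ᵥ δ n :=
    measurable_pi_lambda _ fun i => Finset.measurable_sum _ fun j _ => by fun_prop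
  apply le_antisymm
  · have hf : Measurable fun z : (Fin n → ℝ) × (Fin n → Fin (p n) → ℝ) =>
        (z.2, z.1 - fun i => z.2 i ⬝ᵥ δ n) :=
      measurable_snd.prodMk (measurable_fst.sub (hdot.comp measurable_snd))
    have := (hf.comp (comap_measurable fun ω => (D n ω, controlArray (W n) ω))).comap_le
    refine le_trans (le_of_eq ?_) this
    congr 1
    funext ω
    ext i
    · rfl
    · simp [hm.propensity]
  · have hf : Measurable fun z : (Fin n → Fin (p n) → ℝ) × (Fin n → ℝ) =>
        ((fun i => z.1 i ⬝ᵥ δ n) + z.2, z.1) :=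
      ((hdot.comp measurable_fst).add measurable_snd).prodMk measurable_fst
    have := (hf.comp (comap_measurable fun ω => (controlArray (W n) ω, Dt n ω))).comap_le
    refine le_trans (le_of_eq ?_) this
    congr 1
    funext ω
    ext i
    · simp [hm.propensity]
    · rfl

variable [∀ n, IsProbabilityMeasure (P n)] (he : ErrorConditions P p W D U Dt K η)

include he

lemma fourthMomentArray : FourthMomentArray P (fun n => controlArray (W n)) Dt K := by
  refine ⟨hm.measurable_controlArray, hm.measurable_Dt,
    fun n => (he.condIndep n).comp (f := Prod.snd) measurable_snd, fun n => ?_, he.K_pos⟩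
  have h4 : ∀ x : ℝ, |x| ^ ((2 : ℝ) + 2) = |x| ^ 4 := fun x => by
    rw [abs_rpow_two_add_two]
    exact (Even.pow_abs (by decide) x).symm
  refine condMomentBounds_of_condExp (hm.measurable_controlArray n) (hm.measurable_Dt n)
    two_pos (hm.integrable_Dt n) (fun i => ?_) (hm.condExp_Dt n) (fun i => ?_) fun i => ?_
  · simp_rw [h4]
    exact he.integrable_Dt_pow n i
  · simp_rw [h4]
    have h0 : 0 ≤ᵐ[P n] (P n)[fun ω => |U n ω i| ^ (2 + η) | sigmaDW (D n) (W n)] :=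
      condExp_nonneg (ae_of_all _ fun ω => by positivity)
    filter_upwards [he.moment_upper n i, h0] with ω h1 h0
    simp only [Pi.zero_apply] at h0
    linarith
  · filter_upwards [he.moment_lower n i, he.var_Dt_pos n i, he.var_U_pos n i] with ω h1 h2 h3
    have : 1 / ((P n)[fun ω' => Dt n ω' i ^ 2 | sigmaW (W n)]) ω ≤ K := by
      have := one_div_pos.2 h3
      linarith
    exact (one_div_le h2 he.K_pos).1 this

lemma condIndep_U (n : ℕ) : CondIndepFamily (P n)
    ((inferInstance : MeasurableSpace ((Fin n → ℝ) × (Fin n → Fin (p n) → ℝ))).comap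
      fun ω => (D n ω, controlArray (W n) ω)) fun i ω => U n ω i := by
  have := CondIndepFamily.fst_of_pair (hm.measurable_controlArray n) (hm.measurable_U n)
    (hm.measurable_Dt n) (he.condIndep n)
  rwa [hm.comap_eq n, sigmaDW_eq_comap] at this

lemma condMomentBounds_U (n : ℕ) :
    CondMomentBounds (P n) (fun ω => (D n ω, controlArray (W n) ω)) (U n) (min η 1) (1 + K) := by
  have hσ := sigmaDW_eq_comap (D n) (W n)
  have h : CondMomentBounds (P n) (fun ω => (D n ω, controlArray (W n) ω)) (U n) η K := by
    refine condMomentBounds_of_condExp (hm.measurable_prodMk n) (hm.measurable_U n)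
      he.eta_pos (hm.integrable_U n) (he.integrable_U_rpow n) (fun i => ?_) (fun i => ?_)
      fun i => ?_
    · rw [← hσ]
      exact hm.condExp_U n i
    · rw [← hσ]
      have h0 : 0 ≤ᵐ[P n] (P n)[fun ω => |Dt n ω i| ^ 4 | sigmaW (W n)] :=
        condExp_nonneg (ae_of_all _ fun ω => by positivity)
      filter_upwards [he.moment_upper n i, h0] with ω h1 h0
      simp only [Pi.zero_apply] at h0
      linarith
    · rw [← hσ]
      filter_upwards [he.moment_lower n i, he.var_Dt_pos n i, he.var_U_pos n i] with ω h1 h2 h3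
      have : 1 / ((P n)[fun ω' => U n ω' i ^ 2 | sigmaDW (D n) (W n)]) ω ≤ K := by
        have := one_div_pos.2 h2
        linarith
      exact (one_div_le h3 he.K_pos).1 this
  filter_upwards [h] with ω hω i
  exact (hω i).min_one he.eta_pos he.K_pos

end IsLinearModel

end Model

section CharacteristicFunctions

variable {Ω : ℕ → Type*} [∀ n, MeasurableSpace (Ω n)] {P : ∀ n, Measure (Ω n)}
  [∀ n, IsProbabilityMeasure (P n)]

omit [∀ n, IsProbabilityMeasure (P n)] in
lemma eventually_wpFilter_of_ae {q : ∀ n, Ω n → Prop} (h : ∀ n, ∀ᵐ ω ∂(P n), q n ω) :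
    ∀ᶠ x in wpFilter P, q x.1 x.2 :=
  eventually_wpFilter_of_le (q := q) tendsto_const_nhds
    (Eventually.of_forall fun n => (ae_iff.1 (h n)).le)

omit [∀ n, IsProbabilityMeasure (P n)] in
lemma norm_exp_mul_I_sub_exp_mul_I_le (a b : ℝ) :
    ‖Complex.exp (a * Complex.I) - Complex.exp (b * Complex.I)‖ ≤ |a - b| := by
  have h : Complex.exp (a * Complex.I) - Complex.exp (b * Complex.I)
      = Complex.exp (b * Complex.I) * (Complex.exp (Complex.I * ((a - b : ℝ) : ℂ)) - 1) := by
    rw [mul_sub, ← Complex.exp_add, mul_one]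
    congr 2
    push_cast
    ring
  rw [h, norm_mul, Complex.norm_exp_ofReal_mul_I, one_mul]
  exact Real.norm_exp_I_mul_ofReal_sub_one_le

/-- Slutsky's theorem: variables that differ by `o_p(1)` from variables whose characteristic
functions converge to that of the normal law are asymptotically normal. -/
lemma tendstoInDistribution_gaussian_of_sub {T F : ∀ n, Ω n → ℝ} (hT : ∀ n, Measurable (T n))
    (hF : ∀ n, Measurable (F n))
    (hchar : ∀ t : ℝ, Tendsto (fun n => ∫ ω, Complex.exp ((t * T n ω : ℝ) * Complex.I) ∂(P n))
      atTop (𝓝 (Real.exp (-(t ^ 2 / 2)) : ℝ)))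
    (hsub : Tendsto (fun x : Σ n, Ω n => F x.1 x.2 - T x.1 x.2) (wpFilter P) (𝓝 0)) :
    TendstoInDistribution F atTop (id : ℝ → ℝ) P (gaussianReal 0 1) := by
  have hFm : ∀ n, AEMeasurable (F n) (P n) := fun n => (hF n).aemeasurable
  refine ⟨hFm, aemeasurable_id, ?_⟩
  refine ProbabilityMeasure.tendsto_iff_tendsto_charFun.2 fun t => ?_
  have e1 : charFun ((gaussianReal 0 1).map (id : ℝ → ℝ)) t
      = ((Real.exp (-(t ^ 2 / 2)) : ℝ) : ℂ) := by
    rw [Measure.map_id, charFun_gaussianReal]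
    push_cast
    congr 1
    norm_num
  have e2 : ∀ n, charFun ((P n).map (F n)) t
      = ∫ ω, Complex.exp ((t * F n ω : ℝ) * Complex.I) ∂(P n) := fun n => by
    rw [charFun_apply_real, integral_map (hFm n) (by fun_prop)]
    simp
  simp only [ProbabilityMeasure.coe_mk, e1, e2]
  have hdiff : Tendsto (fun n => ∫ ω, Complex.exp ((t * F n ω : ℝ) * Complex.I) ∂(P n)
      - ∫ ω, Complex.exp ((t * T n ω : ℝ) * Complex.I) ∂(P n)) atTop (𝓝 0) := by
    rw [Metric.tendsto_nhds]
    intro ε hε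
    set r : ℝ := ε / (4 * (|t| + 1)) with hr
    have hr0 : 0 < r := by positivity
    have hsub' := (isLittleOpOne_iff (X := fun n ω => F n ω - T n ω)).2 hsub r hr0
    have hlim := (ENNReal.tendsto_toReal (ENNReal.zero_ne_top)).comp hsub'
    rw [ENNReal.toReal_zero] at hlim
    filter_upwards [hlim.eventually (gt_mem_nhds (show 0 < ε / 4 by positivity))] with n hn
    simp only [Function.comp_apply] at hn
    have hi : ∀ {G : Ω n → ℝ}, Measurable G →
        Integrable (fun ω => Complex.exp ((t * G ω : ℝ) * Complex.I)) (P n) := fun hG =>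
      (integrable_const (1 : ℝ)).mono' (by fun_prop) (ae_of_all _ fun ω => by
        rw [Complex.norm_exp_ofReal_mul_I])
    have hB : MeasurableSet {ω | r ≤ |F n ω - T n ω|} :=
      measurableSet_le measurable_const ((hF n).sub (hT n)).abs
    rw [dist_zero_right, ← integral_sub (hi (hF n)) (hi (hT n))]
    calc _ ≤ ∫ ω, (|t| * r + {ω | r ≤ |F n ω - T n ω|}.indicator (fun _ => (2 : ℝ)) ω) ∂(P n) := by
          refine norm_integral_le_of_norm_le
            ((integrable_const _).add ((integrable_const _).indicator hB)) (ae_of_all _ fun ω => ?_)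
          by_cases hω : r ≤ |F n ω - T n ω|
          · rw [Set.indicator_of_mem (by exact hω)]
            refine (norm_sub_le _ _).trans ?_
            rw [Complex.norm_exp_ofReal_mul_I, Complex.norm_exp_ofReal_mul_I]
            have : 0 ≤ |t| * r := by positivity
            linarith
          · rw [Set.indicator_of_notMem (by exact hω), add_zero]
            refine (norm_exp_mul_I_sub_exp_mul_I_le _ _).trans ?_
            rw [← mul_sub, abs_mul]
            exact mul_le_mul_of_nonneg_left (not_le.1 hω).le (abs_nonneg _)
      _ = |t| * r + 2 * (P n {ω | r ≤ |F n ω - T n ω|}).toReal := by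
          rw [integral_add (integrable_const _) ((integrable_const _).indicator hB),
            integral_indicator_const _ hB]
          simp [mul_comm, measureReal_def]
      _ < ε := by
          have : |t| * r ≤ ε / 4 := by
            rw [hr, ← mul_div_assoc, div_le_div_iff₀ (by positivity) (by positivity)]
            nlinarith [abs_nonneg t]
          linarith
  have := hdiff.add (hchar t)
  simpa using this

end CharacteristicFunctions

section HausmanWeights

variable {n p : ℕ}

lemma sum_hausmanWeight_sq {W : Matrix (Fin n) (Fin p) ℝ} {D x : Fin n → ℝ}
    (hx : ∑ i, olsResidual W D i * x i = ∑ i, olsResidual W D i ^ 2)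
    (h1 : 0 < ∑ i, olsResidual W D i ^ 2) (h2 : 0 < ∑ i, x i ^ 2) :
    ∑ i, hausmanWeight W D x i ^ 2
      = (∑ i, x i ^ 2 - ∑ i, olsResidual W D i ^ 2)
        / ((∑ i, olsResidual W D i ^ 2) * ∑ i, x i ^ 2) := by
  simp only [hausmanWeight]
  set R := olsResidual W D with hR
  set a := ∑ i, R i ^ 2 with ha
  set b := ∑ i, x i ^ 2 with hb
  have : ∀ i, (R i / a - x i / b) ^ 2
      = (1 / a ^ 2) * R i ^ 2 - (2 / (a * b)) * (R i * x i) + (1 / b ^ 2) * x i ^ 2 := fun i => by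
    field_simp
    ring
  simp_rw [this]
  rw [Finset.sum_add_distrib, Finset.sum_sub_distrib, ← Finset.mul_sum, ← Finset.mul_sum,
    ← Finset.mul_sum, hx, ← ha, ← hb]
  field_simp
  ring

/-- Bounds on the residuals that hold with probability tending to one. -/
structure ResidualBounds (W : Matrix (Fin n) (Fin p) ℝ) (D x : Fin n → ℝ) (c C : ℝ) : Prop where
  pos : (0 : ℝ) < n
  cross : ∑ i, olsResidual W D i * x i = ∑ i, olsResidual W D i ^ 2
  le_residual : c * n ≤ ∑ i, olsResidual W D i ^ 2
  le_projection : c * n ≤ ∑ i, x i ^ 2 - ∑ i, olsResidual W D i ^ 2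
  le_upper : ∑ i, x i ^ 2 ≤ C * n

namespace ResidualBounds

variable {W : Matrix (Fin n) (Fin p) ℝ} {D x : Fin n → ℝ} {c C : ℝ}

lemma residual_pos (h : ResidualBounds W D x c C) (hc : 0 < c) :
    0 < ∑ i, olsResidual W D i ^ 2 :=
  (mul_pos hc h.pos).trans_le h.le_residual

lemma le_sum_sq (h : ResidualBounds W D x c C) (hc : 0 < c) : c * n ≤ ∑ i, x i ^ 2 := by
  have := mul_pos hc h.pos
  linarith [h.le_residual, h.le_projection]

lemma sum_sq_pos (h : ResidualBounds W D x c C) (hc : 0 < c) : 0 < ∑ i, x i ^ 2 :=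
  (mul_pos hc h.pos).trans_le (h.le_sum_sq hc)

lemma le_weights (h : ResidualBounds W D x c C) (hc : 0 < c) (hC : 0 < C) :
    c / C ^ 2 ≤ n * ∑ i, hausmanWeight W D x i ^ 2 := by
  have hn := h.pos
  have h1 := h.residual_pos hc
  have h2 := h.sum_sq_pos hc
  have h3 : ∑ i, olsResidual W D i ^ 2 ≤ C * n := by
    linarith [h.le_projection, h.le_upper, mul_pos hc h.pos]
  rw [sum_hausmanWeight_sq h.cross h1 h2, ← mul_div_assoc,
    div_le_div_iff₀ (by positivity) (by positivity)]
  calc c * ((∑ i, olsResidual W D i ^ 2) * ∑ i, x i ^ 2)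
      ≤ c * ((C * n) * (C * n)) := by
        gcongr
        exact h.le_upper
    _ = n * (c * n) * C ^ 2 := by ring
    _ ≤ _ := by
        gcongr
        exact h.le_projection

lemma weights_le (h : ResidualBounds W D x c C) (hc : 0 < c) :
    n * ∑ i, hausmanWeight W D x i ^ 2 ≤ 1 / c := by
  have hn := h.pos
  have h1 := h.residual_pos hc
  have h2 := h.sum_sq_pos hc
  rw [sum_hausmanWeight_sq h.cross h1 h2, ← mul_div_assoc,
    div_le_div_iff₀ (by positivity) (by positivity)]
  have h3 := h.le_residual
  have h4 : n * (∑ i, x i ^ 2 - ∑ i, olsResidual W D i ^ 2) * c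
      ≤ (c * n) * ∑ i, x i ^ 2 := by nlinarith [mul_pos hc hn]
  nlinarith

lemma sqrt_mul_abs_weight_le (h : ResidualBounds W D x c C) (hc : 0 < c) {ε : ℝ} (hε : 0 < ε)
    {i : Fin n} (h1 : |olsResidual W D i| ≤ ε * Real.sqrt n) (h2 : |x i| ≤ ε * Real.sqrt n) :
    Real.sqrt n * |hausmanWeight W D x i| ≤ 2 * ε / c := by
  have hn := h.pos
  have hcn := mul_pos hc hn
  have a1 : |olsResidual W D i / ∑ k, olsResidual W D k ^ 2| ≤ ε * Real.sqrt n / (c * n) := by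
    rw [abs_div, abs_of_pos (h.residual_pos hc)]
    have := h.le_residual
    gcongr
  have a2 : |x i / ∑ k, x k ^ 2| ≤ ε * Real.sqrt n / (c * n) := by
    rw [abs_div, abs_of_pos (h.sum_sq_pos hc)]
    have := h.le_sum_sq hc
    gcongr
  have a3 : |hausmanWeight W D x i| ≤ 2 * (ε * Real.sqrt n / (c * n)) := by
    rw [hausmanWeight]
    exact (abs_sub _ _).trans (by linarith)
  calc _ ≤ Real.sqrt n * (2 * (ε * Real.sqrt n / (c * n))) := by gcongr
    _ = 2 * ε * (Real.sqrt n * Real.sqrt n) / (c * n) := by ring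
    _ = 2 * ε / c := by
        rw [Real.mul_self_sqrt hn.le]
        field_simp

end ResidualBounds

lemma sum_olsResidual_mul_of_eq_add {W : Matrix (Fin n) (Fin p) ℝ} {D x : Fin n → ℝ}
    {d : Fin p → ℝ} (h : ∀ i, D i = (W i ⬝ᵥ d) + x i) :
    ∑ i, olsResidual W D i * x i = ∑ i, olsResidual W D i ^ 2 := by
  simp_rw [olsResidual_eq_of_eq_add h]
  rw [sum_sq_mulVec_of_idempotent (annihilator_symm W) (annihilator_mul_self W)]
  refine Finset.sum_congr rfl fun i _ => ?_
  rw [Finset.sum_mul]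
  exact Finset.sum_congr rfl fun j _ => by ring

lemma sum_sq_sub_sum_olsResidual_sq {W : Matrix (Fin n) (Fin p) ℝ} {D x : Fin n → ℝ}
    {d : Fin p → ℝ} (h : ∀ i, D i = (W i ⬝ᵥ d) + x i) :
    ∑ i, x i ^ 2 - ∑ i, olsResidual W D i ^ 2 = ∑ i, (∑ j, projMatrix W i j * x j) ^ 2 := by
  simp_rw [olsResidual_eq_of_eq_add h]
  rw [sum_sq_mulVec_of_idempotent (annihilator_symm W) (annihilator_mul_self W),
    sum_sq_mulVec_of_idempotent (projMatrix_symm W) (projMatrix_mul_self W),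
    ← Finset.sum_sub_distrib]
  refine Finset.sum_congr rfl fun i _ => ?_
  simp only [annihilator, Matrix.sub_apply, Matrix.one_apply, sub_mul, Finset.sum_sub_distrib]
  simp [sq]

/-- The Frisch-Waugh-Lovell representation of the error of the OLS estimator. -/
lemma betaOLS_eq {W : Matrix (Fin n) (Fin p) ℝ} {Y D x u : Fin n → ℝ} {b : ℝ}
    {d e : Fin p → ℝ} (hD : ∀ i, D i = (W i ⬝ᵥ d) + x i)
    (hY : ∀ i, Y i = D i * b + (W i ⬝ᵥ e) + u i) (h0 : 0 < ∑ i, olsResidual W D i ^ 2) :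
    betaOLS W D Y
      = b + (∑ i, olsResidual W D i * u i) / ∑ i, olsResidual W D i ^ 2 := by
  have h1 : ∑ i, olsResidual W D i * D i = ∑ i, olsResidual W D i ^ 2 := by
    conv_lhs => enter [2, i, 2]; rw [hD i]
    simp_rw [mul_add]
    rw [Finset.sum_add_distrib, sum_olsResidual_mul_dotProduct, zero_add,
      sum_olsResidual_mul_of_eq_add hD]
  have h2 : ∑ i, olsResidual W D i * Y i
      = b * ∑ i, olsResidual W D i ^ 2 + ∑ i, olsResidual W D i * u i := by
    simp_rw [hY, mul_add]
    rw [Finset.sum_add_distrib, Finset.sum_add_distrib, sum_olsResidual_mul_dotProduct, add_zero,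
      ← h1, Finset.mul_sum]
    congr 1
    exact Finset.sum_congr rfl fun i _ => by ring
  rw [betaOLS, h2, add_div, mul_div_cancel_right₀ _ h0.ne']

lemma sum_hausmanWeight_mul {W : Matrix (Fin n) (Fin p) ℝ} {D x u : Fin n → ℝ} :
    ∑ i, hausmanWeight W D x i * u i
      = (∑ i, olsResidual W D i * u i) / (∑ i, olsResidual W D i ^ 2)
        - (∑ i, x i * u i) / ∑ i, x i ^ 2 := by
  simp only [hausmanWeight, sub_mul, Finset.sum_sub_distrib, Finset.sum_div]
  congr 1 <;> exact Finset.sum_congr rfl fun i _ => by ring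

lemma measurable_hausmanWeight {α : Type*} [MeasurableSpace α] {W : α → Matrix (Fin n) (Fin p) ℝ}
    (hW : ∀ i j, Measurable fun a => W a i j) {D T : α → Fin n → ℝ}
    (hD : ∀ i, Measurable fun a => D a i) (hT : ∀ i, Measurable fun a => T a i) (i : Fin n) :
    Measurable fun a => hausmanWeight (W a) (D a) (T a) i := by
  have hR := measurable_olsResidual hW hD
  exact ((hR i).div (Finset.measurable_sum _ fun k _ => (hR k).pow_const 2)).sub
    ((hT i).div (Finset.measurable_sum _ fun k _ => (hT k).pow_const 2))

lemma measurable_hausmanSE {α : Type*} [MeasurableSpace α] {W : α → Matrix (Fin n) (Fin p) ℝ}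
    (hW : ∀ i j, Measurable fun a => W a i j) {D T u : α → Fin n → ℝ}
    (hD : ∀ i, Measurable fun a => D a i) (hT : ∀ i, Measurable fun a => T a i)
    (hu : ∀ i, Measurable fun a => u a i) :
    Measurable fun a => hausmanSE (W a) (D a) (T a) (u a) :=
  (Finset.measurable_sum _ fun i _ => ((measurable_hausmanWeight hW hD hT i).pow_const 2).mul
    ((hu i).pow_const 2)).sqrt

lemma measurable_betaOLS {α : Type*} [MeasurableSpace α] {W : α → Matrix (Fin n) (Fin p) ℝ}
    (hW : ∀ i j, Measurable fun a => W a i j) {D Y : α → Fin n → ℝ}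
    (hD : ∀ i, Measurable fun a => D a i) (hY : ∀ i, Measurable fun a => Y a i) :
    Measurable fun a => betaOLS (W a) (D a) (Y a) := by
  have hR := measurable_olsResidual hW hD
  exact (Finset.measurable_sum _ fun k _ => (hR k).mul (hY k)).div
    (Finset.measurable_sum _ fun k _ => (hR k).pow_const 2)

end HausmanWeights

lemma natCast_div_natCast_toReal (p n : ℕ) :
    ((p : ℝ≥0∞) / (n : ℝ≥0∞)).toReal = (p : ℝ) / n := by
  simp [ENNReal.toReal_div]

lemma exists_pos_mul_le_of_liminf_pos {p : ℕ → ℕ}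
    (h : 0 < liminf (fun n => (p n : ℝ≥0∞) / (n : ℝ≥0∞)) atTop) :
    ∃ l : ℝ, 0 < l ∧ ∀ᶠ n : ℕ in atTop, l * n ≤ p n := by
  obtain ⟨l, hl0, hl⟩ := exists_between h
  refine ⟨l.toReal, ENNReal.toReal_pos hl0.ne' hl.ne_top, ?_⟩
  filter_upwards [eventually_lt_of_lt_liminf hl, eventually_gt_atTop 0] with n hn hn0
  have hn0' : (0 : ℝ) < n := by exact_mod_cast hn0
  have hne : (p n : ℝ≥0∞) / (n : ℝ≥0∞) ≠ ∞ :=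
    ENNReal.div_ne_top (ENNReal.natCast_ne_top _) (by exact_mod_cast hn0.ne')
  have := ENNReal.toReal_mono hne hn.le
  rwa [natCast_div_natCast_toReal, le_div_iff₀ hn0'] at this

lemma exists_lt_one_le_mul_of_limsup_lt {p : ℕ → ℕ}
    (h : limsup (fun n => (p n : ℝ≥0∞) / (n : ℝ≥0∞)) atTop < 1) :
    ∃ u : ℝ, u < 1 ∧ ∀ᶠ n : ℕ in atTop, (p n : ℝ) ≤ u * n := by
  obtain ⟨u, hu, hu1⟩ := exists_between h
  refine ⟨u.toReal, ?_, ?_⟩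
  · simpa using ENNReal.toReal_strict_mono ENNReal.one_ne_top hu1
  filter_upwards [eventually_lt_of_limsup_lt hu, eventually_gt_atTop 0] with n hn hn0
  have hn0' : (0 : ℝ) < n := by exact_mod_cast hn0
  have := ENNReal.toReal_mono hu1.ne_top hn.le
  rwa [natCast_div_natCast_toReal, div_le_iff₀ hn0'] at this

section WithHighProbability

variable {Ω : ℕ → Type*} [∀ n, MeasurableSpace (Ω n)] {P : ∀ n, Measure (Ω n)}
  [∀ n, IsProbabilityMeasure (P n)]
  {p : ℕ → ℕ} {W : ∀ n, Ω n → Matrix (Fin n) (Fin (p n)) ℝ}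
  {Y D U Dt : ∀ n, Ω n → Fin n → ℝ} {β : ℕ → ℝ} {γ δ : ∀ n, Fin (p n) → ℝ} {K η : ℝ}

namespace IsLinearModel

variable (hm : IsLinearModel P p W Y D U Dt β γ δ) (he : ErrorConditions P p W D U Dt K η)

include hm he

lemma exists_residualBounds
    (hliminf : 0 < liminf (fun n => (p n : ℝ≥0∞) / (n : ℝ≥0∞)) atTop)
    (hrank : ∃ c : ℝ, 0 < c ∧
      Tendsto (fun n => P n {ω | ((W n ω).rank : ℝ) < c * p n}) atTop (𝓝 0)) :
    ∃ c C : ℝ, 0 < c ∧ 0 < C ∧ ∀ᶠ x in wpFilter P,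
      ResidualBounds (W x.1 x.2) (D x.1 x.2) (Dt x.1 x.2) c C := by
  obtain ⟨r, hr, hrank⟩ := hrank
  obtain ⟨l, hl, hl'⟩ := exists_pos_mul_le_of_liminf_pos hliminf
  obtain ⟨u, hu, hu'⟩ := exists_lt_one_le_mul_of_limsup_lt he.limsup_lt
  have hK := he.K_pos
  have h4 := hm.fourthMomentArray he
  have hw : ∀ n i j, Measurable fun v : Fin n → Fin (p n) → ℝ => Matrix.of v i j :=
    fun n i j => by simp only [Matrix.of_apply]; fun_prop
  have hu1 : 0 < 1 - u := by linarith
  have hP := h4.eventually_projection_gt (A := fun n v => projMatrix (Matrix.of v))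
    (fun n => measurable_projMatrix (hw n)) (fun n v => projMatrix_symm _)
    (fun n v => projMatrix_mul_self _) (show 0 < r * l / (2 * K) by positivity)
  have hM := h4.eventually_projection_gt (A := fun n v => annihilator (Matrix.of v))
    (fun n => measurable_annihilator (hw n)) (fun n v => annihilator_symm _)
    (fun n v => annihilator_mul_self _) (show 0 < (1 - u) / (2 * K) by positivity)
  have hrank' : ∀ᶠ x in wpFilter P, r * p x.1 ≤ ((W x.1 x.2).rank : ℝ) := by
    refine (eventually_wpFilter_iff (q := fun n ω => r * p n ≤ ((W n ω).rank : ℝ))).2 ?_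
    simpa only [not_le] using hrank
  refine ⟨min (r * l / (2 * K)) ((1 - u) / (2 * K)), 2 + K, lt_min (by positivity) (by positivity),
    by positivity, ?_⟩
  filter_upwards [hP, hM, hrank', h4.eventually_sum_sq_lt, tendsto_fst_wpFilter.eventually hl',
    tendsto_fst_wpFilter.eventually hu', tendsto_fst_wpFilter.eventually (eventually_gt_atTop 0)]
    with x hP hM hrank hX hl' hu' hn
  have hn : (0 : ℝ) < x.1 := by exact_mod_cast hn
  have hD := hm.propensity x.1 x.2
  have hof : Matrix.of (controlArray (W x.1) x.2) = W x.1 x.2 := rfl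
  rw [hof] at hP hM
  rw [trace_projMatrix] at hP
  rw [trace_annihilator] at hM
  refine ⟨hn, sum_olsResidual_mul_of_eq_add hD, ?_, ?_, hX.le⟩
  · simp_rw [olsResidual_eq_of_eq_add hD]
    refine le_trans ?_ hM.le
    have hr' : ((W x.1 x.2).rank : ℝ) ≤ p x.1 := by exact_mod_cast Matrix.rank_le_width _
    calc _ ≤ (1 - u) / (2 * K) * x.1 := by gcongr; exact min_le_right _ _
      _ = (x.1 - u * x.1) / K - (1 - u) / (2 * K) * x.1 := by field_simp; ring
      _ ≤ _ := by gcongr; exact hr'.trans hu'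
  · rw [sum_sq_sub_sum_olsResidual_sq hD]
    refine le_trans ?_ hP.le
    calc _ ≤ r * l / (2 * K) * x.1 := by gcongr; exact min_le_left _ _
      _ = (r * (l * x.1)) / K - r * l / (2 * K) * x.1 := by field_simp; ring
      _ ≤ _ := by
        gcongr
        exact le_trans (by gcongr) hrank

lemma eventually_abs_olsResidual_le {ε : ℝ} (hε : 0 < ε) :
    ∀ᶠ x in wpFilter P, ∀ i, |olsResidual (W x.1 x.2) (D x.1 x.2) i| ≤ ε * Real.sqrt x.1 := by
  have hw : ∀ n i j, Measurable fun v : Fin n → Fin (p n) → ℝ => Matrix.of v i j :=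
    fun n i j => by simp only [Matrix.of_apply]; fun_prop
  have h := (hm.fourthMomentArray he).eventually_forall_abs_lt
    (A := fun n v => annihilator (Matrix.of v)) (fun n => measurable_annihilator (hw n))
    (fun n v i => by
      rw [sum_sq_row_eq_diag (annihilator_symm _) (annihilator_mul_self _)]
      exact diag_le_one_of_idempotent (annihilator_symm _) (annihilator_mul_self _) i) hε
  filter_upwards [h] with x hx i
  rw [olsResidual_eq_of_eq_add (hm.propensity x.1 x.2)]
  exact (hx i).le

lemma eventually_abs_Dt_le {ε : ℝ} (hε : 0 < ε) :
    ∀ᶠ x in wpFilter P, ∀ i, |Dt x.1 x.2 i| ≤ ε * Real.sqrt x.1 := by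
  have h := (hm.fourthMomentArray he).eventually_forall_abs_lt
    (A := fun n _ => (1 : Matrix (Fin n) (Fin n) ℝ)) (fun n i j => measurable_const)
    (fun n v i => by simp [Matrix.one_apply]) hε
  filter_upwards [h] with x hx i
  simpa [Matrix.one_apply] using (hx i).le

end IsLinearModel

/-- The Hausman weights as a function of the treatments and the controls. -/
noncomputable def hausmanWeightFun {n p : ℕ} (d : Fin p → ℝ)
    (v : (Fin n → ℝ) × (Fin n → Fin p → ℝ)) : Fin n → ℝ :=
  hausmanWeight (Matrix.of v.2) v.1 fun i => v.1 i - v.2 i ⬝ᵥ d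

lemma measurable_hausmanWeightFun {n p : ℕ} (d : Fin p → ℝ) (i : Fin n) :
    Measurable fun v : (Fin n → ℝ) × (Fin n → Fin p → ℝ) => hausmanWeightFun d v i := by
  refine measurable_hausmanWeight (W := fun v : (Fin n → ℝ) × (Fin n → Fin p → ℝ) =>
    Matrix.of v.2) (fun i j => ?_) (fun i => by fun_prop) (fun i => ?_) i
  · simp only [Matrix.of_apply]
    fun_prop
  · simp only [dotProduct]
    fun_prop

/-- The conditional standard deviation, given the treatments and the controls, of the Hausman
contrast. -/
noncomputable def hausmanScale (P : ∀ n, Measure (Ω n)) [∀ n, IsProbabilityMeasure (P n)]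
    {p : ℕ → ℕ} (W : ∀ n, Ω n → Matrix (Fin n) (Fin (p n)) ℝ) (D U : ∀ n, Ω n → Fin n → ℝ)
    (δ : ∀ n, Fin (p n) → ℝ) (n : ℕ) (ω : Ω n) : ℝ :=
  condScale (P n) (fun ω => (D n ω, controlArray (W n) ω)) (U n) (hausmanWeightFun (δ n))
    (D n ω, controlArray (W n) ω)

namespace IsLinearModel

omit [∀ n, IsProbabilityMeasure (P n)] in
lemma hausmanWeightFun_eq (hm : IsLinearModel P p W Y D U Dt β γ δ) (n : ℕ) (ω : Ω n) :
    hausmanWeightFun (δ n) (D n ω, controlArray (W n) ω)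
      = hausmanWeight (W n ω) (D n ω) (Dt n ω) := by
  have : (fun i => D n ω i - controlArray (W n) ω i ⬝ᵥ δ n) = Dt n ω := by
    funext i
    rw [hm.propensity]
    exact add_sub_cancel_left _ _
  simp only [hausmanWeightFun, this]
  rfl

variable (hm : IsLinearModel P p W Y D U Dt β γ δ) (he : ErrorConditions P p W D U Dt K η)

include hm he

lemma ae_hausmanScale_sq_bounds (n : ℕ) : ∀ᵐ ω ∂(P n),
    (∑ i, hausmanWeight (W n ω) (D n ω) (Dt n ω) i ^ 2) / (1 + K)
        ≤ hausmanScale P W D U δ n ω ^ 2 ∧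
      hausmanScale P W D U δ n ω ^ 2
        ≤ (2 + K) * ∑ i, hausmanWeight (W n ω) (D n ω) (Dt n ω) i ^ 2 := by
  filter_upwards [hm.condMomentBounds_U he n] with ω hω
  rw [hausmanScale, condScale_sq, hm.hausmanWeightFun_eq, Finset.sum_div, Finset.mul_sum]
  refine ⟨Finset.sum_le_sum fun i _ => ?_, Finset.sum_le_sum fun i _ => ?_⟩
  · rw [div_eq_mul_one_div]
    exact mul_le_mul_of_nonneg_left (hω i).lower (sq_nonneg _)
  · rw [mul_comm]
    refine mul_le_mul_of_nonneg_right ?_ (sq_nonneg _)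
    have := (hω i).integral_sq_le (lt_min he.eta_pos one_pos)
    linarith

lemma exists_hausmanScale_bounds {c C : ℝ} (hc : 0 < c) (hC : 0 < C)
    (hb : ∀ᶠ x in wpFilter P, ResidualBounds (W x.1 x.2) (D x.1 x.2) (Dt x.1 x.2) c C) :
    ∃ a b : ℝ, 0 < a ∧ 0 < b ∧ ∀ᶠ x in wpFilter P, a ≤ x.1 * hausmanScale P W D U δ x.1 x.2 ^ 2 ∧
      x.1 * hausmanScale P W D U δ x.1 x.2 ^ 2 ≤ b := by
  have hK := he.K_pos
  refine ⟨c / C ^ 2 / (1 + K), (2 + K) * (1 / c), by positivity, by positivity, ?_⟩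
  filter_upwards [hb, eventually_wpFilter_of_ae (hm.ae_hausmanScale_sq_bounds he)]
    with x hx h
  have hn := hx.pos
  constructor
  · calc c / C ^ 2 / (1 + K)
        ≤ (x.1 * ∑ i, hausmanWeight (W x.1 x.2) (D x.1 x.2) (Dt x.1 x.2) i ^ 2) / (1 + K) := by
          gcongr
          exact hx.le_weights hc hC
      _ ≤ _ := by
          rw [mul_div_assoc]
          gcongr
          exact h.1
  · calc _ ≤ x.1 * ((2 + K) * ∑ i, hausmanWeight (W x.1 x.2) (D x.1 x.2) (Dt x.1 x.2) i ^ 2) := by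
          gcongr
          exact h.2
      _ = (2 + K) * (x.1 * ∑ i, hausmanWeight (W x.1 x.2) (D x.1 x.2) (Dt x.1 x.2) i ^ 2) := by
          ring
      _ ≤ _ := by
          gcongr
          exact hx.weights_le hc

lemma weightedArray {c C : ℝ} (hc : 0 < c) (hC : 0 < C)
    (hb : ∀ᶠ x in wpFilter P, ResidualBounds (W x.1 x.2) (D x.1 x.2) (Dt x.1 x.2) c C) :
    WeightedArray P (fun n ω => (D n ω, controlArray (W n) ω)) U
      (fun n => hausmanWeightFun (δ n)) (min η 1) (1 + K) where
  measurable_V := hm.measurable_prodMk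
  measurable_X := hm.measurable_U
  measurable_Z n i := measurable_hausmanWeightFun (δ n) i
  condIndep := hm.condIndep_U he
  moments := hm.condMomentBounds_U he
  kappa_pos := lt_min he.eta_pos one_pos
  kappa_le := min_le_right _ _
  K_pos := by linarith [he.K_pos]
  negligible ε hε := by
    obtain ⟨a, b, ha, -, hab⟩ := hm.exists_hausmanScale_bounds he hc hC hb
    set ε' : ℝ := ε * Real.sqrt a * c / 2 with hε'
    have hε'0 : 0 < ε' := by positivity
    filter_upwards [hb, hab, hm.eventually_abs_olsResidual_le he hε'0,
      hm.eventually_abs_Dt_le he hε'0] with x hx h h1 h2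
    have hn := hx.pos
    have hs0 : 0 ≤ hausmanScale P W D U δ x.1 x.2 := Real.sqrt_nonneg _
    have hs : Real.sqrt a ≤ Real.sqrt x.1 * hausmanScale P W D U δ x.1 x.2 := by
      rw [← Real.sqrt_sq hs0, ← Real.sqrt_mul hn.le]
      exact Real.sqrt_le_sqrt h.1
    refine ⟨lt_of_le_of_ne hs0 fun h0 => ?_, fun i => ?_⟩
    · have h0 : hausmanScale P W D U δ x.1 x.2 = 0 := h0.symm
      rw [h0, mul_zero] at hs
      exact absurd hs (not_le.2 (Real.sqrt_pos.2 ha))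
    · rw [hm.hausmanWeightFun_eq]
      have := hx.sqrt_mul_abs_weight_le hc hε'0 (h1 i) (h2 i)
      rw [show 2 * ε' / c = ε * Real.sqrt a by rw [hε']; field_simp] at this
      have h3 : ε * Real.sqrt a ≤ ε * (Real.sqrt x.1 * hausmanScale P W D U δ x.1 x.2) := by gcongr
      have hsn := Real.sqrt_pos.2 hn
      refine le_of_mul_le_mul_left ?_ hsn
      change _ ≤ Real.sqrt x.1 * (ε * hausmanScale P W D U δ x.1 x.2)
      linarith

end IsLinearModel

end WithHighProbability

section HausmanContrast

variable {Ω : ℕ → Type*} [∀ n, MeasurableSpace (Ω n)] {P : ∀ n, Measure (Ω n)}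
  [∀ n, IsProbabilityMeasure (P n)]
  {p : ℕ → ℕ} {W : ∀ n, Ω n → Matrix (Fin n) (Fin (p n)) ℝ}
  {Y D U Dt : ∀ n, Ω n → Fin n → ℝ} {β : ℕ → ℝ} {γ δ : ∀ n, Fin (p n) → ℝ} {K η : ℝ}
  {βstar : ∀ n, Ω n → ℝ} {c C : ℝ}

namespace IsLinearModel

variable (hm : IsLinearModel P p W Y D U Dt β γ δ) (he : ErrorConditions P p W D U Dt K η)

include hm he

lemma eventually_hausmanScale_pos (hc : 0 < c) (hC : 0 < C)
    (hb : ∀ᶠ x in wpFilter P, ResidualBounds (W x.1 x.2) (D x.1 x.2) (Dt x.1 x.2) c C) :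
    ∀ᶠ x in wpFilter P, 0 < hausmanScale P W D U δ x.1 x.2 :=
  ((hm.weightedArray he hc hC hb).negligible 1 one_pos).mono fun _ h => h.1

/-- The Hausman contrast is asymptotically normal when divided by a scale that is consistent for
its conditional standard deviation. -/
lemma tendstoInDistribution_contrast_div (hc : 0 < c) (hC : 0 < C)
    (hb : ∀ᶠ x in wpFilter P, ResidualBounds (W x.1 x.2) (D x.1 x.2) (Dt x.1 x.2) c C)
    (hstar : IsEfficientEstimator P U Dt β βstar) {s : ∀ n, Ω n → ℝ} (hs : ∀ n, Measurable (s n))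
    (hratio : Tendsto (fun x : Σ n, Ω n => s x.1 x.2 / hausmanScale P W D U δ x.1 x.2)
      (wpFilter P) (𝓝 1)) :
    TendstoInDistribution
      (fun n ω => (betaOLS (W n ω) (D n ω) (Y n ω) - βstar n ω) / s n ω)
      atTop (id : ℝ → ℝ) P (gaussianReal 0 1) := by
  have hWA := hm.weightedArray he hc hC hb
  have hUm : ∀ n, Measurable (U n) := fun n => measurable_pi_lambda _ (hm.measurable_U n)
  set T : ∀ n, Ω n → ℝ := fun n ω => standardizedSum (P n)
    (fun ω => (D n ω, controlArray (W n) ω)) (U n) (hausmanWeightFun (δ n))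
    ((D n ω, controlArray (W n) ω), U n ω) with hT
  refine tendstoInDistribution_gaussian_of_sub (T := T)
    (fun n => (measurable_standardizedSum (measurable_hausmanWeightFun (δ n))).comp
      ((hm.measurable_prodMk n).prodMk (hUm n)))
    (fun n => ((measurable_betaOLS (hm.measurable_W n) (hm.measurable_D n)
      (hm.measurable_Y n)).sub (hstar.1 n)).div (hs n))
    (fun t => hWA.tendsto_integral_exp t) ?_
  have hinv : Tendsto (fun x : Σ n, Ω n => hausmanScale P W D U δ x.1 x.2 / s x.1 x.2)
      (wpFilter P) (𝓝 1) := by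
    have := hratio.inv₀ one_ne_zero
    simpa using this
  have h1 : Tendsto (fun x : Σ n, Ω n =>
      T x.1 x.2 * (hausmanScale P W D U δ x.1 x.2 / s x.1 x.2 - 1)) (wpFilter P) (𝓝 0) :=
    hWA.isBigOpOne.tendsto_mul
      (Y := fun n ω => hausmanScale P W D U δ n ω / s n ω - 1) (by simpa using hinv.sub_const 1)
  set e : ∀ n, Ω n → ℝ := fun n ω =>
    βstar n ω - β n - (∑ i, Dt n ω i * U n ω i) / ∑ i, Dt n ω i ^ 2 with hedef
  have hes : Tendsto (fun x : Σ n, Ω n => Real.sqrt x.1 * e x.1 x.2) (wpFilter P) (𝓝 0) :=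
    (isLittleOpOne_iff (X := fun n ω => Real.sqrt n * e n ω)).1 hstar.2
  obtain ⟨a, b, ha, -, hab⟩ := hm.exists_hausmanScale_bounds he hc hC hb
  have hpos := hm.eventually_hausmanScale_pos he hc hC hb
  have h2 : Tendsto (fun x : Σ n, Ω n => e x.1 x.2 / hausmanScale P W D U δ x.1 x.2)
      (wpFilter P) (𝓝 0) := by
    have hz : Tendsto (fun x : Σ n, Ω n => |Real.sqrt x.1 * e x.1 x.2| / Real.sqrt a)
        (wpFilter P) (𝓝 0) := by
      simpa using hes.abs.div_const (Real.sqrt a)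
    refine squeeze_zero_norm' ?_ hz
    filter_upwards [hab, hpos, hb] with x hx hσ hx'
    have hn := hx'.pos
    have hle : Real.sqrt a ≤ Real.sqrt x.1 * hausmanScale P W D U δ x.1 x.2 := by
      rw [← Real.sqrt_sq hσ.le, ← Real.sqrt_mul hn.le]
      exact Real.sqrt_le_sqrt hx.1
    have hsa := Real.sqrt_pos.2 ha
    have hsn := Real.sqrt_pos.2 hn
    rw [Real.norm_eq_abs, abs_div, abs_of_pos hσ, abs_mul, abs_of_pos hsn,
      div_le_div_iff₀ hσ hsa]
    calc |e x.1 x.2| * Real.sqrt a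
        ≤ |e x.1 x.2| * (Real.sqrt x.1 * hausmanScale P W D U δ x.1 x.2) := by gcongr
      _ = _ := by ring
  have h3 := h1.sub (h2.mul hinv)
  rw [zero_mul, sub_zero] at h3
  refine h3.congr' ?_
  filter_upwards [hpos, hb, hratio.eventually_ne one_ne_zero] with x hσ hx hne
  have hs0 : s x.1 x.2 ≠ 0 := fun h => hne (by rw [h, zero_div])
  have hTx : T x.1 x.2 = (∑ i, hausmanWeight (W x.1 x.2) (D x.1 x.2) (Dt x.1 x.2) i
      * U x.1 x.2 i) / hausmanScale P W D U δ x.1 x.2 := by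
    simp only [hT, standardizedSum, hm.hausmanWeightFun_eq, Finset.sum_div]
    exact Finset.sum_congr rfl fun i _ => div_mul_eq_mul_div _ _ _
  have hN : betaOLS (W x.1 x.2) (D x.1 x.2) (Y x.1 x.2) - βstar x.1 x.2
      = ∑ i, hausmanWeight (W x.1 x.2) (D x.1 x.2) (Dt x.1 x.2) i * U x.1 x.2 i - e x.1 x.2 := by
    rw [betaOLS_eq (hm.propensity x.1 x.2) (hm.outcome x.1 x.2) (hx.residual_pos hc),
      sum_hausmanWeight_mul]
    simp only [hedef]
    ring
  rw [hN, hTx]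
  field_simp
  ring

lemma tendsto_sum_sq_div_hausmanScale (hc : 0 < c) (hC : 0 < C)
    (hb : ∀ᶠ x in wpFilter P, ResidualBounds (W x.1 x.2) (D x.1 x.2) (Dt x.1 x.2) c C) :
    Tendsto (fun x : Σ n, Ω n => (∑ i, hausmanWeight (W x.1 x.2) (D x.1 x.2) (Dt x.1 x.2) i ^ 2
      * U x.1 x.2 i ^ 2) / hausmanScale P W D U δ x.1 x.2 ^ 2) (wpFilter P) (𝓝 1) := by
  have := (hm.weightedArray he hc hC hb).tendsto_sum_sq_div
  simp only [hm.hausmanWeightFun_eq] at this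
  exact this

lemma tendsto_sqrt_div_hausmanScale (hc : 0 < c) (hC : 0 < C)
    (hb : ∀ᶠ x in wpFilter P, ResidualBounds (W x.1 x.2) (D x.1 x.2) (Dt x.1 x.2) c C)
    {v : ∀ n, Ω n → ℝ}
    (hv : Tendsto (fun x : Σ n, Ω n => x.1 * (∑ i,
      hausmanWeight (W x.1 x.2) (D x.1 x.2) (Dt x.1 x.2) i ^ 2 * U x.1 x.2 i ^ 2 - v x.1 x.2))
      (wpFilter P) (𝓝 0)) :
    Tendsto (fun x : Σ n, Ω n => Real.sqrt (v x.1 x.2) / hausmanScale P W D U δ x.1 x.2)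
      (wpFilter P) (𝓝 1) := by
  obtain ⟨a, b, ha, -, hab⟩ := hm.exists_hausmanScale_bounds he hc hC hb
  have hpos := hm.eventually_hausmanScale_pos he hc hC hb
  have h2 : Tendsto (fun x : Σ n, Ω n => (x.1 * (∑ i,
      hausmanWeight (W x.1 x.2) (D x.1 x.2) (Dt x.1 x.2) i ^ 2 * U x.1 x.2 i ^ 2 - v x.1 x.2))
      / (x.1 * hausmanScale P W D U δ x.1 x.2 ^ 2)) (wpFilter P) (𝓝 0) := by
    have hz := hv.abs.div_const a
    rw [abs_zero, zero_div] at hz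
    refine squeeze_zero_norm' ?_ hz
    filter_upwards [hab] with x hx
    have h0 := ha.trans_le hx.1
    rw [Real.norm_eq_abs, abs_div, abs_of_pos h0]
    gcongr
    exact hx.1
  have h3 := ((hm.tendsto_sum_sq_div_hausmanScale he hc hC hb).sub h2).sqrt
  rw [sub_zero, Real.sqrt_one] at h3
  refine h3.congr' ?_
  filter_upwards [hpos, hb] with x hσ hx
  have hn := hx.pos
  rw [mul_div_mul_left _ _ hn.ne', ← sub_div, sub_sub_cancel, Real.sqrt_div' _ (sq_nonneg _),
    Real.sqrt_sq hσ.le]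

end IsLinearModel

end HausmanContrast

section VariancePerturbation

variable {n p : ℕ}

lemma half_sum_sq_sub_le (a b : Fin n → ℝ) :
    (∑ i, a i ^ 2) / 2 - ∑ i, (b i - a i) ^ 2 ≤ ∑ i, b i ^ 2 := by
  rw [Finset.sum_div, ← Finset.sum_sub_distrib]
  exact Finset.sum_le_sum fun i _ => by nlinarith [sq_nonneg (a i - 2 * (a i - b i))]

lemma sum_sq_le_natCast_mul {a : Fin n → ℝ} {e : ℝ} (h : ∀ i, |a i| ≤ e) :
    ∑ i, a i ^ 2 ≤ n * e ^ 2 := by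
  calc ∑ i, a i ^ 2 ≤ ∑ _i : Fin n, e ^ 2 := Finset.sum_le_sum fun i _ => by
        rw [← sq_abs]
        exact pow_le_pow_left₀ (abs_nonneg _) (h i) 2
    _ = n * e ^ 2 := by simp

lemma abs_sum_sq_sub_sum_sq_le {a b : Fin n → ℝ} {e : ℝ} (he1 : e ≤ 1)
    (h : ∀ i, |b i - a i| ≤ e) :
    |∑ i, b i ^ 2 - ∑ i, a i ^ 2| ≤ e * (2 * n + ∑ i, a i ^ 2) := by
  rw [← Finset.sum_sub_distrib]
  calc |∑ i, (b i ^ 2 - a i ^ 2)| ≤ ∑ i, |b i ^ 2 - a i ^ 2| := Finset.abs_sum_le_sum_abs _ _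
    _ ≤ ∑ i, e * (2 + a i ^ 2) := Finset.sum_le_sum fun i _ => by
        have he0 := (abs_nonneg _).trans (h i)
        rw [show b i ^ 2 - a i ^ 2 = (b i - a i) * ((b i - a i) + 2 * a i) by ring, abs_mul]
        refine mul_le_mul (h i) ?_ (abs_nonneg _) he0
        refine (abs_add_le _ _).trans ?_
        rw [abs_mul, abs_two]
        nlinarith [h i, sq_nonneg (|a i| - 1), sq_abs (a i)]
    _ = _ := by
        rw [← Finset.mul_sum, Finset.sum_add_distrib]
        simp [mul_comm]

lemma natCast_mul_abs_hausmanWeight_sub_le {W : Matrix (Fin n) (Fin p) ℝ} {D A Ahat : Fin n → ℝ}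
    {c C e : ℝ} (hn : (0 : ℝ) < n) (hc : 0 < c) (hC : 0 ≤ C) (he1 : e ≤ 1)
    (hA : ∀ i, |Ahat i - A i| ≤ e) (h2 : c * n ≤ ∑ i, A i ^ 2) (h3 : c * n ≤ ∑ i, Ahat i ^ 2)
    (h4 : ∑ i, A i ^ 2 ≤ C * n) (i : Fin n) :
    n * |hausmanWeight W D Ahat i - hausmanWeight W D A i|
      ≤ e * (((2 + C) / c ^ 2 + 1 / c) * (1 + |A i|)) := by
  have he0 : 0 ≤ e := (abs_nonneg _).trans (hA i)
  have hcn := mul_pos hc hn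
  have hS := abs_sum_sq_sub_sum_sq_le he1 hA
  set s := ∑ i, A i ^ 2 with hs
  set t := ∑ i, Ahat i ^ 2 with ht
  have hs0 : 0 < s := hcn.trans_le h2
  have ht0 : 0 < t := hcn.trans_le h3
  have hst : |t - s| ≤ e * ((2 + C) * n) := hS.trans (by gcongr; linarith)
  have e1 : hausmanWeight W D Ahat i - hausmanWeight W D A i
      = A i * ((t - s) / (s * t)) - (Ahat i - A i) / t := by
    simp only [hausmanWeight]
    rw [← hs, ← ht]
    field_simp
    ring
  have b1 : |(t - s) / (s * t)| ≤ e * ((2 + C) * n) / ((c * n) * (c * n)) := by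
    rw [abs_div, abs_of_pos (mul_pos hs0 ht0)]
    gcongr
  have b2 : |(Ahat i - A i) / t| ≤ e / (c * n) := by
    rw [abs_div, abs_of_pos ht0]
    gcongr
    exact hA i
  rw [e1]
  calc n * |A i * ((t - s) / (s * t)) - (Ahat i - A i) / t|
      ≤ n * (|A i| * (e * ((2 + C) * n) / ((c * n) * (c * n))) + e / (c * n)) := by
        gcongr
        refine (abs_sub _ _).trans (add_le_add ?_ b2)
        rw [abs_mul]
        gcongr
    _ = e * ((2 + C) / c ^ 2 * |A i| + 1 / c) := by field_simp
    _ ≤ _ := by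
        gcongr
        have : 0 ≤ (2 + C) / c ^ 2 := by positivity
        have : 0 ≤ 1 / c * |A i| := by positivity
        nlinarith

lemma natCast_mul_sum_hausmanWeight_sq_le {W : Matrix (Fin n) (Fin p) ℝ} {D A : Fin n → ℝ}
    {c : ℝ} (hn : (0 : ℝ) < n) (hc : 0 < c) (h1 : c * n ≤ ∑ i, olsResidual W D i ^ 2)
    (h2 : c * n ≤ ∑ i, A i ^ 2) : n * ∑ i, hausmanWeight W D A i ^ 2 ≤ 4 / c := by
  have hcn := mul_pos hc hn
  set s := ∑ i, A i ^ 2 with hs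
  set r := ∑ i, olsResidual W D i ^ 2 with hr
  have hs0 : 0 < s := hcn.trans_le h2
  have hr0 : 0 < r := hcn.trans_le h1
  have hle : ∑ i, hausmanWeight W D A i ^ 2 ≤ 2 * (1 / r) + 2 * (1 / s) := by
    calc ∑ i, hausmanWeight W D A i ^ 2
        ≤ ∑ i, (2 * (olsResidual W D i ^ 2 / r ^ 2) + 2 * (A i ^ 2 / s ^ 2)) :=
          Finset.sum_le_sum fun i _ => by
            rw [← div_pow, ← div_pow]
            simp only [hausmanWeight]
            nlinarith [sq_nonneg (olsResidual W D i / r + A i / s)]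
      _ = 2 * (1 / r) + 2 * (1 / s) := by
          rw [Finset.sum_add_distrib, ← Finset.mul_sum, ← Finset.mul_sum, ← Finset.sum_div,
            ← Finset.sum_div, ← hs, ← hr]
          congr 2 <;> field_simp
  calc n * ∑ i, hausmanWeight W D A i ^ 2 ≤ n * (2 * (1 / (c * n)) + 2 * (1 / (c * n))) := by
        gcongr
        exact hle.trans (by gcongr)
    _ = 4 / c := by field_simp; ring

lemma abs_sq_mul_sq_sub_le {zhat z b bhat a e L : ℝ} (hL : 0 ≤ L) (he1 : e ≤ 1)
    (hz : |zhat - z| ≤ e * (L * (1 + |a|))) (hb : |bhat - b| ≤ e) :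
    |zhat ^ 2 * bhat ^ 2 - z ^ 2 * b ^ 2|
      ≤ e * (16 * L ^ 2 * (1 + a ^ 2 + (b ^ 2 + a ^ 2 * b ^ 2)) + 4 * z ^ 2 + z ^ 2 * b ^ 2) := by
  have he0 : 0 ≤ e := (abs_nonneg _).trans hb
  set w := L * (1 + |a|) * (1 + |b|) + |z| with hw
  have hw0 : 0 ≤ w := by positivity
  have hbhat : |bhat| ≤ 1 + |b| := by
    have := abs_add_le (bhat - b) b
    rw [sub_add_cancel] at this
    linarith
  have hd : |zhat * bhat - z * b| ≤ e * w := by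
    rw [show zhat * bhat - z * b = (zhat - z) * bhat + z * (bhat - b) by ring]
    refine (abs_add_le _ _).trans ?_
    rw [abs_mul, abs_mul]
    calc _ ≤ e * (L * (1 + |a|)) * (1 + |b|) + |z| * e := by gcongr
      _ = e * w := by rw [hw]; ring
  have hw2 : w ^ 2 ≤ 8 * L ^ 2 * (1 + a ^ 2 + (b ^ 2 + a ^ 2 * b ^ 2)) + 2 * z ^ 2 := by
    have k : ∀ x : ℝ, (1 + |x|) ^ 2 ≤ 2 * (1 + x ^ 2) := fun x => by
      nlinarith [sq_nonneg (|x| - 1), sq_abs x]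
    calc w ^ 2 ≤ 2 * (L * (1 + |a|) * (1 + |b|)) ^ 2 + 2 * |z| ^ 2 := by
          rw [hw]
          nlinarith [sq_nonneg (L * (1 + |a|) * (1 + |b|) - |z|)]
      _ = 2 * L ^ 2 * ((1 + |a|) ^ 2 * (1 + |b|) ^ 2) + 2 * z ^ 2 := by rw [sq_abs]; ring
      _ ≤ 2 * L ^ 2 * ((2 * (1 + a ^ 2)) * (2 * (1 + b ^ 2))) + 2 * z ^ 2 := by
          gcongr
          · exact k a
          · exact k b
      _ = _ := by ring
  have e1 : zhat ^ 2 * bhat ^ 2 - z ^ 2 * b ^ 2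
      = (zhat * bhat - z * b) * ((zhat * bhat - z * b) + 2 * (z * b)) := by ring
  rw [e1, abs_mul]
  calc _ ≤ (e * w) * (e * w + 2 * |z * b|) := by
        gcongr
        refine (abs_add_le _ _).trans ?_
        rw [abs_mul 2, abs_two]
        gcongr
    _ ≤ e * (w * (1 * w + 2 * |z * b|)) := by
        rw [mul_assoc]
        gcongr
    _ ≤ e * (2 * w ^ 2 + z ^ 2 * b ^ 2) := by
        gcongr
        nlinarith [sq_nonneg (w - |z * b|), sq_abs (z * b)]
    _ ≤ _ := by
        gcongr
        linarith

/-- Uniform perturbations of the two vectors of residuals have a small effect on the estimated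
variance of the Hausman contrast. -/
lemma abs_sum_hausmanWeight_sq_mul_sq_sub_le {W : Matrix (Fin n) (Fin p) ℝ}
    {D A Ahat B Bhat : Fin n → ℝ}
    {c C e : ℝ} (hn : (0 : ℝ) < n) (hc : 0 < c) (hC : 0 ≤ C) (he1 : e ≤ 1)
    (hA : ∀ i, |Ahat i - A i| ≤ e) (hB : ∀ i, |Bhat i - B i| ≤ e)
    (h1 : c * n ≤ ∑ i, olsResidual W D i ^ 2) (h2 : c * n ≤ ∑ i, A i ^ 2)
    (h3 : c * n ≤ ∑ i, Ahat i ^ 2) (h4 : ∑ i, A i ^ 2 ≤ C * n) :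
    |n * (∑ i, hausmanWeight W D Ahat i ^ 2 * Bhat i ^ 2
        - ∑ i, hausmanWeight W D A i ^ 2 * B i ^ 2)|
      ≤ e * (16 * ((2 + C) / c ^ 2 + 1 / c) ^ 2
        * (1 + C + (∑ i, (B i ^ 2 + A i ^ 2 * B i ^ 2)) / n) + 16 / c
        + n * ∑ i, hausmanWeight W D A i ^ 2 * B i ^ 2) := by
  set L := (2 + C) / c ^ 2 + 1 / c with hL
  have hL0 : 0 ≤ L := by positivity
  have he0 : 0 ≤ e := by
    have : Nonempty (Fin n) := ⟨⟨0, by exact_mod_cast hn⟩⟩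
    exact (abs_nonneg _).trans (hA (Classical.arbitrary _))
  have hw := natCast_mul_sum_hausmanWeight_sq_le (W := W) (D := D) hn hc h1 h2
  have hi : ∀ i, n * |hausmanWeight W D Ahat i ^ 2 * Bhat i ^ 2
      - hausmanWeight W D A i ^ 2 * B i ^ 2| ≤ e * (16 * L ^ 2
        * ((1 + A i ^ 2 + (B i ^ 2 + A i ^ 2 * B i ^ 2)) / n) + 4 * (n * hausmanWeight W D A i ^ 2)
        + n * (hausmanWeight W D A i ^ 2 * B i ^ 2)) := fun i => by
    have hz := natCast_mul_abs_hausmanWeight_sub_le (W := W) (D := D) hn hc hC he1 hA h2 h3 h4 i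
    rw [← abs_of_pos hn, ← abs_mul, mul_sub] at hz
    have := abs_sq_mul_sq_sub_le hL0 he1 hz (hB i)
    rw [show ((n : ℝ) * hausmanWeight W D Ahat i) ^ 2 * Bhat i ^ 2
      - (n * hausmanWeight W D A i) ^ 2 * B i ^ 2
      = n * (n * (hausmanWeight W D Ahat i ^ 2 * Bhat i ^ 2
        - hausmanWeight W D A i ^ 2 * B i ^ 2)) by ring, abs_mul, abs_mul, abs_of_pos hn] at this
    refine le_of_mul_le_mul_left (this.trans (le_of_eq ?_)) hn
    field_simp
  rw [← Finset.sum_sub_distrib, abs_mul, abs_of_pos hn]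
  calc _ ≤ n * ∑ i, |hausmanWeight W D Ahat i ^ 2 * Bhat i ^ 2
        - hausmanWeight W D A i ^ 2 * B i ^ 2| := by
        gcongr
        exact Finset.abs_sum_le_sum_abs _ _
    _ ≤ ∑ i, e * (16 * L ^ 2
        * ((1 + A i ^ 2 + (B i ^ 2 + A i ^ 2 * B i ^ 2)) / n) + 4 * (n * hausmanWeight W D A i ^ 2)
        + n * (hausmanWeight W D A i ^ 2 * B i ^ 2)) := by
        rw [Finset.mul_sum]
        exact Finset.sum_le_sum fun i _ => hi i
    _ = e * (16 * L ^ 2 * (1 + (∑ i, A i ^ 2) / n + (∑ i, (B i ^ 2 + A i ^ 2 * B i ^ 2)) / n)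
        + 4 * (n * ∑ i, hausmanWeight W D A i ^ 2)
        + n * ∑ i, hausmanWeight W D A i ^ 2 * B i ^ 2) := by
        rw [← Finset.mul_sum, Finset.sum_add_distrib, Finset.sum_add_distrib, ← Finset.mul_sum,
          ← Finset.mul_sum, ← Finset.mul_sum, ← Finset.mul_sum, ← Finset.sum_div,
          Finset.sum_add_distrib, Finset.sum_add_distrib]
        simp only [Finset.sum_const, Finset.card_univ, Fintype.card_fin, nsmul_eq_mul, mul_one]
        rw [add_div, add_div, div_self hn.ne']
    _ ≤ _ := by
        have h5 : (∑ i, A i ^ 2) / n ≤ C := (div_le_iff₀ hn).2 h4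
        have h6 : 4 * (n * ∑ i, hausmanWeight W D A i ^ 2) ≤ 16 / c := by
          calc _ ≤ 4 * (4 / c) := by gcongr
            _ = 16 / c := by ring
        gcongr

end VariancePerturbation

section ConditionalSecondMoments

lemma lintegral_mul_sq_le_of_condDistrib {Ω S : Type*} [MeasurableSpace Ω] [MeasurableSpace S]
    {P : Measure Ω} [IsProbabilityMeasure P] {κ K : ℝ} {V : Ω → S} (hV : Measurable V)
    {X : Ω → ℝ} (hX : Measurable X) (hκ : 0 < κ)
    (h : ∀ᵐ ω ∂P, MomentBounds κ K (condDistrib X V P (V ω))) {f : S → ℝ≥0∞}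
    (hf : Measurable f) :
    ∫⁻ ω, f (V ω) * ENNReal.ofReal (X ω ^ 2) ∂P
      ≤ ENNReal.ofReal (1 + K) * ∫⁻ ω, f (V ω) ∂P := by
  have hF : Measurable fun z : S × ℝ => f z.1 * ENNReal.ofReal (z.2 ^ 2) := by fun_prop
  have hF1 : ∀ v : S, Measurable fun x : ℝ => ENNReal.ofReal (x ^ 2) := fun v => by fun_prop
  have hG : Measurable fun v => ∫⁻ x, f v * ENNReal.ofReal (x ^ 2) ∂(condDistrib X V P v) :=
    Measurable.lintegral_kernel_prod_right' hF
  calc ∫⁻ ω, f (V ω) * ENNReal.ofReal (X ω ^ 2) ∂P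
      = ∫⁻ z, f z.1 * ENNReal.ofReal (z.2 ^ 2) ∂(P.map fun ω => (V ω, X ω)) :=
        (lintegral_map hF (hV.prodMk hX)).symm
    _ = ∫⁻ ω, ∫⁻ x, f (V ω) * ENNReal.ofReal (x ^ 2) ∂(condDistrib X V P (V ω)) ∂P := by
        rw [← compProd_map_condDistrib hX.aemeasurable, Measure.lintegral_compProd hF,
          lintegral_map hG hV]
    _ ≤ ∫⁻ ω, ENNReal.ofReal (1 + K) * f (V ω) ∂P := by
        refine lintegral_mono_ae ?_
        filter_upwards [h] with ω hω
        rw [lintegral_const_mul _ (hF1 (V ω)), mul_comm, ← ofReal_integral_eq_lintegral_ofReal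
          (hω.memLp hκ).integrable_sq (ae_of_all _ fun x => sq_nonneg x)]
        gcongr
        exact hω.integral_sq_le hκ
    _ = _ := lintegral_const_mul _ (hf.comp hV)

lemma lintegral_ofReal_abs_mean {Ω : Type*} [MeasurableSpace Ω] {P : Measure Ω} {n : ℕ}
    {f : Fin n → Ω → ℝ} (hf : ∀ i, Measurable (f i)) (h0 : ∀ i ω, 0 ≤ f i ω) :
    ∫⁻ ω, ENNReal.ofReal |(∑ i, f i ω) / n| ∂P
      = (∑ i, ∫⁻ ω, ENNReal.ofReal (f i ω) ∂P) / (n : ℝ≥0∞) := by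
  rcases Nat.eq_zero_or_pos n with rfl | hn
  · simp
  have hn' : (0 : ℝ) < n := by exact_mod_cast hn
  rw [← lintegral_finsetSum _ fun i _ => (hf i).ennreal_ofReal, div_eq_mul_inv, mul_comm,
    ← lintegral_const_mul _ (Finset.measurable_sum _ fun i _ => (hf i).ennreal_ofReal)]
  refine lintegral_congr fun ω => ?_
  rw [abs_of_nonneg (div_nonneg (Finset.sum_nonneg fun i _ => h0 i ω) hn'.le),
    ENNReal.ofReal_div_of_pos hn', ENNReal.ofReal_natCast,
    ENNReal.ofReal_sum_of_nonneg fun i _ => h0 i ω, div_eq_mul_inv, mul_comm]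

end ConditionalSecondMoments

section Remainders

variable {Ω : ℕ → Type*} [∀ n, MeasurableSpace (Ω n)] {P : ∀ n, Measure (Ω n)}
  {p : ℕ → ℕ} {W : ∀ n, Ω n → Matrix (Fin n) (Fin (p n)) ℝ}
  {Y D U Dt : ∀ n, Ω n → Fin n → ℝ} {β : ℕ → ℝ} {γ δ : ∀ n, Fin (p n) → ℝ} {K η : ℝ}
  {f g rγ rδ : ∀ n, (Fin (p n) → ℝ) → ℝ}

namespace IsLinearModel

variable (hm : IsLinearModel P p W Y D U Dt β γ δ)

include hm

lemma measurable_comp_row {n : ℕ} {r : (Fin (p n) → ℝ) → ℝ} (hr : Measurable r) (i : Fin n) :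
    Measurable fun ω => r (W n ω i) :=
  hr.comp (measurable_pi_lambda _ fun j => hm.measurable_W n i j)

lemma tendsto_mean_remainder_sq (hR : RemainderConditions P p W D U Dt γ δ f g rγ rδ) :
    Tendsto (fun x : Σ n, Ω n => (∑ i, rδ x.1 (W x.1 x.2 i) ^ 2) / x.1)
      (wpFilter P) (𝓝 0) := by
  have hmeas : ∀ n i, Measurable fun ω => rδ n (W n ω i) ^ 2 := fun n i =>
    (hm.measurable_comp_row (hR.measurable_rδ n) i).pow_const 2
  refine tendsto_wpFilter_zero_of_lintegral
    (X := fun n ω => (∑ i, rδ n (W n ω i) ^ 2) / n)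
    (fun n => ((Finset.measurable_sum _ fun i _ => hmeas n i).div_const _).aemeasurable) ?_
  refine tendsto_of_tendsto_of_tendsto_of_le_of_le tendsto_const_nhds hR.mean_square
    (fun _ => zero_le) fun n => ?_
  rw [lintegral_ofReal_abs_mean (fun i => hmeas n i) fun i ω => sq_nonneg _]
  refine ENNReal.div_le_div_right (Finset.sum_le_sum fun i _ => lintegral_mono fun ω =>
    ENNReal.ofReal_le_ofReal ?_) _
  exact le_add_of_nonneg_right (sq_nonneg _)

variable [∀ n, IsProbabilityMeasure (P n)] (he : ErrorConditions P p W D U Dt K η)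

include he

lemma lintegral_mul_U_sq_le (n : ℕ) (i : Fin n)
    {φ : (Fin n → ℝ) × (Fin n → Fin (p n) → ℝ) → ℝ≥0∞} (hφ : Measurable φ) :
    ∫⁻ ω, φ (D n ω, controlArray (W n) ω) * ENNReal.ofReal (U n ω i ^ 2) ∂(P n)
      ≤ ENNReal.ofReal (2 + K) * ∫⁻ ω, φ (D n ω, controlArray (W n) ω) ∂(P n) := by
  have := lintegral_mul_sq_le_of_condDistrib (hm.measurable_prodMk n) (hm.measurable_U n i)
    (lt_min he.eta_pos one_pos) ((hm.condMomentBounds_U he n).mono fun ω h => h i) hφ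
  rwa [show 1 + (1 + K) = 2 + K by ring] at this

lemma lintegral_mul_Dt_sq_le (n : ℕ) (i : Fin n)
    {φ : (Fin n → Fin (p n) → ℝ) → ℝ≥0∞} (hφ : Measurable φ) :
    ∫⁻ ω, φ (controlArray (W n) ω) * ENNReal.ofReal (Dt n ω i ^ 2) ∂(P n)
      ≤ ENNReal.ofReal (2 + K) * ∫⁻ ω, φ (controlArray (W n) ω) ∂(P n) := by
  refine (lintegral_mul_sq_le_of_condDistrib (hm.measurable_controlArray n)
    (hm.measurable_Dt n i) two_pos (((hm.fourthMomentArray he).moments n).mono fun ω h => h i)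
    hφ).trans ?_
  gcongr
  norm_num

lemma lintegral_perturbed_le (hR : RemainderConditions P p W D U Dt γ δ f g rγ rδ) (n : ℕ)
    (i : Fin n) {M : ℝ≥0∞} (hM : M = ENNReal.ofReal (2 + K)) :
    ∫⁻ ω, ENNReal.ofReal ((U n ω i + rγ n (W n ω i)) ^ 2
        + (Dt n ω i + rδ n (W n ω i)) ^ 2 * (U n ω i + rγ n (W n ω i)) ^ 2) ∂(P n)
      ≤ 4 * ((M + M * M) + (1 + M) * ∫⁻ ω, ENNReal.ofReal
          (rδ n (W n ω i) ^ 2 + rγ n (W n ω i) ^ 2) ∂(P n)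
        + ∫⁻ ω, ENNReal.ofReal (rγ n (W n ω i) ^ 2 * rδ n (W n ω i) ^ 2) ∂(P n)) := by
  have mU := hm.measurable_U n i
  have mD := hm.measurable_Dt n i
  have mγ := hm.measurable_comp_row (hR.measurable_rγ n) i
  have mδ := hm.measurable_comp_row (hR.measurable_rδ n) i
  have mγ' : Measurable fun v : Fin n → Fin (p n) → ℝ => ENNReal.ofReal (rγ n (v i) ^ 2) :=
    (((hR.measurable_rγ n).comp (measurable_pi_apply i)).pow_const 2).ennreal_ofReal
  have mδ' : Measurable fun v : Fin n → Fin (p n) → ℝ => ENNReal.ofReal (rδ n (v i) ^ 2) :=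
    (((hR.measurable_rδ n).comp (measurable_pi_apply i)).pow_const 2).ennreal_ofReal
  have hDt : ∀ ω, Dt n ω i = D n ω i - controlArray (W n) ω i ⬝ᵥ δ n := fun ω => by
    rw [hm.propensity]
    exact (add_sub_cancel_left _ _).symm
  have i1 : ∫⁻ ω, ENNReal.ofReal (U n ω i ^ 2) ∂(P n) ≤ M := by
    have := hm.lintegral_mul_U_sq_le he n i (φ := fun _ => 1) measurable_const
    simpa [hM] using this
  have i2 : ∫⁻ ω, ENNReal.ofReal (Dt n ω i ^ 2) ∂(P n) ≤ M := by
    have := hm.lintegral_mul_Dt_sq_le he n i (φ := fun _ => 1) measurable_const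
    simpa [hM] using this
  have i3 : ∫⁻ ω, ENNReal.ofReal (Dt n ω i ^ 2) * ENNReal.ofReal (U n ω i ^ 2) ∂(P n)
      ≤ M * M := by
    have := hm.lintegral_mul_U_sq_le he n i
      (φ := fun v => ENNReal.ofReal ((v.1 i - v.2 i ⬝ᵥ δ n) ^ 2))
      (by simp only [dotProduct]; fun_prop)
    simp only [← hDt, ← hM] at this
    exact this.trans (by gcongr)
  have i4 := hm.lintegral_mul_Dt_sq_le he n i mγ'
  have i5 := hm.lintegral_mul_U_sq_le he n i (mδ'.comp measurable_snd)
  rw [← hM] at i4 i5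
  simp only [Function.comp_apply] at i5
  have hpt : ∀ ω, ENNReal.ofReal ((U n ω i + rγ n (W n ω i)) ^ 2
        + (Dt n ω i + rδ n (W n ω i)) ^ 2 * (U n ω i + rγ n (W n ω i)) ^ 2)
      ≤ 4 * (ENNReal.ofReal (U n ω i ^ 2) + ENNReal.ofReal (rγ n (W n ω i) ^ 2)
        + ENNReal.ofReal (Dt n ω i ^ 2) * ENNReal.ofReal (U n ω i ^ 2)
        + ENNReal.ofReal (rγ n (W n ω i) ^ 2) * ENNReal.ofReal (Dt n ω i ^ 2)
        + ENNReal.ofReal (rδ n (W n ω i) ^ 2) * ENNReal.ofReal (U n ω i ^ 2)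
        + ENNReal.ofReal (rγ n (W n ω i) ^ 2 * rδ n (W n ω i) ^ 2)) := fun ω => by
    rw [show (4 : ℝ≥0∞) = ENNReal.ofReal 4 by norm_num,
      ← ENNReal.ofReal_mul (sq_nonneg _), ← ENNReal.ofReal_mul (sq_nonneg _),
      ← ENNReal.ofReal_mul (sq_nonneg _), ← ENNReal.ofReal_add (by positivity) (by positivity),
      ← ENNReal.ofReal_add (by positivity) (by positivity),
      ← ENNReal.ofReal_add (by positivity) (by positivity),
      ← ENNReal.ofReal_add (by positivity) (by positivity),
      ← ENNReal.ofReal_add (by positivity) (by positivity),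
      ← ENNReal.ofReal_mul (by norm_num)]
    refine ENNReal.ofReal_le_ofReal ?_
    generalize U n ω i = a
    generalize Dt n ω i = b
    generalize rγ n (W n ω i) = r
    generalize rδ n (W n ω i) = q
    have k : ∀ x y : ℝ, (x + y) ^ 2 ≤ 2 * (x ^ 2 + y ^ 2) := fun x y => by
      nlinarith [sq_nonneg (x - y)]
    have h1 := k a r
    have h2 : (b + q) ^ 2 * (a + r) ^ 2 ≤ (2 * (b ^ 2 + q ^ 2)) * (2 * (a ^ 2 + r ^ 2)) :=
      mul_le_mul (k b q) h1 (sq_nonneg _) (by positivity)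
    nlinarith [sq_nonneg a, sq_nonneg r]
  have hγ : ∫⁻ ω, ENNReal.ofReal (rγ n (W n ω i) ^ 2) ∂(P n) ≤ ∫⁻ ω, ENNReal.ofReal
      (rδ n (W n ω i) ^ 2 + rγ n (W n ω i) ^ 2) ∂(P n) := lintegral_mono fun ω =>
    ENNReal.ofReal_le_ofReal (le_add_of_nonneg_left (sq_nonneg _))
  have hγδ : ∫⁻ ω, ENNReal.ofReal (rγ n (W n ω i) ^ 2) ∂(P n)
      + ∫⁻ ω, ENNReal.ofReal (rδ n (W n ω i) ^ 2) ∂(P n) = ∫⁻ ω, ENNReal.ofReal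
      (rδ n (W n ω i) ^ 2 + rγ n (W n ω i) ^ 2) ∂(P n) := by
    rw [← lintegral_add_left (mγ.pow_const 2).ennreal_ofReal]
    refine lintegral_congr fun ω => ?_
    rw [← ENNReal.ofReal_add (sq_nonneg _) (sq_nonneg _), add_comm]
  have eU := (mU.pow_const 2).ennreal_ofReal
  have eD := (mD.pow_const 2).ennreal_ofReal
  have eγ := (mγ.pow_const 2).ennreal_ofReal
  have eδ := (mδ.pow_const 2).ennreal_ofReal
  have a1 := eU.add eγ
  have a2 := a1.add (eD.mul eU)
  have a3 := a2.add (eγ.mul eD)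
  have a4 := a3.add (eδ.mul eU)
  refine (lintegral_mono hpt).trans ?_
  rw [lintegral_const_mul _
      (by exact a4.add ((mγ.pow_const 2).mul (mδ.pow_const 2)).ennreal_ofReal),
    lintegral_add_left (by exact a4), lintegral_add_left (by exact a3),
    lintegral_add_left (by exact a2), lintegral_add_left (by exact a1),
    lintegral_add_left (by exact eU)]
  gcongr 4 * (?_ + _)
  calc _ ≤ M + (∫⁻ ω, ENNReal.ofReal (rγ n (W n ω i) ^ 2) ∂(P n)) + M * M
        + M * (∫⁻ ω, ENNReal.ofReal (rγ n (W n ω i) ^ 2) ∂(P n))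
        + M * ∫⁻ ω, ENNReal.ofReal (rδ n (W n ω i) ^ 2) ∂(P n) := by
        gcongr
    _ = (M + M * M) + ((∫⁻ ω, ENNReal.ofReal (rγ n (W n ω i) ^ 2) ∂(P n))
        + M * ((∫⁻ ω, ENNReal.ofReal (rγ n (W n ω i) ^ 2) ∂(P n))
        + ∫⁻ ω, ENNReal.ofReal (rδ n (W n ω i) ^ 2) ∂(P n))) := by ring
    _ ≤ _ := by
        rw [hγδ, add_mul, one_mul]
        gcongr

lemma isBigOpOne_mean_perturbed (hR : RemainderConditions P p W D U Dt γ δ f g rγ rδ) :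
    IsBigOpOne P fun n ω => (∑ i, ((U n ω i + rγ n (W n ω i)) ^ 2
      + (Dt n ω i + rδ n (W n ω i)) ^ 2 * (U n ω i + rγ n (W n ω i)) ^ 2)) / n := by
  obtain ⟨C, hC⟩ := hR.mean_product
  set M := ENNReal.ofReal (2 + K) with hM
  have mB : ∀ n i, Measurable fun ω => U n ω i + rγ n (W n ω i) := fun n i =>
    (hm.measurable_U n i).add (hm.measurable_comp_row (hR.measurable_rγ n) i)
  have mA : ∀ n i, Measurable fun ω => Dt n ω i + rδ n (W n ω i) := fun n i =>
    (hm.measurable_Dt n i).add (hm.measurable_comp_row (hR.measurable_rδ n) i)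
  have mF : ∀ n i, Measurable fun ω => (U n ω i + rγ n (W n ω i)) ^ 2
      + (Dt n ω i + rδ n (W n ω i)) ^ 2 * (U n ω i + rγ n (W n ω i)) ^ 2 := fun n i =>
    ((mB n i).pow_const 2).add (((mA n i).pow_const 2).mul ((mB n i).pow_const 2))
  set T : ℝ≥0∞ := 4 * ((M + M * M) + (1 + M) * 1 + ENNReal.ofReal C) with hT
  have hTt : T ≠ ∞ := by
    have : M ≠ ∞ := ENNReal.ofReal_ne_top
    finiteness
  refine isBigOpOne_of_lintegral_le (C := T.toReal) (fun n =>
    ((Finset.measurable_sum _ fun i _ => mF n i).div_const _).aemeasurable) ?_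
  filter_upwards [hC, hR.mean_square.eventually (gt_mem_nhds one_pos), eventually_gt_atTop 0]
    with n h1 h2 hn
  rw [ENNReal.ofReal_toReal hTt, lintegral_ofReal_abs_mean (mF n) fun i ω => by positivity]
  have hn0 : (n : ℝ≥0∞) ≠ 0 := by exact_mod_cast hn.ne'
  refine (ENNReal.div_le_div_right (Finset.sum_le_sum fun i _ =>
    hm.lintegral_perturbed_le he hR n i hM) _).trans ?_
  rw [← Finset.mul_sum, Finset.sum_add_distrib, Finset.sum_add_distrib, ← Finset.mul_sum,
    Finset.sum_const, Finset.card_univ, Fintype.card_fin, nsmul_eq_mul, mul_div_assoc,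
    ENNReal.add_div, ENNReal.add_div, mul_div_assoc, ENNReal.mul_div_cancel hn0
      (ENNReal.natCast_ne_top n), mul_div_assoc]
  rw [hT]
  gcongr

end IsLinearModel

end Remainders

section FeasibleVariance

variable {Ω : ℕ → Type*} [∀ n, MeasurableSpace (Ω n)] {P : ∀ n, Measure (Ω n)}
  {p : ℕ → ℕ} {W : ∀ n, Ω n → Matrix (Fin n) (Fin (p n)) ℝ}
  {Y D U Dt : ∀ n, Ω n → Fin n → ℝ} {β : ℕ → ℝ} {γ δ : ∀ n, Fin (p n) → ℝ} {K η c C : ℝ}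
  {f g rγ rδ : ∀ n, (Fin (p n) → ℝ) → ℝ} {Uhat Dhat : ∀ n, Ω n → Fin n → ℝ}

lemma ResidualAccuracy.exists_tendsto_zero (hA : ResidualAccuracy P p W U Dt rγ rδ Uhat Dhat) :
    ∃ e : (Σ n, Ω n) → ℝ, Tendsto e (wpFilter P) (𝓝 0) ∧ ∀ x : Σ n, Ω n, ∀ i,
      |Uhat x.1 x.2 i - (U x.1 x.2 i + rγ x.1 (W x.1 x.2 i))| ≤ e x ∧
      |Dhat x.1 x.2 i - (Dt x.1 x.2 i + rδ x.1 (W x.1 x.2 i))| ≤ e x := by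
  refine ⟨_, isLittleOpOne_iff.1 hA.accurate, fun x i => ?_⟩
  have h : ∀ v w : Fin x.1 → ℝ, |v i| ≤ (⨆ i, |v i|) + ⨆ i, |w i| ∧
      |w i| ≤ (⨆ i, |v i|) + ⨆ i, |w i| := fun v w => by
    have h1 := le_ciSup (Set.finite_range fun i => |v i|).bddAbove i
    have h2 := le_ciSup (Set.finite_range fun i => |w i|).bddAbove i
    have h3 := (abs_nonneg _).trans h1
    have h4 := (abs_nonneg _).trans h2
    exact ⟨by linarith, by linarith⟩
  simp only [← sub_sub]
  exact h (fun i => Uhat x.1 x.2 i - U x.1 x.2 i - rγ x.1 (W x.1 x.2 i))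
    (fun i => Dhat x.1 x.2 i - Dt x.1 x.2 i - rδ x.1 (W x.1 x.2 i))

namespace IsLinearModel

variable (hm : IsLinearModel P p W Y D U Dt β γ δ)

include hm

lemma eventually_perturbed_bounds (hR : RemainderConditions P p W D U Dt γ δ f g rγ rδ)
    (hc : 0 < c)
    (hb : ∀ᶠ x in wpFilter P, ResidualBounds (W x.1 x.2) (D x.1 x.2) (Dt x.1 x.2) c C) :
    ∀ᶠ x in wpFilter P,
      c / 4 * x.1 ≤ ∑ i, (Dt x.1 x.2 i + rδ x.1 (W x.1 x.2 i)) ^ 2 ∧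
      ∑ i, (Dt x.1 x.2 i + rδ x.1 (W x.1 x.2 i)) ^ 2 ≤ (2 * C + c) * x.1 := by
  filter_upwards [hb, (hm.tendsto_mean_remainder_sq hR).eventually
    (gt_mem_nhds (show 0 < c / 4 by positivity))] with x hx hr
  rw [div_lt_iff₀ hx.pos] at hr
  have h1 := half_sum_sq_sub_le (Dt x.1 x.2) fun i => Dt x.1 x.2 i + rδ x.1 (W x.1 x.2 i)
  have h2 := half_sum_sq_sub_le (fun i => Dt x.1 x.2 i + rδ x.1 (W x.1 x.2 i)) (Dt x.1 x.2)
  simp only [add_sub_cancel_left, sub_add_cancel_left, neg_sq] at h1 h2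
  have h3 := hx.le_sum_sq hc
  have h4 := hx.le_upper
  have h5 := mul_pos hc hx.pos
  constructor <;> linarith

variable [∀ n, IsProbabilityMeasure (P n)] (he : ErrorConditions P p W D U Dt K η)

include he

lemma exists_eventually_perturbed_variance_le (hc : 0 < c) (hC : 0 < C)
    (hb : ∀ᶠ x in wpFilter P, ResidualBounds (W x.1 x.2) (D x.1 x.2) (Dt x.1 x.2) c C)
    (hR : RemainderConditions P p W D U Dt γ δ f g rγ rδ) :
    ∃ M : ℝ, ∀ᶠ x in wpFilter P, x.1 * ∑ i, hausmanWeight (W x.1 x.2) (D x.1 x.2)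
      (fun k => Dt x.1 x.2 k + rδ x.1 (W x.1 x.2 k)) i ^ 2
        * (U x.1 x.2 i + rγ x.1 (W x.1 x.2 i)) ^ 2 ≤ M := by
  obtain ⟨a, b, ha, -, hab⟩ := hm.exists_hausmanScale_bounds he hc hC hb
  refine ⟨2 * b + 1, ?_⟩
  filter_upwards [hab, hb, hm.eventually_hausmanScale_pos he hc hC hb,
    (hm.tendsto_sum_sq_div_hausmanScale he hc hC hb).eventually (gt_mem_nhds one_lt_two),
    (isLittleOpOne_iff.1 hR.negligible).eventually (lt_mem_nhds (neg_one_lt_zero))]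
    with x hx hx' hσ h1 h2
  rw [div_lt_iff₀ (by positivity)] at h1
  rw [Finset.sum_sub_distrib, mul_sub] at h2
  have h3 := mul_le_mul_of_nonneg_left h1.le hx'.pos.le
  have h4 := hx.2
  linarith

lemma tendsto_variance_sub_feasible (hc : 0 < c) (hC : 0 < C)
    (hb : ∀ᶠ x in wpFilter P, ResidualBounds (W x.1 x.2) (D x.1 x.2) (Dt x.1 x.2) c C)
    (hR : RemainderConditions P p W D U Dt γ δ f g rγ rδ)
    (hA : ResidualAccuracy P p W U Dt rγ rδ Uhat Dhat) :
    Tendsto (fun x : Σ n, Ω n => x.1 * (∑ i,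
      hausmanWeight (W x.1 x.2) (D x.1 x.2) (Dt x.1 x.2) i ^ 2 * U x.1 x.2 i ^ 2
      - ∑ i, hausmanWeight (W x.1 x.2) (D x.1 x.2) (Dhat x.1 x.2) i ^ 2 * Uhat x.1 x.2 i ^ 2))
      (wpFilter P) (𝓝 0) := by
  obtain ⟨e, he0, hle⟩ := hA.exists_tendsto_zero
  obtain ⟨M, hM⟩ := hm.exists_eventually_perturbed_variance_le he hc hC hb hR
  set H : ∀ n, Ω n → ℝ := fun n ω => (∑ i, ((U n ω i + rγ n (W n ω i)) ^ 2
      + (Dt n ω i + rδ n (W n ω i)) ^ 2 * (U n ω i + rγ n (W n ω i)) ^ 2)) / n with hH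
  have hHO : IsBigOpOne P H := hm.isBigOpOne_mean_perturbed he hR
  have hHe := hHO.tendsto_mul (Y := fun n ω => e ⟨n, ω⟩) he0
  set c' := c / 16 with hc'
  have hc'0 : 0 < c' := by positivity
  set q := 16 * ((2 + (2 * C + c)) / c' ^ 2 + 1 / c') ^ 2 with hq
  have key : Tendsto (fun x : Σ n, Ω n => x.1 * (∑ i,
      hausmanWeight (W x.1 x.2) (D x.1 x.2) (Dhat x.1 x.2) i ^ 2 * Uhat x.1 x.2 i ^ 2
      - ∑ i, hausmanWeight (W x.1 x.2) (D x.1 x.2)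
        (fun k => Dt x.1 x.2 k + rδ x.1 (W x.1 x.2 k)) i ^ 2
        * (U x.1 x.2 i + rγ x.1 (W x.1 x.2 i)) ^ 2)) (wpFilter P) (𝓝 0) := by
    have hz := (he0.mul_const (q * (1 + (2 * C + c)) + 16 / c' + M)).add (hHe.const_mul q)
    rw [zero_mul, mul_zero, add_zero] at hz
    refine squeeze_zero_norm' ?_ hz
    have he2 := he0.pow 2
    rw [zero_pow two_ne_zero] at he2
    filter_upwards [hb, hm.eventually_perturbed_bounds hR hc hb, hM,
      he0.eventually (gt_mem_nhds one_pos), he2.eventually (gt_mem_nhds hc'0)]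
      with x hx hAx hMx he1 he2
    have hn := hx.pos
    have hcn := mul_pos hc'0 hn
    have hex : 0 ≤ e x := (abs_nonneg _).trans (hle x ⟨0, by exact_mod_cast hn⟩).1
    have h3 : c' * x.1 ≤ ∑ i, Dhat x.1 x.2 i ^ 2 := by
      have h := half_sum_sq_sub_le (fun i => Dt x.1 x.2 i + rδ x.1 (W x.1 x.2 i)) (Dhat x.1 x.2)
      have h' := sum_sq_le_natCast_mul fun i => (hle x i).2
      have h'' : x.1 * e x ^ 2 ≤ x.1 * c' := by gcongr
      have := hAx.1
      rw [show c / 4 = 4 * c' by rw [hc']; ring] at this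
      linarith
    have h1 : c' * x.1 ≤ ∑ i, olsResidual (W x.1 x.2) (D x.1 x.2) i ^ 2 := by
      have := hx.le_residual
      rw [show c = 16 * c' by rw [hc']; ring] at this
      linarith
    have h2 : c' * x.1 ≤ ∑ i, (Dt x.1 x.2 i + rδ x.1 (W x.1 x.2 i)) ^ 2 := by
      have := hAx.1
      rw [show c / 4 = 4 * c' by rw [hc']; ring] at this
      linarith
    have h := abs_sum_hausmanWeight_sq_mul_sq_sub_le (W := W x.1 x.2) (D := D x.1 x.2) hn hc'0
      (by positivity : 0 ≤ 2 * C + c) he1.le (fun i => (hle x i).2) (fun i => (hle x i).1) h1 h2 h3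
      hAx.2
    rw [Real.norm_eq_abs]
    refine h.trans ?_
    calc _ ≤ e x * (q * (1 + (2 * C + c) + H x.1 x.2) + 16 / c' + M) := by gcongr
      _ = _ := by ring
  have h3 := (isLittleOpOne_iff.1 hR.negligible).sub key
  rw [sub_zero] at h3
  refine h3.congr fun x => ?_
  rw [Finset.sum_sub_distrib]
  ring

end IsLinearModel

end FeasibleVariance

theorem lemma4 {Ω : ℕ → Type*} [∀ n, MeasurableSpace (Ω n)] (P : ∀ n, Measure (Ω n))
    [∀ n, IsProbabilityMeasure (P n)]
    (p : ℕ → ℕ) (W : ∀ n, Ω n → Matrix (Fin n) (Fin (p n)) ℝ)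
    (Y D U Dt : ∀ n, Ω n → Fin n → ℝ)
    (β : ℕ → ℝ) (γ δ : ∀ n, Fin (p n) → ℝ)
    (hmodel : IsLinearModel P p W Y D U Dt β γ δ)
    (K η : ℝ) (herr : ErrorConditions P p W D U Dt K η)
    (hliminf : 0 < liminf (fun n => (p n : ℝ≥0∞) / (n : ℝ≥0∞)) atTop)
    (hrank : ∃ c : ℝ, 0 < c ∧
      Tendsto (fun n => P n {ω | ((W n ω).rank : ℝ) < c * p n}) atTop (𝓝 0))
    (βstar : ∀ n, Ω n → ℝ) (hstar : IsEfficientEstimator P U Dt β βstar) :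
    TendstoInDistribution
      (fun n ω => (betaOLS (W n ω) (D n ω) (Y n ω) - βstar n ω)
        / hausmanSE (W n ω) (D n ω) (Dt n ω) (U n ω))
      atTop (id : ℝ → ℝ) P (gaussianReal 0 1) ∧
    ∀ (f g rγ rδ : ∀ n, (Fin (p n) → ℝ) → ℝ) (Uhat Dhat : ∀ n, Ω n → Fin n → ℝ),
      RemainderConditions P p W D U Dt γ δ f g rγ rδ →
      ResidualAccuracy P p W U Dt rγ rδ Uhat Dhat →
      TendstoInDistribution
        (fun n ω => (betaOLS (W n ω) (D n ω) (Y n ω) - βstar n ω)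
          / hausmanSE (W n ω) (D n ω) (Dhat n ω) (Uhat n ω))
        atTop (id : ℝ → ℝ) P (gaussianReal 0 1) := by
  obtain ⟨c, C, hc, hC, hb⟩ := hmodel.exists_residualBounds herr hliminf hrank
  refine ⟨hmodel.tendstoInDistribution_contrast_div herr hc hC hb hstar
    (fun n => measurable_hausmanSE (hmodel.measurable_W n) (hmodel.measurable_D n)
      (hmodel.measurable_Dt n) (hmodel.measurable_U n))
    (hmodel.tendsto_sqrt_div_hausmanScale herr hc hC hb (v := fun n ω => ∑ i,
      hausmanWeight (W n ω) (D n ω) (Dt n ω) i ^ 2 * U n ω i ^ 2)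
      (by simpa using tendsto_const_nhds)), ?_⟩
  intro f g rγ rδ Uhat Dhat hR hA
  exact hmodel.tendstoInDistribution_contrast_div herr hc hC hb hstar
    (fun n => measurable_hausmanSE (hmodel.measurable_W n) (hmodel.measurable_D n)
      (hA.measurable_Dhat n) (hA.measurable_Uhat n))
    (hmodel.tendsto_sqrt_div_hausmanScale herr hc hC hb (v := fun n ω => ∑ i,
      hausmanWeight (W n ω) (D n ω) (Dhat n ω) i ^ 2 * Uhat n ω i ^ 2)
      (hmodel.tendsto_variance_sub_feasible herr hc hC hb hR hA))
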